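/- **Theorem (Local acyclicity of the reduced Koszul–Tate operator).** *Starting point.* Let $\varphi^i$, $i=1,\dots,m_{-1}$, be finitely many real commuting or anticommuting variables of Grassmann parity $\varepsilon_i$, with values in an open superdomain $D$ (a smooth function on $D$ is a polynomial in the odd $\varphi^i$ whose coefficients are smooth in the even ones). Let $L\ge 0$, let $m_0,\dots,m_L\ge 0$, put $m_s:=0$ for $s>L$ and $M_s:=\sum_{r\ge 0}(-1)^r m_{r+s}$. Let index values $\alpha_s\in\{1,\dots,m_s\}$ carry parities $\varepsilon_{\alpha_s}$, where $\alpha_{-1}\equiv i$. Let there be given an even smooth function $S_0$ on $D$ with right derivatives $T_i:=S_0\frac{\overleftarrow\partial}{\partial\varphi^i}$, and smooth matrices $Z^{\alpha_{s-1}}{}_{\alpha_s}$ on $D$, $s=0,\dots,L$, whose entries have parity $\varepsilon_{\alpha_{s-1}}+\varepsilon_{\alpha_s}$; write $R^i{}_{\alpha_0}:=Z^{\alpha_{-1}}{}_{\alpha_0}$. For a function $f$ on an open $U\subseteq D$ write $f\approx 0$ if $f=\sum_i T_i b^i$ for some smooth functions $b^i$ on $U$. Assume the Noether identities $$T_iR^i{}_{\alpha_0}=0,\qquad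 Z^{\alpha_{s-2}}{}_{\alpha_{s-1}}Z^{\alpha_{s-1}}{}_{\alpha_s}\approx 0\quad(s=1,\dots,L)$$ and, at every point of the stationary surface $\{T_i=0\}$, the rank conditions $$\operatorname{rank}\Bigl(\tfrac{\overrightarrow\partial}{\partial\varphi^i}S_0\tfrac{\overleftarrow\partial}{\partial\varphi^j}\Bigr)=M_{-1},\qquad \operatorname{rank}(Z^{\alpha_{s-1}}{}_{\alpha_s})=M_s\quad(s=0,\dots,L).$$ (Points of $D$ are points of its underlying space of even variables, and ranks and equations at a point refer to the values there, with the odd variables set to zero.) *Transversal and longitudinal fields.* On an open $U\subseteq D$, these are new coordinates $\bar\varphi=(\xi^I,\theta^A)$ with invertible Jacobian matrix, with the same parities as the $\varphi^i$ up to relabelling, with exactly $M_{-1}$ transversal fields $\xi^I$, and such that $\bigl(\xi^I\frac{\overleftarrow\partial}{\partial\varphi^i}\bigr)R^i{}_{\alpha_0}\approx0$ and $\xi^I\approx0$. *Fields and antifields.* Adjoin ghosts $c^{\alpha_s}$ of parity $\varepsilon_{\alpha_s}+s+1$ ($0\le s\le L$) and antifields $\Phi^*_{\alpha_s}$ of parity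 $\varepsilon_{\alpha_s}+s$ ($-1\le s\le L$; $\varphi^*_i=\Phi^*_{\alpha_{-1}}$ and $c^*_{\alpha_s}=\Phi^*_{\alpha_s}$ for $s\ge0$). Let $\mathcal A(U)$ be the algebra of smooth functions of all these variables with $\varphi\in U$; an *operator* is an $\mathbb R$-linear map $X:\mathcal A(U)\to\mathcal A(U)$. Let $$K:=\xi^I\frac{\partial}{\partial\xi^I}+\sum_{s=-1}^{L}\Phi^*_{\alpha_s}\frac{\partial}{\partial\Phi^*_{\alpha_s}}$$ (left derivatives, $\partial/\partial\xi^I$ taken at fixed $\theta$, ghosts and antifields). An operator $X$ has reduced antifield number $\operatorname{rafn}(X)=r\in\mathbb Z$ if $[K,X]=rX$. Expand $$T_i=T_{[1]i}+O(\xi^2),\quad T_{[1]i}=\xi^Ih_{Ii},\qquad Z^{\alpha_{s-1}}{}_{\alpha_s}=Z^{\alpha_{s-1}}_{[0]\alpha_s}+O(\xi),$$ where $h_{Ii}$ and $Z_{[0]}$ depend on $\theta$ only (their derivatives $\partial/\partial\xi^I$ vanish) and $O(\xi^k)$ denotes the $k$-th power of the ideal generated by the $\xi^I$. The reduced Koszul–Tate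 operator is $$\delta:=T_{[1]i}\frac{\partial}{\partial\varphi^*_i}+\sum_{s=0}^L\Phi^*_{\alpha_{s-1}}Z^{\alpha_{s-1}}_{[0]\alpha_s}\frac{\partial}{\partial c^*_{\alpha_s}} .$$ *Claim.* Let $p$ be a point of the stationary surface. Then transversal and longitudinal fields exist on some open neighbourhood of $p$ in $D$. Moreover, for every open neighbourhood $U'\subseteq D$ of $p$ and every choice of transversal and longitudinal fields on $U'$ there is an open neighbourhood $U\subseteq U'$ of $p$ on which $T_{[1]i}$ and $Z_{[0]}$ exist, and on which, for any such $T_{[1]i}$ and $Z_{[0]}$, the operator $\delta$ satisfies $\delta^2=0$ and its operator cohomology is trivial in non-zero reduced antifield number: $$\forall\text{ operators }X\text{ on }\mathcal A(U):\quad [\delta,X]=0\ \wedge\ \operatorname{rafn}(X)\neq0\ \Longrightarrow\ \exists\text{ an operator }Y:\ X=[\delta,Y],$$ where $[\cdot,\cdot]$ is the graded commutator. -/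

import Mathlib

open scoped ContDiff
open TopologicalSpace (Opens)

/-! ### Smooth functions of commuting and anticommuting variables

A finite, linearly ordered family `V` of variables is given with Grassmann parities `π : V → ZMod 2`.
The even variables are real coordinates, the odd ones generate a Grassmann algebra. -/

/-- The even (commuting) variables. -/
abbrev EvenIdx {V : Type*} (π : V → ZMod 2) : Type _ := {v : V // π v = 0}

/-- The odd (anticommuting) variables. -/
abbrev OddIdx {V : Type*} (π : V → ZMod 2) : Type _ := {v : V // π v ≠ 0}

/-- The superfunctions over an open set `W` in the space of the even variables: formal sums
`f = ∑ S, f S · η_S`, where `η_S` is the product of the odd variables in `S` in increasing order and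
the coefficients `f S` are smooth on `W`. A coefficient is recorded as a function on the whole space
that is zero outside `W`, so that equal functions on `W` are equal. -/
def SuperFun {V : Type*} [Fintype V] (π : V → ZMod 2) (W : Opens (EvenIdx π → ℝ)) :
    Submodule ℝ (Finset (OddIdx π) → (EvenIdx π → ℝ) → ℝ) where
  carrier := {f | ∀ S, ContDiffOn ℝ ∞ (f S) W ∧ ∀ x ∉ W, f S x = 0}
  add_mem' := fun hf hg S =>
    ⟨(hf S).1.add (hg S).1, fun x hx => by simp [(hf S).2 x hx, (hg S).2 x hx]⟩
  zero_mem' := fun S => ⟨contDiffOn_const, fun _ _ => rfl⟩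
  smul_mem' := fun c f hf S =>
    ⟨(hf S).1.const_smul c, fun x hx => by simp [(hf S).2 x hx]⟩

namespace SuperFun

section Basic

variable {V : Type*} [Fintype V] {π : V → ZMod 2} {W : Opens (EvenIdx π → ℝ)}

/-- The body of a superfunction: its part of degree zero in the odd variables. -/
def body (f : SuperFun π W) (x : EvenIdx π → ℝ) : ℝ := f.1 ∅ x

/-- `f` is homogeneous of Grassmann parity `a`. -/
def HasParity (f : SuperFun π W) (a : ZMod 2) : Prop :=
  ∀ S : Finset (OddIdx π), (S.card : ZMod 2) ≠ a → f.1 S = 0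

/-- The parity operator: the identity on even and minus the identity on odd superfunctions. -/
noncomputable def parityOp : SuperFun π W →ₗ[ℝ] SuperFun π W where
  toFun f := ⟨fun S => (-1 : ℝ) ^ S.card • f.1 S, fun S =>
    ⟨(f.2 S).1.const_smul ((-1 : ℝ) ^ S.card), fun x hx => by simp [(f.2 S).2 x hx]⟩⟩
  map_add' f g := by
    apply Subtype.ext; funext S
    exact smul_add ((-1 : ℝ) ^ S.card) (f.1 S) (g.1 S)
  map_smul' c f := by
    apply Subtype.ext; funext S
    exact smul_comm ((-1 : ℝ) ^ S.card) c (f.1 S)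

/-- Restriction to a smaller open set. -/
noncomputable def res {U : Opens (EvenIdx π → ℝ)} (h : U ≤ W) (f : SuperFun π W) :
    SuperFun π U :=
  ⟨fun S => (U : Set (EvenIdx π → ℝ)).indicator (f.1 S), fun S =>
    ⟨((f.2 S).1.mono h).congr fun _ hx => Set.indicator_of_mem hx _,
      fun _ hx => Set.indicator_of_notMem hx _⟩⟩

end Basic

section Ordered

variable {V : Type*} [Fintype V] [LinearOrder V] {π : V → ZMod 2} {W : Opens (EvenIdx π → ℝ)}

/-- The constant function `1`. -/
noncomputable instance : One (SuperFun π W) :=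
  ⟨⟨fun S => if S = ∅ then (W : Set (EvenIdx π → ℝ)).indicator (fun _ => 1) else 0, fun S => by
    by_cases hS : S = ∅
    · simp only [hS, if_true]
      exact ⟨contDiffOn_const.congr fun _ hx => Set.indicator_of_mem hx _,
        fun _ hx => Set.indicator_of_notMem hx _⟩
    · simp only [hS, if_false]
      exact ⟨contDiffOn_const, fun _ _ => rfl⟩⟩⟩

/-- The number of transpositions that sort `η_A η_B`. -/
def inversions (A B : Finset (OddIdx π)) : ℕ := ((A ×ˢ B).filter fun p => p.2 < p.1).card

/-- The product: `η_A η_B = ± η_{A ∪ B}` for disjoint `A`, `B`, and zero otherwise. -/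
noncomputable instance : Mul (SuperFun π W) :=
  ⟨fun f g => ⟨fun S x => ∑ A ∈ S.powerset,
      (-1 : ℝ) ^ inversions A (S \ A) * (f.1 A x * g.1 (S \ A) x), fun S =>
    ⟨ContDiffOn.sum fun A _ =>
        (contDiffOn_const (c := (-1 : ℝ) ^ inversions A (S \ A))).mul
          ((f.2 A).1.mul (g.2 (S \ A)).1),
      fun x hx => Finset.sum_eq_zero fun A _ => by simp [(f.2 A).2 x hx]⟩⟩⟩

/-- The variable `v` as a superfunction. -/
noncomputable def var (v : V) : SuperFun π W :=
  if h : π v = 0 then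
    ⟨fun S => if S = ∅ then (W : Set (EvenIdx π → ℝ)).indicator (fun x => x ⟨v, h⟩) else 0,
      fun S => by
        by_cases hS : S = ∅
        · simp only [hS, if_true]
          exact ⟨(contDiff_apply ℝ ℝ (⟨v, h⟩ : EvenIdx π)).contDiffOn.congr
            fun _ hx => Set.indicator_of_mem hx _, fun _ hx => Set.indicator_of_notMem hx _⟩
        · simp only [hS, if_false]
          exact ⟨contDiffOn_const, fun _ _ => rfl⟩⟩
  else
    ⟨fun S => if S = {⟨v, h⟩} then (W : Set (EvenIdx π → ℝ)).indicator (fun _ => 1) else 0,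
      fun S => by
        by_cases hS : S = {⟨v, h⟩}
        · simp only [hS, if_true]
          exact ⟨contDiffOn_const.congr fun _ hx => Set.indicator_of_mem hx _,
            fun _ hx => Set.indicator_of_notMem hx _⟩
        · simp only [hS, if_false]
          exact ⟨contDiffOn_const, fun _ _ => rfl⟩⟩

/-- Left multiplication by `a`, as an operator. -/
noncomputable def mulLeft (a : SuperFun π W) : SuperFun π W →ₗ[ℝ] SuperFun π W where
  toFun f := a * f
  map_add' f g := by
    apply Subtype.ext; funext S x
    refine Eq.trans (Finset.sum_congr rfl fun A _ => ?_) Finset.sum_add_distrib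
    change _ * (_ * (f.1 _ x + g.1 _ x)) = _
    ring
  map_smul' c f := by
    apply Subtype.ext; funext S x
    refine Eq.trans (Finset.sum_congr rfl fun A _ => ?_) (Finset.mul_sum _ _ c).symm
    change _ * (_ * (c * f.1 _ x)) = _
    ring

/-- The partial derivative with respect to an even variable. -/
noncomputable def dEven (v : EvenIdx π) : SuperFun π W →ₗ[ℝ] SuperFun π W where
  toFun f := ⟨fun S => (W : Set (EvenIdx π → ℝ)).indicator
      (fun x => fderiv ℝ (f.1 S) x (Pi.single v 1)), fun S =>
    ⟨(((f.2 S).1.fderiv_of_isOpen W.isOpen (m := ∞) (by simp)).clm_apply contDiffOn_const).congr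
        fun _ hx => Set.indicator_of_mem hx _,
      fun _ hx => Set.indicator_of_notMem hx _⟩⟩
  map_add' f g := by
    apply Subtype.ext; funext S x
    by_cases hx : x ∈ (W : Set (EvenIdx π → ℝ))
    · have hd : ∀ k : SuperFun π W, DifferentiableAt ℝ (k.1 S) x := fun k =>
        ((k.2 S).1.contDiffAt (W.isOpen.mem_nhds hx)).differentiableAt (by simp)
      have := congrArg (fun F => F (Pi.single v 1)) (fderiv_add (hd f) (hd g))
      simpa [Set.indicator_of_mem hx] using this
    · simp [Set.indicator_of_notMem hx]
  map_smul' c f := by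
    apply Subtype.ext; funext S x
    by_cases hx : x ∈ (W : Set (EvenIdx π → ℝ))
    · have hd : DifferentiableAt ℝ (f.1 S) x :=
        ((f.2 S).1.contDiffAt (W.isOpen.mem_nhds hx)).differentiableAt (by simp)
      have := congrArg (fun F => F (Pi.single v 1)) (fderiv_const_smul hd c)
      simpa [Set.indicator_of_mem hx] using this
    · simp [Set.indicator_of_notMem hx]

/-- The derivative with respect to an odd variable `v`, where `n v S` is the number of variables that
`v` has to pass before it is removed from `η_{S ∪ {v}}`. -/
noncomputable def dOdd (n : OddIdx π → Finset (OddIdx π) → ℕ) (v : OddIdx π) :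
    SuperFun π W →ₗ[ℝ] SuperFun π W where
  toFun f := ⟨fun S => if v ∈ S then 0 else (-1 : ℝ) ^ n v S • f.1 (insert v S), fun S => by
    by_cases hS : v ∈ S
    · simp only [hS, if_true]
      exact ⟨contDiffOn_const, fun _ _ => rfl⟩
    · simp only [hS, if_false]
      exact ⟨(f.2 _).1.const_smul ((-1 : ℝ) ^ n v S), fun x hx => by simp [(f.2 _).2 x hx]⟩⟩
  map_add' f g := by
    apply Subtype.ext; funext S
    by_cases hS : v ∈ S
    · simp [hS]
    · simp [hS]
  map_smul' c f := by
    apply Subtype.ext; funext S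
    by_cases hS : v ∈ S
    · simp [hS]
    · simp [hS, smul_comm c ((-1 : ℝ) ^ n v S) (f.1 (insert v S))]

/-- The left derivative `∂f/∂v` (it acts from the left). -/
noncomputable def dL (v : V) : SuperFun π W →ₗ[ℝ] SuperFun π W :=
  if h : π v = 0 then dEven ⟨v, h⟩
  else dOdd (fun v S => (S.filter fun t => t < v).card) ⟨v, h⟩

/-- The right derivative `f ∂/∂v` (it acts from the right). -/
noncomputable def dR (v : V) : SuperFun π W →ₗ[ℝ] SuperFun π W :=
  if h : π v = 0 then dEven ⟨v, h⟩
  else dOdd (fun v S => (S.filter fun t => v < t).card) ⟨v, h⟩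

end Ordered

section Lift

variable {V V' : Type*} [Fintype V] [LinearOrder V] [Fintype V'] [LinearOrder V']
  {π : V → ZMod 2} {π' : V' → ZMod 2} (j : V ↪o V') (hj : ∀ v, π' (j v) = π v)

/-- The projection of the space of all even variables to the ones in the image of `j`. -/
def proj (x : EvenIdx π' → ℝ) : EvenIdx π → ℝ := fun v => x ⟨j v.1, (hj v.1).trans v.2⟩

/-- The cylinder over `W`. -/
def cylinder (W : Opens (EvenIdx π → ℝ)) : Opens (EvenIdx π' → ℝ) :=
  ⟨proj j hj ⁻¹' W, W.isOpen.preimage (continuous_pi fun _ => continuous_apply _)⟩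

/-- The inclusion of the odd variables along `j`. -/
def oddIncl : OddIdx π ↪ OddIdx π' :=
  ⟨fun v => ⟨j v.1, fun h => v.2 ((hj v.1).symm.trans h)⟩, fun _ _ h =>
    Subtype.ext (j.injective (congrArg Subtype.val h))⟩

/-- A superfunction of the variables `V`, regarded as a superfunction of the variables `V'`. -/
noncomputable def lift {W : Opens (EvenIdx π → ℝ)} (f : SuperFun π W) :
    SuperFun π' (cylinder j hj W) :=
  ⟨fun S x => ∑ A : Finset (OddIdx π), if A.map (oddIncl j hj) = S then f.1 A (proj j hj x) else 0,
    fun S => by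
      constructor
      · refine ContDiffOn.sum fun A _ => ?_
        by_cases hA : A.map (oddIncl j hj) = S
        · simp only [hA, if_true]
          exact (f.2 A).1.comp
            (contDiff_pi.2 fun v => contDiff_apply ℝ ℝ _).contDiffOn fun x hx => hx
        · simp only [hA, if_false]
          exact contDiffOn_const
      · intro x hx
        refine Finset.sum_eq_zero fun A _ => ?_
        split_ifs
        · exact (f.2 A).2 _ hx
        · rfl⟩

end Lift

end SuperFun

open SuperFun

/-! ### Reducible gauge theories -/

/-- The starting point: an action and its gauge generators. The index `k = s + 1` counts the stages:
`k = 0` labels the original fields `φ^i`, and `k ≥ 1` the gauge(-for-gauge)^{k-1} symmetries. Thus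
`Z 0` is the matrix `R^i_{α₀}`, and `Z k` is the matrix `Z^{α_{k-1}}_{α_k}`. -/
structure GaugeData where
  /-- the number of reducibility stages -/
  L : ℕ
  /-- the multiplicities `m_{k-1}` -/
  m : ℕ → ℕ
  /-- the Grassmann parities `ε_{α_{k-1}}` -/
  ε : ∀ k, Fin (m k) → ZMod 2
  /-- the domain of the original fields (a neighbourhood of the stationary surface) -/
  D : Opens (EvenIdx (ε 0) → ℝ)
  /-- the original action -/
  S₀ : SuperFun (ε 0) D
  /-- the generators -/
  Z : ∀ k, Fin (m k) → Fin (m (k + 1)) → SuperFun (ε 0) D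

namespace GaugeData

variable (G : GaugeData)

/-- Functions of the original fields over `U`. -/
abbrev Fun (U : Opens (EvenIdx (G.ε 0) → ℝ)) : Type := SuperFun (G.ε 0) U

/-- The equations of motion `T_i = S₀ ∂/∂φ^i`, over `U`. -/
noncomputable def T {U : Opens (EvenIdx (G.ε 0) → ℝ)} (hU : U ≤ G.D) (i : Fin (G.m 0)) : G.Fun U :=
  res hU (dR i G.S₀)

/-- `f ≈ 0` over `U`: equality to zero modulo the equations of motion. -/
def WeakZero {U : Opens (EvenIdx (G.ε 0) → ℝ)} (hU : U ≤ G.D) (f : G.Fun U) : Prop :=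
  ∃ b : Fin (G.m 0) → G.Fun U, f = ∑ i, G.T hU i * b i

/-- The points of the stationary surface. -/
def stationary : Set (EvenIdx (G.ε 0) → ℝ) :=
  {x | x ∈ G.D ∧ ∀ i, body (dR i G.S₀) x = 0}

/-- `M k = m k - m (k + 1) + m (k + 2) - ⋯` (the number `M_{k-1}` in stage notation). -/
def M (k : ℕ) : ℤ := ∑ r ∈ Finset.range (G.L + 2), (-1) ^ r * (G.m (k + r) : ℤ)

/-- The assumptions on the starting point: Grassmann parities, Noether identities, rank conditions. -/
structure IsGaugeTheory : Prop where
  m_eq_zero : ∀ k, G.L + 2 ≤ k → G.m k = 0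
  parity_S₀ : HasParity G.S₀ 0
  parity_Z : ∀ k b a, HasParity (G.Z k b a) (G.ε k b + G.ε (k + 1) a)
  noether_zero : ∀ a, ∑ i, G.T le_rfl i * G.Z 0 i a = 0
  noether_succ : ∀ k c a, G.WeakZero le_rfl (∑ b, G.Z k c b * G.Z (k + 1) b a)
  rank_hessian : ∀ x ∈ G.stationary,
    ((Matrix.of fun i j => body (dL i (dR j G.S₀)) x).rank : ℤ) = G.M 0
  rank_Z : ∀ x ∈ G.stationary, ∀ k,
    ((Matrix.of fun b a => body (G.Z k b a) x).rank : ℤ) = G.M (k + 1)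

/-! ### Transversal and longitudinal fields -/

section Coordinates

variable {U : Opens (EvenIdx (G.ε 0) → ℝ)}

/-- The left derivative `∂f/∂y^j` with respect to new coordinates `y`, where
`N j i = ∂φ^i/∂y^j` is the inverse of the Jacobian matrix `∂y^j/∂φ^i`. -/
noncomputable def coordD (N : Fin (G.m 0) → Fin (G.m 0) → G.Fun U) (j : Fin (G.m 0)) (f : G.Fun U) :
    G.Fun U := ∑ i, N j i * dL i f

/-- `y` is a non-singular system of new coordinates over `U`, in which `y^I`, `I ∈ Ξ`, are
transversal fields `ξ^I` and the remaining ones are longitudinal fields; `N` is the inverse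
of the Jacobian matrix. -/
structure IsTransversalLongitudinal (hU : U ≤ G.D) (Ξ : Finset (Fin (G.m 0)))
    (y : Fin (G.m 0) → G.Fun U) (N : Fin (G.m 0) → Fin (G.m 0) → G.Fun U) : Prop where
  card_eq : (Ξ.card : ℤ) = G.M 0
  parity : ∀ j, HasParity (y j) (G.ε 0 j)
  inverse_left : ∀ j k, ∑ i, N j i * dL i (y k) = if j = k then 1 else 0
  inverse_right : ∀ i k, ∑ j, dL i (y j) * N j k = if i = k then 1 else 0
  gauge_invariant : ∀ I ∈ Ξ, ∀ a, G.WeakZero hU (∑ i, dR i (y I) * res hU (G.Z 0 i a))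
  vanishes : ∀ I ∈ Ξ, G.WeakZero hU (y I)

/-- `T₁ = T_{[1]}` and `Z₀ = Z_{[0]}` are the leading terms in the expansion of the equations of motion
and of the generators in powers of the transversal fields,
`T_i = ξ^I h_{Ii}(θ) + O(ξ²)` and `Z = Z₀(θ) + O(ξ)`. -/
structure IsLeading (hU : U ≤ G.D) (Ξ : Finset (Fin (G.m 0)))
    (y : Fin (G.m 0) → G.Fun U) (N : Fin (G.m 0) → Fin (G.m 0) → G.Fun U)
    (T₁ : Fin (G.m 0) → G.Fun U) (Z₀ : ∀ k, Fin (G.m k) → Fin (G.m (k + 1)) → G.Fun U) : Prop where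
  T_expansion : ∀ i, ∃ (h : Fin (G.m 0) → G.Fun U) (g : Fin (G.m 0) → Fin (G.m 0) → G.Fun U),
    (∀ I ∈ Ξ, ∀ J ∈ Ξ, G.coordD N J (h I) = 0) ∧
    T₁ i = ∑ I ∈ Ξ, y I * h I ∧
    G.T hU i = T₁ i + ∑ I ∈ Ξ, ∑ J ∈ Ξ, (y I * y J) * g I J
  Z_expansion : ∀ k b a, (∀ J ∈ Ξ, G.coordD N J (Z₀ k b a) = 0) ∧
    ∃ g : Fin (G.m 0) → G.Fun U, res hU (G.Z k b a) = Z₀ k b a + ∑ I ∈ Ξ, y I * g I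

end Coordinates

/-! ### Fields, antifields, and the reduced Koszul-Tate operator -/

/-- The labels of the fields: original fields (`k = 0`) and ghosts of stage `k - 1` (`k ≥ 1`). -/
abbrev FieldIdx : Type := Σₗ k : Fin (G.L + 2), Fin (G.m k)

/-- The labels of all variables: fields `Φ^α` and antifields `Φ*_α`. -/
abbrev PhaseIdx : Type := G.FieldIdx ⊕ₗ G.FieldIdx

/-- The field `Φ^{α_{k-1}}`. -/
def field (k : Fin (G.L + 2)) (a : Fin (G.m k)) : G.PhaseIdx := toLex (Sum.inl (toLex ⟨k, a⟩))

/-- The antifield `Φ*_{α_{k-1}}`. -/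
def antifield (k : Fin (G.L + 2)) (a : Fin (G.m k)) : G.PhaseIdx :=
  toLex (Sum.inr (toLex ⟨k, a⟩))

/-- The Grassmann parities of fields and antifields; with `s = k - 1` they are `ε_{α_s} + s + 1`
and `ε_{α_s} + s`. -/
def parity (v : G.PhaseIdx) : ZMod 2 :=
  Sum.elim (fun α => G.ε (ofLex α).1 (ofLex α).2 + ((ofLex α).1 : ℕ))
    (fun α => G.ε (ofLex α).1 (ofLex α).2 + ((ofLex α).1 : ℕ) + 1) (ofLex v)

/-- The original fields among all variables. -/
def incl : Fin (G.m 0) ↪o G.PhaseIdx :=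
  OrderEmbedding.ofMapLEIff (fun i => G.field 0 i) fun i j => by
    change Sum.Lex _ _ (Sum.inl _) (Sum.inl _) ↔ _
    rw [Sum.lex_inl_inl]
    change Sigma.Lex _ _ (⟨0, i⟩ : Σ k : Fin (G.L + 2), Fin (G.m k))
      (⟨0, j⟩ : Σ k : Fin (G.L + 2), Fin (G.m k)) ↔ _
    simp only [Sigma.lex_iff, lt_self_iff_false, exists_const, false_or]
    exact Iff.rfl

theorem parity_incl (i : Fin (G.m 0)) : G.parity (G.incl i) = G.ε 0 i := by
  simp [incl, parity, field]

/-- All functions of the fields and antifields over a set `U` of values of the original fields. -/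
abbrev PhaseFun (U : Opens (EvenIdx (G.ε 0) → ℝ)) : Type :=
  SuperFun G.parity (cylinder G.incl G.parity_incl U)

/-- The linear operators on the functions of the fields and antifields over `U`. -/
abbrev Operator (U : Opens (EvenIdx (G.ε 0) → ℝ)) : Type := Module.End ℝ (G.PhaseFun U)

variable {U : Opens (EvenIdx (G.ε 0) → ℝ)}

/-- A function of the original fields as a function of all fields and antifields. -/
noncomputable def up (f : G.Fun U) : G.PhaseFun U := lift G.incl G.parity_incl f

/-- The reduced Koszul-Tate operator
`δ = T_{[1]i} ∂/∂φ*_i + ∑_{s=0}^{L} Φ*_{α_{s-1}} Z_{[0]}^{α_{s-1}}_{α_s} ∂/∂c*_{α_s}`. -/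
noncomputable def koszulTate (T₁ : Fin (G.m 0) → G.Fun U)
    (Z₀ : ∀ k, Fin (G.m k) → Fin (G.m (k + 1)) → G.Fun U) : G.Operator U :=
  ∑ i : Fin (G.m 0), mulLeft (G.up (T₁ i)) ∘ₗ dL (G.antifield 0 i) +
  ∑ s : Fin (G.L + 1), ∑ b : Fin (G.m s), ∑ a : Fin (G.m (s + 1)),
    mulLeft (var (G.antifield s.castSucc b) * G.up (Z₀ s b a)) ∘ₗ dL (G.antifield s.succ a)

/-- The Euler vector field `ξ^I ∂/∂ξ^I + Φ*_α ∂/∂Φ*_α`, which counts transversal fields and antifields;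
`∂/∂ξ^I` is taken at fixed longitudinal fields, ghosts and antifields. -/
noncomputable def euler (Ξ : Finset (Fin (G.m 0))) (y : Fin (G.m 0) → G.Fun U)
    (N : Fin (G.m 0) → Fin (G.m 0) → G.Fun U) : G.Operator U :=
  ∑ I ∈ Ξ, ∑ i : Fin (G.m 0),
    mulLeft (G.up (y I)) ∘ₗ mulLeft (G.up (N I i)) ∘ₗ dL (G.field 0 i) +
  ∑ k : Fin (G.L + 2), ∑ a : Fin (G.m k),
    mulLeft (var (G.antifield k a)) ∘ₗ dL (G.antifield k a)

/-- The operator `X` has reduced antifield number `r`. -/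
def HasRafn (Ξ : Finset (Fin (G.m 0))) (y : Fin (G.m 0) → G.Fun U)
    (N : Fin (G.m 0) → Fin (G.m 0) → G.Fun U) (X : G.Operator U) (r : ℤ) : Prop :=
  G.euler Ξ y N ∘ₗ X - X ∘ₗ G.euler Ξ y N = (r : ℝ) • X

/-- The graded commutator `[δ, X]` of an odd operator `δ` with an arbitrary operator `X`: it is
`δX - Xδ` for even `X`, and `δX + Xδ` for odd `X`. -/
noncomputable def oddCommutator (δ X : G.Operator U) : G.Operator U :=
  δ ∘ₗ X - (parityOp ∘ₗ X ∘ₗ parityOp) ∘ₗ δ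

end GaugeData

set_option linter.unusedSectionVars false

/-! ### Signs -/

/-! The operator `δ` is an odd vector field, linear in the transversal fields and the antifields,
whose coefficients depend on the longitudinal fields only. It is encoded by one square matrix `D` of
functions of the original fields (`linMatrix`), with blocks `h` and `Z₀`. It suffices to find an odd
operator `η` with `δη + ηδ = K`: if `[δ, X] = 0` and `[K, X] = rX`, the Jacobi identity gives `rX =
[[δ, η], X] = [δ, [η, X]]`, so `Y = r⁻¹[η, X]` works for `r ≠ 0` (`exists_eq_oddCommutator`).
Nothing but linearity of `X` is used.

The operator `η` is sought as a linear vector field with an odd matrix `s`; the relation then reads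
`D s + s D = 1` (`linField_anticomm`). The entries of `s` may depend on the transversal fields,
because `δ` annihilates every function of the original fields. Near `p` such an `s` comes from
linear algebra at `p`. There the Noether identities and the rank conditions make the sequence with
maps `h`, `Z 0`, `Z 1`, … exact and the rows of `h` independent, so the Laplacian `D Dᵀ + Dᵀ D` of
the body is invertible (`IsLeadingCoeff.det_laplacian`). For the constant matrix `σ = D(p)ᵀ` the
matrix `Dσ + σD` remains invertible near `p`, since a matrix of superfunctions is invertible as soon
as its body is. It commutes with `D`, hence `s = σ(Dσ + σD)⁻¹` (`exists_homotopy_of_isUnit`); its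
odd part is again a homotopy (`exists_odd_homotopy`).

The identity `D² = 0`, and with it `δ² = 0`, is the leading part of the Noether identities.
Comparing leading parts needs the principle that a function which is both `O(ξ)` and independent of
`ξ` vanishes (`IsAdapted.eq_zero_of_inIdeal`). It holds on neighbourhoods stable under `ξ ↦ tξ`, `0
≤ t ≤ 1`, where Hadamard's lemma also provides the expansions (`exists_adapted_nhd`); odd
coordinates are removed one at a time. The same principle makes `T₁` and `Z₀` unique, so the result
covers every choice of them.

Two facts connect this with the starting point. Near `p` every `T_i` is `O(ξ)` (`exists_T_inIdeal`),
because `T` multiplied by a matrix of full row rank gives only zeros and the `ξ^I`. Transversal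
fields exist because the `T_I` belonging to a nonsingular principal minor of the Hessian can serve
as coordinates (`exists_transversalLongitudinal`). -/

theorem zmod_two_eq_zero_or_one (a : ZMod 2) : a = 0 ∨ a = 1 := by revert a; decide

/-- The sign `(-1)^a` of a Grassmann parity. -/
def sgn (a : ZMod 2) : ℝ := if a = 0 then 1 else -1

@[simp] theorem sgn_zero : sgn 0 = 1 := by simp [sgn]

@[simp] theorem sgn_one : sgn 1 = -1 := by simp [sgn]

theorem zmod_two_one_add_one : (1 + 1 : ZMod 2) = 0 := rfl

theorem sgn_add (a b : ZMod 2) : sgn (a + b) = sgn a * sgn b := by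
  rcases zmod_two_eq_zero_or_one a with rfl | rfl <;>
    rcases zmod_two_eq_zero_or_one b with rfl | rfl <;> simp [zmod_two_one_add_one]

theorem sgn_natCast (n : ℕ) : sgn (n : ZMod 2) = (-1) ^ n := by
  induction n with
  | zero => simp
  | succ n ih => rw [Nat.cast_succ, sgn_add, ih, sgn_one, pow_succ]

@[simp] theorem sgn_mul_self (a : ZMod 2) : sgn a * sgn a = 1 := by
  rcases zmod_two_eq_zero_or_one a with rfl | rfl <;> simp

theorem sgn_ne_zero (a : ZMod 2) : sgn a ≠ 0 := by
  rcases zmod_two_eq_zero_or_one a with rfl | rfl <;> simp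

namespace SuperFun

/-! ### The algebra of superfunctions -/

section Ring

variable {V : Type*} [Fintype V] [LinearOrder V] {π : V → ZMod 2} {W : Opens (EvenIdx π → ℝ)}

theorem ext_apply {f g : SuperFun π W} (h : ∀ S, ∀ x ∈ W, f.1 S x = g.1 S x) : f = g := by
  apply Subtype.ext; funext S x
  by_cases hx : x ∈ W
  · exact h S x hx
  · rw [(f.2 S).2 x hx, (g.2 S).2 x hx]

theorem add_apply (f g : SuperFun π W) (S x) : (f + g).1 S x = f.1 S x + g.1 S x := rfl

theorem smul_apply (c : ℝ) (f : SuperFun π W) (S x) : (c • f).1 S x = c * f.1 S x := rfl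

theorem sum_apply {ι : Type*} (s : Finset ι) (f : ι → SuperFun π W) (S x) :
    (∑ i ∈ s, f i).1 S x = ∑ i ∈ s, (f i).1 S x := by
  induction s using Finset.cons_induction with
  | empty => rfl
  | cons a s ha ih => rw [Finset.sum_cons, Finset.sum_cons, add_apply, ih]

theorem mul_apply (f g : SuperFun π W) (S x) : (f * g).1 S x = ∑ A ∈ S.powerset,
    (-1 : ℝ) ^ inversions A (S \ A) * (f.1 A x * g.1 (S \ A) x) := rfl

theorem one_apply (S) {x} (hx : x ∈ W) : (1 : SuperFun π W).1 S x = if S = ∅ then 1 else 0 := by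
  change (if S = ∅ then (W : Set (EvenIdx π → ℝ)).indicator (fun _ => (1 : ℝ)) else 0) x = _
  split_ifs
  · exact Set.indicator_of_mem hx _
  · rfl

theorem inversions_union_left {A B C : Finset (OddIdx π)} (h : Disjoint A B) :
    inversions (A ∪ B) C = inversions A C + inversions B C := by
  unfold inversions
  rw [Finset.union_product, Finset.filter_union, Finset.card_union_of_disjoint]
  exact Finset.disjoint_filter_filter (Finset.disjoint_product.2 (Or.inl h))

theorem inversions_union_right {A B C : Finset (OddIdx π)} (h : Disjoint B C) :
    inversions A (B ∪ C) = inversions A B + inversions A C := by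
  unfold inversions
  rw [Finset.product_union, Finset.filter_union, Finset.card_union_of_disjoint]
  exact Finset.disjoint_filter_filter (Finset.disjoint_product.2 (Or.inr h))

@[simp] theorem inversions_empty_left (B : Finset (OddIdx π)) : inversions ∅ B = 0 := by
  simp [inversions]

@[simp] theorem inversions_empty_right (A : Finset (OddIdx π)) : inversions A ∅ = 0 := by
  simp [inversions]

/-- Disjointness excludes ties, so each pair is an inversion for exactly one of the two orders. -/
theorem inversions_add_swap {A B : Finset (OddIdx π)} (h : Disjoint A B) :
    inversions A B + inversions B A = A.card * B.card := by
  have h1 : inversions B A = ((A ×ˢ B).filter fun p => ¬ p.2 < p.1).card := by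
    unfold inversions
    refine Finset.card_bij' (fun p _ => (p.2, p.1)) (fun p _ => (p.2, p.1)) ?_ ?_ ?_ ?_
    · rintro ⟨a, b⟩ hp
      simp only [Finset.mem_filter, Finset.mem_product] at hp ⊢
      exact ⟨⟨hp.1.2, hp.1.1⟩, not_lt.2 hp.2.le⟩
    · rintro ⟨a, b⟩ hp
      simp only [Finset.mem_filter, Finset.mem_product] at hp ⊢
      refine ⟨⟨hp.1.2, hp.1.1⟩, lt_of_le_of_ne (not_lt.1 hp.2) ?_⟩
      rintro rfl
      exact Finset.disjoint_left.1 h hp.1.1 hp.1.2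
    · intros; rfl
    · intros; rfl
  rw [h1, inversions, Finset.card_filter_add_card_filter_not, Finset.card_product]

theorem neg_one_pow_inversions_swap {A B : Finset (OddIdx π)} (h : Disjoint A B) :
    (-1 : ℝ) ^ inversions B A = sgn (A.card * B.card) * (-1) ^ inversions A B := by
  have := inversions_add_swap h
  rw [← Nat.cast_mul, sgn_natCast, ← this, ← pow_add,
    show inversions A B + inversions B A + inversions A B
      = inversions B A + 2 * inversions A B by ring, pow_add, pow_mul]
  simp

/-- Both sides are sums over ordered partitions of `S` into three blocks. The signs agree because
`inversions` is additive over disjoint unions in each argument. -/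
protected theorem mul_assoc (f g h : SuperFun π W) : f * g * h = f * (g * h) := by
  refine ext_apply fun S x _ => ?_
  simp only [mul_apply, Finset.sum_mul, Finset.mul_sum]
  rw [Finset.sum_sigma', Finset.sum_sigma']
  refine Finset.sum_bij' (fun p _ => ⟨p.2, p.1 \ p.2⟩) (fun p _ => ⟨p.1 ∪ p.2, p.1⟩) ?_ ?_ ?_ ?_ ?_
  · rintro ⟨C, A⟩ hp
    simp only [Finset.mem_sigma, Finset.mem_powerset] at hp ⊢
    exact ⟨hp.2.trans hp.1, Finset.sdiff_subset_sdiff hp.1 le_rfl⟩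
  · rintro ⟨A, B⟩ hp
    simp only [Finset.mem_sigma, Finset.mem_powerset] at hp ⊢
    exact ⟨Finset.union_subset hp.1 (hp.2.trans Finset.sdiff_subset), Finset.subset_union_left⟩
  · rintro ⟨C, A⟩ hp
    simp only [Finset.mem_sigma, Finset.mem_powerset] at hp
    simp [Finset.union_sdiff_of_subset hp.2]
  · rintro ⟨A, B⟩ hp
    simp only [Finset.mem_sigma, Finset.mem_powerset] at hp
    have : Disjoint A B := (Finset.disjoint_sdiff).mono_right hp.2
    simp [Finset.union_sdiff_cancel_left this]
  · rintro ⟨C, A⟩ hp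
    simp only [Finset.mem_sigma, Finset.mem_powerset] at hp
    have e1 : (S \ A) \ (C \ A) = S \ C := by
      ext t; simp only [Finset.mem_sdiff]
      have := @hp.2 t
      tauto
    have e2 : C = A ∪ (C \ A) := (Finset.union_sdiff_of_subset hp.2).symm
    have e3 : S \ A = (C \ A) ∪ (S \ C) := by
      ext t; simp only [Finset.mem_sdiff, Finset.mem_union]
      have := @hp.2 t
      have := @hp.1 t
      tauto
    have i1 : inversions C (S \ C) = inversions A (S \ C) + inversions (C \ A) (S \ C) := by
      conv_lhs => rw [e2]
      rw [inversions_union_left Finset.disjoint_sdiff, ← e2]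
    have i2 : inversions A (S \ A) = inversions A (C \ A) + inversions A (S \ C) := by
      rw [e3, inversions_union_right]
      exact Finset.disjoint_sdiff.mono_left Finset.sdiff_subset
    simp only [e1, i1, i2, pow_add]
    ring

protected theorem one_mul (f : SuperFun π W) : 1 * f = f := by
  refine ext_apply fun S x hx => ?_
  rw [mul_apply, Finset.sum_eq_single ∅]
  · simp [one_apply _ hx]
  · intro A _ hA
    simp [one_apply _ hx, hA]
  · simp

protected theorem mul_one (f : SuperFun π W) : f * 1 = f := by
  refine ext_apply fun S x hx => ?_
  rw [mul_apply, Finset.sum_eq_single S]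
  · simp [one_apply _ hx]
  · intro A hA hAS
    have : S \ A ≠ ∅ := fun h =>
      hAS (subset_antisymm (Finset.mem_powerset.1 hA) (Finset.sdiff_eq_empty_iff_subset.1 h))
    simp [one_apply _ hx, this]
  · simp

protected theorem add_mul (f g h : SuperFun π W) : (f + g) * h = f * h + g * h := by
  refine ext_apply fun S x hx => ?_
  simp only [mul_apply, add_apply, ← Finset.sum_add_distrib]
  exact Finset.sum_congr rfl fun A _ => by ring

noncomputable instance : Ring (SuperFun π W) :=
  { (inferInstance : AddCommGroup (SuperFun π W)), (inferInstance : Mul (SuperFun π W)),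
    (inferInstance : One (SuperFun π W)) with
    left_distrib := fun f g h => (mulLeft f).map_add g h
    right_distrib := SuperFun.add_mul
    zero_mul := fun f => by
      have := SuperFun.add_mul 0 0 f
      rw [add_zero] at this
      exact left_eq_add.1 this
    mul_zero := fun f => (mulLeft f).map_zero
    mul_assoc := SuperFun.mul_assoc
    one_mul := SuperFun.one_mul
    mul_one := SuperFun.mul_one }

instance : SMulCommClass ℝ (SuperFun π W) (SuperFun π W) :=
  ⟨fun c f g => ((mulLeft f).map_smul c g).symm⟩

instance : IsScalarTower ℝ (SuperFun π W) (SuperFun π W) :=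
  ⟨fun c f g => ext_apply fun S x _ => by
    simp only [smul_eq_mul, mul_apply, smul_apply, Finset.mul_sum]
    exact Finset.sum_congr rfl fun A _ => by ring⟩

@[simp] theorem mulLeft_apply (a f : SuperFun π W) : mulLeft a f = a * f := rfl

/-! ### Parities -/

/-- The `a`-th power of the parity operator. -/
noncomputable def twist (a : ZMod 2) : SuperFun π W →ₗ[ℝ] SuperFun π W :=
  if a = 0 then LinearMap.id else parityOp

theorem twist_apply (a : ZMod 2) (f : SuperFun π W) (S x) :
    (twist a f).1 S x = sgn (a * S.card) * f.1 S x := by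
  rcases zmod_two_eq_zero_or_one a with rfl | rfl
  · simp [twist]
  · have : (twist 1 : SuperFun π W →ₗ[ℝ] SuperFun π W) = parityOp := if_neg (by decide)
    rw [this, one_mul, sgn_natCast]
    rfl

@[simp] theorem twist_zero (f : SuperFun π W) : twist 0 f = f := by simp [twist]

theorem twist_one : (twist 1 : SuperFun π W →ₗ[ℝ] SuperFun π W) = parityOp := if_neg (by decide)

theorem twist_mul (a : ZMod 2) (f g : SuperFun π W) : twist a (f * g) = twist a f * twist a g := by
  refine ext_apply fun S x _ => ?_
  simp only [twist_apply, mul_apply, Finset.mul_sum]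
  refine Finset.sum_congr rfl fun A hA => ?_
  have : (S.card : ZMod 2) = A.card + (S \ A).card := by
    rw [← Nat.cast_add, add_comm, Finset.card_sdiff_add_card_eq_card (Finset.mem_powerset.1 hA)]
  rw [this, mul_add, sgn_add]
  ring

@[simp] theorem twist_map_one (a : ZMod 2) : twist a (1 : SuperFun π W) = 1 := by
  refine ext_apply fun S x hx => ?_
  rw [twist_apply, one_apply _ hx]
  split_ifs with h <;> simp [h]

theorem twist_twist (a b : ZMod 2) (f : SuperFun π W) : twist a (twist b f) = twist (a + b) f := by
  refine ext_apply fun S x hx => ?_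
  rw [twist_apply, twist_apply, twist_apply, add_mul, sgn_add, mul_assoc]

@[simp] theorem twist_twist_self (a : ZMod 2) (f : SuperFun π W) : twist a (twist a f) = f := by
  rw [twist_twist, CharTwo.add_self_eq_zero, twist_zero]

theorem HasParity.twist {f : SuperFun π W} {b : ZMod 2} (h : HasParity f b) (a : ZMod 2) :
    SuperFun.twist a f = sgn (a * b) • f := by
  refine ext_apply fun S x _ => ?_
  rw [twist_apply, smul_apply]
  by_cases hS : (S.card : ZMod 2) = b
  · rw [hS]
  · rw [h S hS]; simp

/-- Homogeneous functions are the eigenvectors of the parity automorphism. This turns parity claims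
into algebra with `twist`, which is multiplicative. -/
theorem hasParity_iff {f : SuperFun π W} {b : ZMod 2} :
    HasParity f b ↔ SuperFun.twist 1 f = sgn b • f := by
  refine ⟨fun h => by rw [h.twist, one_mul], fun h S hS => ?_⟩
  funext x
  have h1 := congrArg (fun k : SuperFun π W => k.1 S x) h
  simp only [twist_apply, smul_apply, one_mul] at h1
  have h2 : (S.card : ZMod 2) = b + 1 := by
    have key : ∀ b c : ZMod 2, c ≠ b → c = b + 1 := by decide
    exact key _ _ hS
  rw [h2, sgn_add, sgn_one] at h1
  have h3 : sgn b * f.1 S x = 0 := by linarith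
  exact (mul_eq_zero.1 h3).resolve_left (sgn_ne_zero b)

theorem HasParity.mul {f g : SuperFun π W} {a b : ZMod 2} (hf : HasParity f a)
    (hg : HasParity g b) : HasParity (f * g) (a + b) := by
  rw [hasParity_iff] at *
  rw [twist_mul, hf, hg, smul_mul_smul_comm, sgn_add]

theorem hasParity_zero (a : ZMod 2) : HasParity (0 : SuperFun π W) a := fun _ _ => rfl

theorem HasParity.smul {f : SuperFun π W} {a : ZMod 2} (hf : HasParity f a) (c : ℝ) :
    HasParity (c • f) a := by
  rw [hasParity_iff] at *
  rw [map_smul, hf, smul_comm]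

theorem HasParity.sum {ι : Type*} {s : Finset ι} {f : ι → SuperFun π W} {a : ZMod 2}
    (hf : ∀ i ∈ s, HasParity (f i) a) : HasParity (∑ i ∈ s, f i) a := by
  rw [hasParity_iff, map_sum, Finset.smul_sum]
  exact Finset.sum_congr rfl fun i hi => hasParity_iff.1 (hf i hi)

/-- Graded commutativity. -/
theorem HasParity.mul_comm_twist {f : SuperFun π W} {a : ZMod 2} (h : HasParity f a)
    (g : SuperFun π W) : f * g = SuperFun.twist a g * f := by
  refine ext_apply fun S x _ => ?_
  rw [mul_apply, mul_apply]
  refine Finset.sum_bij' (fun A _ => S \ A) (fun A _ => S \ A) ?_ ?_ ?_ ?_ ?_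
  · intro A _; simp
  · intro A _; simp
  · intro A hA; simpa using Finset.mem_powerset.1 hA
  · intro A hA; simpa using Finset.mem_powerset.1 hA
  · intro A hA
    rw [Finset.sdiff_sdiff_eq_self (Finset.mem_powerset.1 hA),
      neg_one_pow_inversions_swap Finset.disjoint_sdiff, twist_apply]
    by_cases hA' : (A.card : ZMod 2) = a
    · rw [hA']
      linear_combination (-(-1) ^ inversions A (S \ A) * f.1 A x * g.1 (S \ A) x) *
        sgn_mul_self (a * (S \ A).card)
    · simp [h A hA']

theorem HasParity.mul_comm_smul {f g : SuperFun π W} {a b : ZMod 2} (hf : HasParity f a)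
    (hg : HasParity g b) : f * g = sgn (a * b) • (g * f) := by
  rw [hf.mul_comm_twist, hg.twist, smul_mul_assoc]

end Ring

end SuperFun

namespace SuperFun

/-! ### Derivatives -/

section Deriv

variable {V : Type*} [Fintype V] [LinearOrder V] {π : V → ZMod 2} {W : Opens (EvenIdx π → ℝ)}

theorem differentiableAt (f : SuperFun π W) (S) {x} (hx : x ∈ W) :
    DifferentiableAt ℝ (f.1 S) x :=
  ((f.2 S).1.contDiffAt (W.isOpen.mem_nhds hx)).differentiableAt (by simp)

theorem dEven_apply (v : EvenIdx π) (f : SuperFun π W) (S) {x} (hx : x ∈ W) :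
    (dEven v f).1 S x = fderiv ℝ (f.1 S) x (Pi.single v 1) :=
  Set.indicator_of_mem (s := (W : Set (EvenIdx π → ℝ))) hx
    (fun x => fderiv ℝ (f.1 S) x (Pi.single v 1))

theorem dOdd_apply (n : OddIdx π → Finset (OddIdx π) → ℕ) (v : OddIdx π) (f : SuperFun π W) (S x) :
    (dOdd n v f).1 S x = if v ∈ S then 0 else (-1 : ℝ) ^ n v S * f.1 (insert v S) x := by
  change (if v ∈ S then 0 else (-1 : ℝ) ^ n v S • f.1 (insert v S)) x = _
  split_ifs <;> rfl

theorem dL_of_even {v : V} (h : π v = 0) : (dL v : SuperFun π W →ₗ[ℝ] _) = dEven ⟨v, h⟩ :=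
  dif_pos h

theorem dL_of_odd {v : V} (h : π v ≠ 0) : (dL v : SuperFun π W →ₗ[ℝ] _) =
    dOdd (fun v S => (S.filter fun t => t < v).card) ⟨v, h⟩ :=
  dif_neg h

theorem inversions_singleton_left (v : OddIdx π) (S : Finset (OddIdx π)) :
    inversions {v} S = (S.filter fun t => t < v).card := by
  unfold inversions
  rw [Finset.singleton_product, Finset.filter_map, Finset.card_map]
  rfl

theorem dL_odd_apply {v : V} (h : π v ≠ 0) (f : SuperFun π W) (S x) :
    (dL v f).1 S x = if ⟨v, h⟩ ∈ S then 0 else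
      (-1 : ℝ) ^ inversions {(⟨v, h⟩ : OddIdx π)} S * f.1 (insert ⟨v, h⟩ S) x := by
  rw [dL_of_odd h, dOdd_apply, inversions_singleton_left]

theorem dL_even_apply {v : V} (h : π v = 0) (f : SuperFun π W) (S) {x} (hx : x ∈ W) :
    (dL v f).1 S x = fderiv ℝ (f.1 S) x (Pi.single ⟨v, h⟩ 1) := by
  rw [dL_of_even h, dEven_apply _ _ _ hx]

theorem eq_one_of_ne_zero {a : ZMod 2} (h : a ≠ 0) : a = 1 :=
  (zmod_two_eq_zero_or_one a).resolve_left h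

theorem twist_dL (v : V) (a : ZMod 2) (f : SuperFun π W) :
    twist a (dL v f) = sgn (a * π v) • dL v (twist a f) := by
  refine ext_apply fun S x hx => ?_
  rw [twist_apply, smul_apply]
  by_cases h : π v = 0
  · rw [dL_even_apply h _ _ hx, dL_even_apply h _ _ hx, h]
    have : (twist a f).1 S = fun x => sgn (a * S.card) * f.1 S x := by
      funext x; exact twist_apply a f S x
    rw [this, fderiv_const_mul (differentiableAt f S hx)]
    simp
  · rw [dL_odd_apply h, dL_odd_apply h, eq_one_of_ne_zero h]
    split_ifs with hv
    · simp
    · rw [twist_apply, Finset.card_insert_of_notMem hv, Nat.cast_succ, mul_add, sgn_add]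
      linear_combination (-sgn (a * S.card) * (-1 : ℝ) ^ inversions {(⟨v, h⟩ : OddIdx π)} S *
        f.1 (insert ⟨v, h⟩ S) x) * sgn_mul_self (a * 1)

theorem HasParity.dL {f : SuperFun π W} {a : ZMod 2} (h : HasParity f a) (v : V) :
    HasParity (SuperFun.dL v f) (π v + a) := by
  rw [hasParity_iff] at *
  rw [twist_dL, h, map_smul, one_mul, smul_smul, sgn_add]

/-- The graded Leibniz rule. -/
theorem dL_mul (v : V) (f g : SuperFun π W) :
    dL v (f * g) = dL v f * g + twist (π v) f * dL v g := by
  refine ext_apply fun S x hx => ?_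
  rw [add_apply, mul_apply, mul_apply]
  by_cases h : π v = 0
  · rw [dL_even_apply h _ _ hx]
    have h1 : HasFDerivAt ((f * g).1 S) (∑ A ∈ S.powerset, (-1 : ℝ) ^ inversions A (S \ A) •
        (f.1 A x • fderiv ℝ (g.1 (S \ A)) x + g.1 (S \ A) x • fderiv ℝ (f.1 A) x)) x := by
      refine HasFDerivAt.fun_sum fun A _ => HasFDerivAt.const_mul ?_ _
      exact (differentiableAt f A hx).hasFDerivAt.mul (differentiableAt g _ hx).hasFDerivAt
    rw [h1.fderiv, ← Finset.sum_add_distrib]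
    simp only [FunLike.coe_sum, Finset.sum_apply, dL_even_apply h _ _ hx, h, twist_zero,
      _root_.smul_apply, _root_.add_apply, smul_eq_mul]
    exact Finset.sum_congr rfl fun A _ => by ring
  · set w : OddIdx π := ⟨v, h⟩ with hw
    rw [dL_odd_apply h, ← hw]
    split_ifs with hv
    · obtain ⟨S, hvS, rfl⟩ : ∃ S', w ∉ S' ∧ insert w S' = S :=
        ⟨S.erase w, Finset.notMem_erase _ _, Finset.insert_erase hv⟩
      -- The left side vanishes here. On the right, the term of `A` in which `f` is differentiated
      -- cancels the term of `A ∪ {w}` in which `g` is differentiated.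
      rw [← Finset.sum_add_distrib, Finset.sum_powerset_insert hvS, ← Finset.sum_add_distrib]
      refine (Finset.sum_eq_zero fun A hA => ?_).symm
      have hA := Finset.mem_powerset.1 hA
      have hvA : w ∉ A := fun hh => hvS (hA hh)
      have hvB : w ∉ S \ A := fun hh => hvS (Finset.mem_sdiff.1 hh).1
      have e1 : insert w S \ insert w A = S \ A := by
        rw [Finset.insert_sdiff_insert, Finset.sdiff_insert_of_notMem hvS]
      rw [Finset.insert_sdiff_of_notMem _ hvA, e1, dL_odd_apply h, dL_odd_apply h, dL_odd_apply h,
        dL_odd_apply h, ← hw, if_neg hvA, if_neg hvB, if_pos (Finset.mem_insert_self _ _),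
        if_pos (Finset.mem_insert_self _ _), twist_apply, twist_apply _ f (insert w A),
        eq_one_of_ne_zero h, one_mul, one_mul,
        Finset.card_insert_of_notMem hvA, Nat.cast_succ, sgn_add, Finset.insert_eq w (S \ A),
        Finset.insert_eq w A, inversions_union_right (Finset.disjoint_singleton_left.2 hvB),
        inversions_union_left (Finset.disjoint_singleton_left.2 hvA), pow_add, pow_add]
      have e2 := neg_one_pow_inversions_swap (A := {w}) (B := A)
        (Finset.disjoint_singleton_left.2 hvA)
      rw [Finset.card_singleton, Nat.cast_one, one_mul] at e2
      rw [e2, sgn_one]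
      have h1 : ((-1 : ℝ) ^ inversions {w} (S \ A)) * (-1) ^ inversions {w} (S \ A) = 1 := by
        rw [← mul_pow]; simp
      have h2 : ((-1 : ℝ) ^ inversions {w} A) * (-1) ^ inversions {w} A = 1 := by
        rw [← mul_pow]; simp
      linear_combination ((-1 : ℝ) ^ inversions A (S \ A) * sgn A.card *
          f.1 ({w} ∪ A) x * g.1 ({w} ∪ S \ A) x) * (h2 - h1)
    -- Subsets of `S ∪ {w}` that contain `w` contribute the derivative of `f`, the others the
    -- derivative of `g`.
    · rw [mul_apply, Finset.sum_powerset_insert hv, mul_add, Finset.mul_sum, Finset.mul_sum, add_comm]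
      congr 1
      · refine Finset.sum_congr rfl fun A hA => ?_
        have hA := Finset.mem_powerset.1 hA
        have hvA : w ∉ A := fun hh => hv (hA hh)
        rw [dL_odd_apply h, ← hw, if_neg hvA, Finset.insert_eq w A,
          show insert w S \ ({w} ∪ A) = S \ A by
            ext t; simp only [Finset.mem_sdiff, Finset.mem_insert, Finset.mem_union,
              Finset.mem_singleton]
            by_cases ht : t = w
            · subst ht; tauto
            · tauto,
          inversions_union_left (Finset.disjoint_singleton_left.2 hvA)]
        have e : inversions {w} S = inversions {w} A + inversions {w} (S \ A) := by
          conv_lhs => rw [← Finset.union_sdiff_of_subset hA]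
          exact inversions_union_right Finset.disjoint_sdiff
        rw [e, pow_add, pow_add]
        have : ((-1 : ℝ) ^ inversions {w} (S \ A)) * (-1) ^ inversions {w} (S \ A) = 1 := by
          rw [← mul_pow]; simp
        linear_combination ((-1 : ℝ) ^ inversions {w} A * (-1) ^ inversions A (S \ A) *
          f.1 ({w} ∪ A) x * g.1 (S \ A) x) * this
      · refine Finset.sum_congr rfl fun A hA => ?_
        have hA := Finset.mem_powerset.1 hA
        have hvA : w ∉ A := fun hh => hv (hA hh)
        have hvS : w ∉ S \ A := fun hh => hv (Finset.mem_sdiff.1 hh).1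
        rw [dL_odd_apply h, ← hw, if_neg hvS, twist_apply, eq_one_of_ne_zero h, one_mul,
          Finset.insert_sdiff_of_notMem _ hvA, Finset.insert_eq w (S \ A),
          inversions_union_right (Finset.disjoint_singleton_left.2 hvS)]
        have e : inversions {w} S = inversions {w} A + inversions {w} (S \ A) := by
          conv_lhs => rw [← Finset.union_sdiff_of_subset hA]
          exact inversions_union_right Finset.disjoint_sdiff
        have e2 := neg_one_pow_inversions_swap (A := A) (B := {w})
          (Finset.disjoint_singleton_right.2 hvA)
        rw [Finset.card_singleton, Nat.cast_one, mul_one] at e2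
        rw [e, pow_add, pow_add, e2]
        have : ((-1 : ℝ) ^ inversions A {w}) * (-1) ^ inversions A {w} = 1 := by
          rw [← mul_pow]; simp
        linear_combination (sgn A.card * (-1 : ℝ) ^ inversions {w} (S \ A) *
          (-1) ^ inversions A (S \ A) * f.1 A x * g.1 ({w} ∪ (S \ A)) x) * this

@[simp] theorem dL_one (v : V) : dL v (1 : SuperFun π W) = 0 := by
  have h := dL_mul v (1 : SuperFun π W) 1
  simpa using h

/-- Left derivatives commute in the graded sense. -/
theorem dL_dL (v w : V) (f : SuperFun π W) : dL v (dL w f) = sgn (π v * π w) • dL w (dL v f) := by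
  have mixed : ∀ v w : V, π v = 0 → π w ≠ 0 → dL v (dL w f) = dL w (dL v f) := by
    intro v w hv hw
    refine ext_apply fun S x hx => ?_
    rw [dL_even_apply hv _ _ hx, dL_odd_apply hw]
    by_cases h : ⟨w, hw⟩ ∈ S
    · have : (dL w f).1 S = fun _ => 0 := by funext x; rw [dL_odd_apply hw, if_pos h]
      rw [this, if_pos h]; simp
    · have : (dL w f).1 S = fun x => (-1 : ℝ) ^ inversions {(⟨w, hw⟩ : OddIdx π)} S *
          f.1 (insert ⟨w, hw⟩ S) x := by
        funext x; rw [dL_odd_apply hw, if_neg h]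
      rw [this, if_neg h, dL_even_apply hv _ _ hx, fderiv_const_mul (differentiableAt f _ hx)]
      rfl
  by_cases hv : π v = 0
  · by_cases hw : π w = 0
    · refine ext_apply fun S x hx => ?_
      rw [hv, zero_mul, sgn_zero, one_smul, dL_even_apply hv _ _ hx, dL_even_apply hw _ _ hx]
      have hc : ContDiffAt ℝ ∞ (f.1 S) x := (f.2 S).1.contDiffAt (W.isOpen.mem_nhds hx)
      have hd : DifferentiableAt ℝ (fderiv ℝ (f.1 S)) x :=
        (hc.fderiv_right (m := 1) (by norm_cast)).differentiableAt (by simp)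
      have key : ∀ u : V, ∀ hu : π u = 0, ∀ z, fderiv ℝ ((dL u f).1 S) x z =
          fderiv ℝ (fderiv ℝ (f.1 S)) x z (Pi.single ⟨u, hu⟩ 1) := by
        intro u hu z
        have e : (dL u f).1 S =ᶠ[nhds x] fun x => fderiv ℝ (f.1 S) x (Pi.single ⟨u, hu⟩ 1) :=
          Filter.eventuallyEq_of_mem (W.isOpen.mem_nhds hx) fun y hy => dL_even_apply hu f S hy
        rw [e.fderiv_eq, fderiv_clm_apply hd (differentiableAt_const _)]
        simp
      rw [key w hw, key v hv]
      exact hc.isSymmSndFDerivAt (by simp; norm_cast) _ _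
    · rw [hv, zero_mul, sgn_zero, one_smul, mixed v w hv hw]
  · by_cases hw : π w = 0
    · rw [hw, mul_zero, sgn_zero, one_smul, mixed w v hw hv]
    · rw [eq_one_of_ne_zero hv, eq_one_of_ne_zero hw]
      refine ext_apply fun S x hx => ?_
      rw [smul_apply, dL_odd_apply hv, dL_odd_apply hw, dL_odd_apply hw, dL_odd_apply hv]
      set a : OddIdx π := ⟨v, hv⟩
      set b : OddIdx π := ⟨w, hw⟩
      by_cases ha : a ∈ S
      · simp [ha]
      by_cases hb : b ∈ S
      · simp [hb]
      by_cases hab : a = b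
      · simp [hab]
      have e1 : inversions {b} (insert a S) = inversions {b} {a} + inversions {b} S := by
        rw [Finset.insert_eq, inversions_union_right (Finset.disjoint_singleton_left.2 ha)]
      have e2 : inversions {a} (insert b S) = inversions {a} {b} + inversions {a} S := by
        rw [Finset.insert_eq, inversions_union_right (Finset.disjoint_singleton_left.2 hb)]
      have e3 := neg_one_pow_inversions_swap (A := {a}) (B := {b})
        (Finset.disjoint_singleton_left.2 (by simpa using hab))
      simp only [Finset.mem_insert, ha, hb, hab, Ne.symm hab, or_self, if_false, e1, e2, pow_add,
        e3, Finset.card_singleton, Nat.cast_one, one_mul, sgn_one, Finset.insert_comm b a S]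
      ring

/-- Removing `v` from the right instead of the left moves it past all other factors of each
monomial; for homogeneous `f` this costs one common sign. -/
theorem dR_of_hasParity {f : SuperFun π W} {a : ZMod 2} (hf : HasParity f a) (v : V) :
    dR v f = sgn (π v * (a + 1)) • dL v f := by
  by_cases h : π v = 0
  · rw [h, zero_mul, sgn_zero, one_smul, dL_of_even h]
    exact congrArg (fun F : SuperFun π W →ₗ[ℝ] SuperFun π W => F f) (dif_pos h)
  · have e : (dR v : SuperFun π W →ₗ[ℝ] _) =
      dOdd (fun v S => (S.filter fun t => v < t).card) ⟨v, h⟩ := dif_neg h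
    refine ext_apply fun S x hx => ?_
    rw [e, smul_apply, dL_odd_apply h, dOdd_apply, eq_one_of_ne_zero h, one_mul]
    set w : OddIdx π := ⟨v, h⟩
    split_ifs with hw
    · simp
    · by_cases ha : ((insert w S).card : ZMod 2) = a
      · have h2 : (S.filter fun t => w < t).card = inversions S {w} := by
          unfold inversions
          rw [Finset.product_singleton, Finset.filter_map, Finset.card_map]
          rfl
        have h3 := neg_one_pow_inversions_swap (A := {w}) (B := S) (Finset.disjoint_singleton_left.2 hw)
        rw [h2, h3, Finset.card_singleton, Nat.cast_one, one_mul, ← ha,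
          Finset.card_insert_of_notMem hw, Nat.cast_succ, add_assoc, CharTwo.add_self_eq_zero, add_zero,
          mul_assoc]
      · rw [hf _ ha]; simp

theorem var_even_apply {v : V} (h : π v = 0) (S) {x} (hx : x ∈ W) :
    (var v : SuperFun π W).1 S x = if S = ∅ then x ⟨v, h⟩ else 0 := by
  rw [var, dif_pos h]
  change (if S = ∅ then (W : Set (EvenIdx π → ℝ)).indicator (fun x => x ⟨v, h⟩) else 0) x = _
  split_ifs
  · exact Set.indicator_of_mem (s := (W : Set (EvenIdx π → ℝ))) hx _
  · rfl

theorem var_odd_apply {v : V} (h : π v ≠ 0) (S) {x} (hx : x ∈ W) :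
    (var v : SuperFun π W).1 S x = if S = {⟨v, h⟩} then 1 else 0 := by
  rw [var, dif_neg h]
  change (if S = {⟨v, h⟩} then (W : Set (EvenIdx π → ℝ)).indicator (fun x => 1) else 0) x = _
  split_ifs
  · exact Set.indicator_of_mem (s := (W : Set (EvenIdx π → ℝ))) hx _
  · rfl

theorem hasParity_var (v : V) : HasParity (var v : SuperFun π W) (π v) := by
  intro S hS
  by_cases h : π v = 0
  · rw [var, dif_pos h]
    refine if_neg ?_
    rintro rfl
    exact hS (by simp [h])
  · rw [var, dif_neg h]
    refine if_neg ?_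
    rintro rfl
    exact hS (by simp [eq_one_of_ne_zero h])

theorem dL_var (v w : V) : dL v (var w : SuperFun π W) = if v = w then 1 else 0 := by
  refine ext_apply fun S x hx => ?_
  have rhs : ((if v = w then 1 else 0 : SuperFun π W)).1 S x =
      if v = w then (if S = ∅ then 1 else 0) else 0 := by
    split_ifs with h1 h2
    · rw [one_apply _ hx, if_pos h2]
    · rw [one_apply _ hx, if_neg h2]
    · rfl
  rw [rhs]
  by_cases hv : π v = 0
  · rw [dL_even_apply hv _ _ hx]
    by_cases hw : π w = 0
    · have e : (var w : SuperFun π W).1 S =ᶠ[nhds x] fun x => if S = ∅ then x ⟨w, hw⟩ else 0 :=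
        Filter.eventuallyEq_of_mem (W.isOpen.mem_nhds hx) fun y hy => var_even_apply hw S hy
      rw [e.fderiv_eq]
      by_cases hS : S = ∅
      · simp only [hS, if_true]
        have : HasFDerivAt (fun x : EvenIdx π → ℝ => x ⟨w, hw⟩)
          (ContinuousLinearMap.proj (R := ℝ) (φ := fun _ => ℝ) (⟨w, hw⟩ : EvenIdx π)) x :=
          (ContinuousLinearMap.proj (R := ℝ) (φ := fun _ => ℝ) (⟨w, hw⟩ : EvenIdx π)).hasFDerivAt
        rw [this.fderiv]
        simp [Pi.single_apply, Subtype.ext_iff, eq_comm]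
      · simp [hS]
    · have e : (var w : SuperFun π W).1 S =ᶠ[nhds x] fun _ => if S = {⟨w, hw⟩} then 1 else 0 :=
        Filter.eventuallyEq_of_mem (W.isOpen.mem_nhds hx) fun y hy => var_odd_apply hw S hy
      have hvw : v ≠ w := by rintro rfl; exact hw hv
      rw [e.fderiv_eq, if_neg hvw]
      simp
  · rw [dL_odd_apply hv]
    by_cases hw : π w = 0
    · have hvw : v ≠ w := by rintro rfl; exact hv hw
      rw [if_neg hvw, var_even_apply hw _ hx, if_neg (Finset.insert_ne_empty _ _)]
      simp
    · rw [var_odd_apply hw _ hx]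
      by_cases hvw : v = w
      · subst hvw
        by_cases hS : S = ∅
        · subst hS; simp
        · by_cases hm : ⟨v, hv⟩ ∈ S
          · simp [hm, hS]
          · have : insert ⟨v, hv⟩ S ≠ ({⟨v, hv⟩} : Finset (OddIdx π)) := by
              intro h
              have := congrArg Finset.card h
              rw [Finset.card_insert_of_notMem hm, Finset.card_singleton] at this
              exact hS (Finset.card_eq_zero.1 (by omega))
            simp [hm, hS, this]
      · have : insert ⟨v, hv⟩ S ≠ ({⟨w, hw⟩} : Finset (OddIdx π)) := by
          intro h
          have h1 := h ▸ Finset.mem_insert_self (⟨v, hv⟩ : OddIdx π) S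
          exact hvw (congrArg Subtype.val (Finset.mem_singleton.1 h1))
        simp [this, hvw]

/-! ### Vector fields -/

/-- The vector field `∑ v, a v ∂/∂v`. -/
noncomputable def vectorField (a : V → SuperFun π W) : SuperFun π W →ₗ[ℝ] SuperFun π W :=
  ∑ v, mulLeft (a v) ∘ₗ dL v

theorem vectorField_apply (a : V → SuperFun π W) (f : SuperFun π W) :
    vectorField a f = ∑ v, a v * dL v f := by
  simp [vectorField, LinearMap.sum_apply]

theorem vectorField_var (a : V → SuperFun π W) (v : V) : vectorField a (var v) = a v := by
  simp [vectorField_apply, dL_var]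

/-- `a` are the coefficients of a vector field of parity `e`. -/
def IsVectorField (e : ZMod 2) (a : V → SuperFun π W) : Prop := ∀ v, HasParity (a v) (e + π v)

variable {e e' : ZMod 2} {a b : V → SuperFun π W}

theorem IsVectorField.map_mul (ha : IsVectorField e a) (f g : SuperFun π W) :
    vectorField a (f * g) = vectorField a f * g + twist e f * vectorField a g := by
  simp only [vectorField_apply, Finset.sum_mul, Finset.mul_sum, ← Finset.sum_add_distrib]
  refine Finset.sum_congr rfl fun v _ => ?_
  rw [dL_mul, mul_add, mul_assoc, ← mul_assoc (a v) (SuperFun.twist _ f),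
    (ha v).mul_comm_twist (SuperFun.twist _ f), twist_twist,
    add_assoc, CharTwo.add_self_eq_zero, add_zero, mul_assoc]

theorem vectorField_one (a : V → SuperFun π W) :
    vectorField a (1 : SuperFun π W) = 0 := by
  simp [vectorField_apply]

theorem IsVectorField.twist (ha : IsVectorField e a) (c : ZMod 2) (f : SuperFun π W) :
    SuperFun.twist c (vectorField a f) = sgn (c * e) • vectorField a (SuperFun.twist c f) := by
  rw [vectorField_apply, vectorField_apply, map_sum, Finset.smul_sum]
  refine Finset.sum_congr rfl fun v _ => ?_
  rw [twist_mul, (ha v).twist, twist_dL, smul_mul_smul_comm, mul_add, sgn_add, mul_assoc, sgn_mul_self,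
    mul_one]

/-- Splits a composition into a first-order part and a second-order part. The second-order part is
graded symmetric in the two fields, so it drops out of the commutator. -/
theorem IsVectorField.comp_aux (ha : IsVectorField e a) (hb : IsVectorField e' b)
    (f : SuperFun π W) : vectorField a (vectorField b f) =
      vectorField (fun v => vectorField a (b v)) f +
        ∑ w, ∑ v, sgn (e * (e' + π w)) • (b w * (a v * dL v (dL w f))) := by
  rw [vectorField_apply b, map_sum, vectorField_apply, ← Finset.sum_add_distrib]
  refine Finset.sum_congr rfl fun w _ => ?_
  rw [ha.map_mul, (hb w).twist, smul_mul_assoc, vectorField_apply a (dL w f), Finset.mul_sum,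
    Finset.smul_sum]

/-- The graded commutator of two vector fields is a vector field. -/
theorem IsVectorField.commutator (ha : IsVectorField e a) (hb : IsVectorField e' b)
    (f : SuperFun π W) :
    vectorField a (vectorField b f) - sgn (e * e') • vectorField b (vectorField a f) =
      vectorField (fun v => vectorField a (b v) - sgn (e * e') • vectorField b (a v)) f := by
  -- The second-order parts of the two compositions agree up to the sign of the graded commutator.
  have h : ∑ w, ∑ v, sgn (e * (e' + π w)) • (b w * (a v * dL v (dL w f))) =
      sgn (e * e') • ∑ w, ∑ v, sgn (e' * (e + π w)) • (a w * (b v * dL v (dL w f))) := by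
    rw [Finset.sum_comm, Finset.smul_sum]
    refine Finset.sum_congr rfl fun v _ => ?_
    rw [Finset.smul_sum]
    refine Finset.sum_congr rfl fun w _ => ?_
    rw [← mul_assoc, ← mul_assoc, (ha v).mul_comm_smul (hb w), dL_dL v w, mul_smul_comm, smul_mul_assoc,
      smul_smul, smul_smul, smul_smul]
    congr 1
    rcases zmod_two_eq_zero_or_one e with rfl | rfl <;>
      rcases zmod_two_eq_zero_or_one e' with rfl | rfl <;>
      rcases zmod_two_eq_zero_or_one (π v) with hv | hv <;>
      rcases zmod_two_eq_zero_or_one (π w) with hw | hw <;>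
      simp [hv, hw, zmod_two_one_add_one]
  rw [ha.comp_aux hb, hb.comp_aux ha, h, smul_add, add_sub_add_right_eq_sub]
  rw [vectorField_apply _ f]
  simp only [vectorField_apply _ f, sub_mul, Finset.sum_sub_distrib, smul_mul_assoc, Finset.smul_sum]

end Deriv

/-! ### Restriction -/

section Res

variable {V : Type*} [Fintype V] [LinearOrder V] {π : V → ZMod 2} {W U : Opens (EvenIdx π → ℝ)}
  (h : U ≤ W)

theorem res_apply (f : SuperFun π W) (S) {x} (hx : x ∈ U) : (res h f).1 S x = f.1 S x :=
  Set.indicator_of_mem (s := (U : Set (EvenIdx π → ℝ))) hx _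

theorem res_body (f : SuperFun π W) {x} (hx : x ∈ U) : body (res h f) x = body f x :=
  res_apply h f ∅ hx

theorem res_res {U' : Opens (EvenIdx π → ℝ)} (h' : U' ≤ U) (f : SuperFun π W) :
    res h' (res h f) = res (h'.trans h) f :=
  ext_apply fun S _ hx => by rw [res_apply _ _ _ hx, res_apply _ _ _ (h' hx), res_apply _ _ _ hx]

/-- Restriction as a ring homomorphism. -/
noncomputable def resHom : SuperFun π W →+* SuperFun π U where
  toFun := res h
  map_one' := ext_apply fun S x hx => by
    rw [res_apply _ _ _ hx, one_apply _ hx, one_apply _ (h hx)]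
  map_mul' f g := ext_apply fun S x hx => by
    simp only [res_apply _ _ _ hx, mul_apply]
  map_zero' := ext_apply fun S x hx => by rw [res_apply _ _ _ hx]; rfl
  map_add' f g := ext_apply fun S x hx => by simp only [res_apply _ _ _ hx, add_apply]

theorem resHom_apply (f : SuperFun π W) : resHom h f = res h f := rfl

theorem res_smul (c : ℝ) (f : SuperFun π W) : res h (c • f) = c • res h f :=
  ext_apply fun S x hx => by rw [res_apply _ _ _ hx, smul_apply, smul_apply, res_apply _ _ _ hx]

theorem HasParity.res {f : SuperFun π W} {a : ZMod 2} (hf : HasParity f a) :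
    HasParity (SuperFun.res h f) a := fun S hS => by
  funext x
  change (U : Set (EvenIdx π → ℝ)).indicator (f.1 S) x = 0
  rw [hf S hS]; simp

theorem dEven_res (v : EvenIdx π) (f : SuperFun π W) : dEven v (res h f) = res h (dEven v f) := by
  refine ext_apply fun S x hx => ?_
  rw [res_apply _ _ _ hx, dEven_apply _ _ _ hx, dEven_apply _ _ _ (h hx)]
  have e : (res h f).1 S =ᶠ[nhds x] f.1 S :=
    Filter.eventuallyEq_of_mem (U.isOpen.mem_nhds hx) fun y hy => res_apply h f S hy
  rw [e.fderiv_eq]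

theorem dOdd_res (n : OddIdx π → Finset (OddIdx π) → ℕ) (v : OddIdx π) (f : SuperFun π W) :
    dOdd n v (res h f) = res h (dOdd n v f) := by
  refine ext_apply fun S x hx => ?_
  rw [res_apply _ _ _ hx, dOdd_apply, dOdd_apply, res_apply _ _ _ hx]

theorem dL_res (v : V) (f : SuperFun π W) : dL v (res h f) = res h (dL v f) := by
  by_cases hv : π v = 0
  · rw [dL_of_even hv, dL_of_even hv, dEven_res]
  · rw [dL_of_odd hv, dL_of_odd hv, dOdd_res]

theorem dR_res (v : V) (f : SuperFun π W) : dR v (res h f) = res h (dR v f) := by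
  unfold dR
  split_ifs
  · rw [dEven_res]
  · rw [dOdd_res]

end Res

/-! ### The body -/

section Body

variable {V : Type*} [Fintype V] [LinearOrder V] {π : V → ZMod 2} {W : Opens (EvenIdx π → ℝ)}

theorem body_mul (f g : SuperFun π W) (x) : body (f * g) x = body f x * body g x := by
  simp [body, mul_apply]

theorem body_one {x} (hx : x ∈ W) : body (1 : SuperFun π W) x = 1 := by
  simp [body, one_apply _ hx]

theorem body_add (f g : SuperFun π W) (x) : body (f + g) x = body f x + body g x := rfl

theorem body_sub (f g : SuperFun π W) (x) : body (f - g) x = body f x - body g x := rfl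

theorem body_smul (c : ℝ) (f : SuperFun π W) (x) : body (c • f) x = c * body f x := rfl

theorem body_zero (x) : body (0 : SuperFun π W) x = 0 := rfl

theorem body_sum {ι : Type*} (s : Finset ι) (f : ι → SuperFun π W) (x) :
    body (∑ i ∈ s, f i) x = ∑ i ∈ s, body (f i) x := sum_apply s f ∅ x

/-- Evaluation of the body at a point, as a ring homomorphism. -/
noncomputable def bodyHom {x : EvenIdx π → ℝ} (hx : x ∈ W) : SuperFun π W →+* ℝ where
  toFun f := body f x
  map_one' := body_one hx
  map_mul' f g := body_mul f g x
  map_zero' := rfl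
  map_add' _ _ := rfl

theorem HasParity.body_eq_zero {f : SuperFun π W} {a : ZMod 2} (h : HasParity f a) (ha : a ≠ 0) (x) :
    body f x = 0 := by
  rw [body, h ∅ (by simpa using ha.symm)]; rfl

theorem contDiffOn_body (f : SuperFun π W) : ContDiffOn ℝ ∞ (body f) W := (f.2 ∅).1

/-- A smooth function of the even variables as a superfunction. -/
noncomputable def ofSmooth (u : (EvenIdx π → ℝ) → ℝ) (hu : ContDiffOn ℝ ∞ u W) : SuperFun π W :=
  ⟨fun S => if S = ∅ then (W : Set (EvenIdx π → ℝ)).indicator u else 0, fun S => by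
    by_cases hS : S = ∅
    · simp only [hS, if_true]
      exact ⟨hu.congr fun _ hx => Set.indicator_of_mem hx _,
        fun _ hx => Set.indicator_of_notMem hx _⟩
    · simp only [hS, if_false]
      exact ⟨contDiffOn_const, fun _ _ => rfl⟩⟩

theorem body_ofSmooth {u : (EvenIdx π → ℝ) → ℝ} (hu : ContDiffOn ℝ ∞ u W) {x} (hx : x ∈ W) :
    body (ofSmooth u hu) x = u x := by
  change (if (∅ : Finset (OddIdx π)) = ∅ then (W : Set (EvenIdx π → ℝ)).indicator u else 0) x = u x
  rw [if_pos rfl]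
  exact Set.indicator_of_mem (s := (W : Set (EvenIdx π → ℝ))) hx _

end Body

end SuperFun

/-! ### Inverse matrices -/

section SmoothMatrix

variable {E : Type*} [NormedAddCommGroup E] [NormedSpace ℝ E] {s : Set E}
  {n : Type*} [Fintype n] [DecidableEq n] {M : E → Matrix n n ℝ}

theorem contDiffOn_matrix_det (h : ∀ i j, ContDiffOn ℝ ∞ (fun x => M x i j) s) :
    ContDiffOn ℝ ∞ (fun x => (M x).det) s := by
  simp only [Matrix.det_apply']
  refine ContDiffOn.sum fun σ _ => contDiffOn_const.mul ?_
  exact contDiffOn_prod fun i _ => h _ _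

/-- By Cramer's rule the entries are cofactors divided by the determinant. -/
theorem contDiffOn_matrix_inv (h : ∀ i j, ContDiffOn ℝ ∞ (fun x => M x i j) s)
    (hd : ∀ x ∈ s, (M x).det ≠ 0) (i j : n) : ContDiffOn ℝ ∞ (fun x => (M x)⁻¹ i j) s := by
  have e : (fun x => (M x)⁻¹ i j) = fun x => ((M x).det)⁻¹ * (M x).adjugate i j := by
    funext x
    rw [Matrix.inv_def, Matrix.smul_apply, Ring.inverse_eq_inv', smul_eq_mul]
  rw [e]
  refine ((contDiffOn_matrix_det h).inv hd).mul ?_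
  simp only [Matrix.adjugate_apply]
  refine contDiffOn_matrix_det fun a b => ?_
  by_cases hj : a = j
  · subst hj
    simp only [Matrix.updateRow_self]
    exact contDiffOn_const
  · simp only [Matrix.updateRow_ne hj]
    exact h a b

end SmoothMatrix

/-! ### Filtration by odd degree, and invertible matrices of superfunctions. -/

namespace SuperFun

variable {V : Type*} [Fintype V] [LinearOrder V] {π : V → ZMod 2} {W : Opens (EvenIdx π → ℝ)}

/-- All monomials of `f` contain at least `k` odd variables. -/
def OrderGE (k : ℕ) (f : SuperFun π W) : Prop := ∀ S : Finset (OddIdx π), S.card < k → f.1 S = 0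

theorem OrderGE.mul {k l : ℕ} {f g : SuperFun π W} (hf : OrderGE k f) (hg : OrderGE l g) :
    OrderGE (k + l) (f * g) := by
  intro S hS
  funext x
  rw [mul_apply]
  refine Finset.sum_eq_zero fun A hA => ?_
  have h := Finset.card_sdiff_add_card_eq_card (Finset.mem_powerset.1 hA)
  by_cases hk : A.card < k
  · rw [hf A hk]; simp
  · rw [hg (S \ A) (by omega)]; simp

theorem OrderGE.mono {k l : ℕ} {f : SuperFun π W} (hf : OrderGE k f) (h : l ≤ k) : OrderGE l f :=
  fun S hS => hf S (hS.trans_le h)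

theorem orderGE_zero (f : SuperFun π W) : OrderGE 0 f := fun _ h => absurd h (Nat.not_lt_zero _)

theorem OrderGE.sum {ι : Type*} {s : Finset ι} {k : ℕ} {f : ι → SuperFun π W}
    (h : ∀ i ∈ s, OrderGE k (f i)) : OrderGE k (∑ i ∈ s, f i) := fun S hS => by
  funext x
  rw [sum_apply]
  exact Finset.sum_eq_zero fun i hi => by rw [h i hi S hS]; rfl

theorem orderGE_one_iff {f : SuperFun π W} : OrderGE 1 f ↔ ∀ x ∈ W, body f x = 0 := by
  refine ⟨fun h x _ => ?_, fun h S hS => ?_⟩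
  · rw [body, h ∅ (by simp)]; rfl
  · have : S = ∅ := Finset.card_eq_zero.1 (by omega)
    subst this
    funext x
    by_cases hx : x ∈ W
    · exact h x hx
    · exact (f.2 ∅).2 x hx

theorem OrderGE.eq_zero {f : SuperFun π W} (h : ∀ k, OrderGE k f) : f = 0 :=
  ext_apply fun S x _ => by rw [h (S.card + 1) S (Nat.lt_succ_self _)]; rfl

theorem HasParity.orderGE_one {f : SuperFun π W} (h : HasParity f 1) : OrderGE 1 f :=
  orderGE_one_iff.2 fun x _ => h.body_eq_zero (by decide) x

section Matrix

variable {n : Type*} [Fintype n] [DecidableEq n]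

/-- The body of a matrix at a point. -/
def bodyMatrix {m n : Type*} (E : Matrix m n (SuperFun π W)) (x : EvenIdx π → ℝ) : Matrix m n ℝ :=
  Matrix.of fun i j => body (E i j) x

theorem bodyMatrix_mul {l m k : Type*} [Fintype k] (A : Matrix l k (SuperFun π W))
    (B : Matrix k m (SuperFun π W)) (x) : bodyMatrix (A * B) x = bodyMatrix A x * bodyMatrix B x := by
  ext i j
  simp [bodyMatrix, Matrix.mul_apply, body_sum, body_mul]

theorem bodyMatrix_one {x} (hx : x ∈ W) : bodyMatrix (1 : Matrix n n (SuperFun π W)) x = 1 := by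
  ext i j
  by_cases h : i = j
  · subst h; simp [bodyMatrix, body_one hx]
  · simp [bodyMatrix, Matrix.one_apply_ne h, body_zero]

/-- The entries of `E - 1` have no body, so those of its `k`-th power start in odd degree `k`. There
are finitely many odd variables, hence `E - 1` is nilpotent. -/
theorem isUnit_of_bodyMatrix_eq_one {E : Matrix n n (SuperFun π W)}
    (h : ∀ x ∈ W, bodyMatrix E x = 1) : IsUnit E := by
  have hpow : ∀ k i j, OrderGE k (((E - 1) ^ k) i j) := by
    intro k
    induction k with
    | zero => intro i j; exact orderGE_zero _
    | succ k ih =>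
      intro i j
      rw [pow_succ, Matrix.mul_apply]
      refine OrderGE.sum fun l _ => (ih i l).mul (orderGE_one_iff.2 fun x hx => ?_)
      have h1 := congrFun (congrFun (h x hx) l) j
      have h2 := congrFun (congrFun (bodyMatrix_one (π := π) (n := n) hx) l) j
      rw [← h2] at h1
      change (bodyHom hx) (E l j - (1 : Matrix n n (SuperFun π W)) l j) = 0
      rw [map_sub]
      exact sub_eq_zero.2 h1
  have hn : IsNilpotent (E - 1) := by
    refine ⟨Fintype.card (OddIdx π) + 1, ?_⟩
    ext1 i j
    refine ext_apply fun S x _ => ?_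
    rw [hpow _ i j S (Nat.lt_succ_of_le (Finset.card_le_univ S))]
    rfl
  have := hn.isUnit_add_one
  rwa [sub_add_cancel] at this

theorem exists_bodyMatrix_eq_inv {E : Matrix n n (SuperFun π W)}
    (h : ∀ x ∈ W, (bodyMatrix E x).det ≠ 0) :
    ∃ B : Matrix n n (SuperFun π W), ∀ x ∈ W, bodyMatrix B x = (bodyMatrix E x)⁻¹ := by
  have hs : ∀ i j, ContDiffOn ℝ ∞ (fun x => bodyMatrix E x i j) W := fun i j => contDiffOn_body _
  refine ⟨fun i j => ofSmooth (fun x => (bodyMatrix E x)⁻¹ i j) (contDiffOn_matrix_inv hs h i j),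
    fun x hx => ?_⟩
  ext i j
  exact body_ofSmooth (contDiffOn_matrix_inv hs h i j) hx

theorem isUnit_of_isUnit_mul {R : Type*} [Monoid R] {a b : R} (h1 : IsUnit (b * a))
    (h2 : IsUnit (a * b)) : IsUnit a := by
  obtain ⟨c, hc⟩ := h1.exists_left_inv
  obtain ⟨d, hd⟩ := h2.exists_right_inv
  have hl : c * b * a = 1 := by rw [mul_assoc, hc]
  have hr : a * (b * d) = 1 := by rw [← mul_assoc, hd]
  have e := left_inv_eq_right_inv hl hr
  exact ⟨⟨a, c * b, by rw [e, hr], hl⟩, rfl⟩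

/-- A matrix of superfunctions is invertible if its body is. -/
theorem isUnit_of_isUnit_bodyMatrix {E : Matrix n n (SuperFun π W)}
    (h : ∀ x ∈ W, (bodyMatrix E x).det ≠ 0) : IsUnit E := by
  obtain ⟨B, hB⟩ := exists_bodyMatrix_eq_inv h
  refine isUnit_of_isUnit_mul (b := B) (isUnit_of_bodyMatrix_eq_one fun x hx => ?_)
    (isUnit_of_bodyMatrix_eq_one fun x hx => ?_)
  · rw [bodyMatrix_mul, hB x hx, Matrix.nonsing_inv_mul _ (isUnit_iff_ne_zero.2 (h x hx))]
  · rw [bodyMatrix_mul, hB x hx, Matrix.mul_nonsing_inv _ (isUnit_iff_ne_zero.2 (h x hx))]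

theorem isOpen_det_bodyMatrix_ne_zero (E : Matrix n n (SuperFun π W)) :
    IsOpen {x | x ∈ W ∧ (bodyMatrix E x).det ≠ 0} :=
  (contDiffOn_matrix_det fun i j => contDiffOn_body (E i j)).continuousOn.isOpen_inter_preimage
    W.isOpen isOpen_ne

end Matrix

end SuperFun

/-! ### Smooth functions in adapted coordinates -/

section Parametric

universe u

variable {E : Type u} [NormedAddCommGroup E] [NormedSpace ℝ E] [FiniteDimensional ℝ E]

/-- By the tube lemma a closed ball around `x` times `[0, 1]` lies in `Ω`. This set is compact, so
the derivative is bounded on it and differentiation under the integral is allowed. -/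
theorem hasFDerivAt_intervalIntegral_of_contDiffOn {F : Type u} [NormedAddCommGroup F]
    [NormedSpace ℝ F] {Ω : Set (E × ℝ)} (hΩ : IsOpen Ω) {f : E × ℝ → F}
    (hf : ContDiffOn ℝ ∞ f Ω) {x : E} (hx : ∀ t ∈ Set.Icc (0 : ℝ) 1, (x, t) ∈ Ω) :
    HasFDerivAt (fun x => ∫ t in (0 : ℝ)..1, f (x, t))
      (∫ t in (0 : ℝ)..1, (fderiv ℝ f (x, t)).comp (ContinuousLinearMap.inl ℝ E ℝ)) x := by
  obtain ⟨u, v, hu, hv, hxu, h01, huv⟩ := generalized_tube_lemma (isCompact_singleton (x := x))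
    (isCompact_Icc (a := (0 : ℝ)) (b := 1)) hΩ (by
      rintro ⟨y, t⟩ ⟨hy, ht⟩
      rw [Set.mem_singleton_iff] at hy
      subst hy
      exact hx t ht)
  have hxu : x ∈ u := hxu rfl
  obtain ⟨r, hr, hru⟩ := Metric.nhds_basis_closedBall.mem_iff.1 (hu.mem_nhds hxu)
  have hsub : ∀ y ∈ Metric.closedBall x r, ∀ t ∈ Set.Icc (0 : ℝ) 1, (y, t) ∈ Ω :=
    fun y hy t ht => huv ⟨hru hy, h01 ht⟩
  have hcf : ContinuousOn f Ω := hf.continuousOn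
  set f' : E × ℝ → E →L[ℝ] F := fun z => (fderiv ℝ f z).comp (ContinuousLinearMap.inl ℝ E ℝ)
  have hcf' : ContinuousOn f' Ω :=
    (hf.continuousOn_fderiv_of_isOpen hΩ (by simp)).clm_comp continuousOn_const
  have hI : Set.uIoc (0 : ℝ) 1 ⊆ Set.Icc 0 1 := by
    rw [Set.uIoc_of_le zero_le_one]; exact Set.Ioc_subset_Icc_self
  have hslice : ∀ {G : Type u} [NormedAddCommGroup G] {g : E × ℝ → G}, ContinuousOn g Ω →
      ∀ y ∈ Metric.closedBall x r, ContinuousOn (fun t => g (y, t)) (Set.Icc (0 : ℝ) 1) := by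
    intro G _ g hg y hy
    exact hg.comp (by fun_prop) fun t ht => hsub y hy t ht
  obtain ⟨C, hC⟩ := ((isCompact_closedBall x r).prod (isCompact_Icc (a := (0 : ℝ)) (b := 1))
    ).exists_bound_of_continuousOn (f := f') (hcf'.mono fun z hz => hsub z.1 hz.1 z.2 hz.2)
  refine (intervalIntegral.hasFDerivAt_integral_of_dominated_of_fderiv_le (bound := fun _ => C)
    (F := fun x t => f (x, t)) (F' := fun x t => f' (x, t))
    (Metric.closedBall_mem_nhds x hr) ?_ ?_ ?_ ?_ ?_ ?_)
  · filter_upwards [Metric.closedBall_mem_nhds x hr] with y hy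
    exact ((hslice hcf y hy).mono hI).aestronglyMeasurable measurableSet_uIoc
  · refine ContinuousOn.intervalIntegrable ?_
    rw [Set.uIcc_of_le zero_le_one]
    exact hslice hcf x (Metric.mem_closedBall_self hr.le)
  · exact ((hslice hcf' x (Metric.mem_closedBall_self hr.le)).mono hI).aestronglyMeasurable
      measurableSet_uIoc
  · exact Filter.Eventually.of_forall fun t ht y hy => hC (y, t) ⟨hy, hI ht⟩
  · exact intervalIntegrable_const
  · refine Filter.Eventually.of_forall fun t ht y hy => ?_
    have h1 : HasFDerivAt f (fderiv ℝ f (y, t)) (y, t) :=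
      ((hf.contDiffAt (hΩ.mem_nhds (hsub y hy t (hI ht)))).differentiableAt (by simp)).hasFDerivAt
    exact h1.comp y ((hasFDerivAt_id y).prodMk (hasFDerivAt_const t y))

/-- Induction on the order of differentiability: the derivative is an integral of the same kind with
values in `E →L[ℝ] F`. Hence `F` varies in the induction and shares its universe with `E`. -/
theorem contDiffOn_intervalIntegral {F : Type u} [NormedAddCommGroup F]
    [NormedSpace ℝ F] {Ω : Set (E × ℝ)} (hΩ : IsOpen Ω) {f : E × ℝ → F}
    (hf : ContDiffOn ℝ ∞ f Ω) {s : Set E} (hs : IsOpen s)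
    (hx : ∀ x ∈ s, ∀ t ∈ Set.Icc (0 : ℝ) 1, (x, t) ∈ Ω) :
    ContDiffOn ℝ ∞ (fun x => ∫ t in (0 : ℝ)..1, f (x, t)) s := by
  rw [contDiffOn_infty]
  intro n
  induction n generalizing F with
  | zero =>
    refine contDiffOn_zero.2 fun x hxs => ?_
    exact (hasFDerivAt_intervalIntegral_of_contDiffOn hΩ hf
      (hx x hxs)).continuousAt.continuousWithinAt
  | succ n ih =>
    have key := fun x hxs => hasFDerivAt_intervalIntegral_of_contDiffOn hΩ hf (hx x hxs)
    rw [Nat.cast_succ, contDiffOn_succ_iff_fderiv_of_isOpen hs]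
    refine ⟨fun x hxs => (key x hxs).differentiableAt.differentiableWithinAt, by simp, ?_⟩
    refine (ih (f := fun z => (fderiv ℝ f z).comp (ContinuousLinearMap.inl ℝ E ℝ)) ?_).congr
      fun x hxs => (key x hxs).fderiv
    exact (hf.fderiv_of_isOpen hΩ (m := ∞) (by simp)).clm_comp contDiffOn_const

end Parametric

/-! ### Hadamard's lemma for rescaling part of the coordinates. -/

section Adapted

variable {ι : Type*} [Fintype ι] [DecidableEq ι]

/-- Rescale the coordinates in `Ξ` by `t`. -/
def rescale (Ξ : Finset ι) (t : ℝ) (z : ι → ℝ) : ι → ℝ := fun i => if i ∈ Ξ then t * z i else z i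

theorem rescale_one (Ξ : Finset ι) (z : ι → ℝ) : rescale Ξ 1 z = z := by
  funext i; simp [rescale]

theorem contDiff_rescale (Ξ : Finset ι) :
    ContDiff ℝ ∞ fun q : (ι → ℝ) × ℝ => rescale Ξ q.2 q.1 := by
  rw [contDiff_pi]
  intro i
  by_cases hi : i ∈ Ξ
  · simp only [rescale, hi, if_true]; fun_prop
  · simp only [rescale, hi, if_false]; fun_prop

/-- Balls are taken in the sup norm, so they are boxes. The centre has zero coordinates in `Ξ`, and
shrinking these coordinates towards it stays in the box. -/
theorem rescale_mem_ball {Ξ : Finset ι} {c z : ι → ℝ} {r t : ℝ} (hc : ∀ i ∈ Ξ, c i = 0)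
    (hz : z ∈ Metric.ball c r) (ht : t ∈ Set.Icc (0 : ℝ) 1) : rescale Ξ t z ∈ Metric.ball c r := by
  have hr : 0 < r := dist_nonneg.trans_lt hz
  rw [Metric.mem_ball, dist_pi_lt_iff hr] at *
  intro i
  by_cases hi : i ∈ Ξ
  · have := hz i
    simp only [rescale, hi, if_true, hc i hi, Real.dist_eq, sub_zero, abs_mul] at *
    refine lt_of_le_of_lt ?_ this
    rw [abs_of_nonneg ht.1]
    exact mul_le_of_le_one_left (abs_nonneg _) ht.2
  · simpa [rescale, hi] using hz i

theorem hasDerivAt_rescale (Ξ : Finset ι) (z : ι → ℝ) (t : ℝ) :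
    HasDerivAt (fun t => rescale Ξ t z) (∑ i ∈ Ξ, z i • Pi.single i (1 : ℝ)) t := by
  rw [hasDerivAt_pi]
  intro i
  have e : (∑ j ∈ Ξ, z j • Pi.single j (1 : ℝ) : ι → ℝ) i = if i ∈ Ξ then z i else 0 := by
    simp [Finset.sum_apply, Pi.single_apply]
  rw [e]
  by_cases hi : i ∈ Ξ
  · simp only [rescale, hi, if_true]
    simpa using (hasDerivAt_id t).mul_const (z i)
  · simp only [rescale, hi, if_false]
    exact hasDerivAt_const _ _

/-- Hadamard's lemma on a box. -/
theorem hadamard_ball {Ξ : Finset ι} {c : ι → ℝ} {r : ℝ} (hc : ∀ i ∈ Ξ, c i = 0)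
    {g : (ι → ℝ) → ℝ} (hg : ContDiffOn ℝ ∞ g (Metric.ball c r)) {z} (hz : z ∈ Metric.ball c r) :
    g z = g (rescale Ξ 0 z) + ∑ i ∈ Ξ, z i *
      ∫ t in (0 : ℝ)..1, fderiv ℝ g (rescale Ξ t z) (Pi.single i 1) := by
  have hcont : ∀ i, ContinuousOn (fun t => fderiv ℝ g (rescale Ξ t z) (Pi.single i 1))
      (Set.uIcc (0 : ℝ) 1) := by
    intro i
    rw [Set.uIcc_of_le zero_le_one]
    refine ContinuousOn.clm_apply ?_ continuousOn_const
    refine (hg.continuousOn_fderiv_of_isOpen Metric.isOpen_ball (by simp)).comp ?_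
      fun t ht => rescale_mem_ball hc hz ht
    exact ((contDiff_rescale Ξ).continuous.comp (by fun_prop : Continuous fun t : ℝ => (z, t))
      ).continuousOn
  have hd : ∀ t ∈ Set.uIcc (0 : ℝ) 1, HasDerivAt (fun t => g (rescale Ξ t z))
      (∑ i ∈ Ξ, z i * fderiv ℝ g (rescale Ξ t z) (Pi.single i 1)) t := by
    intro t ht
    rw [Set.uIcc_of_le zero_le_one] at ht
    have h1 : HasFDerivAt g (fderiv ℝ g (rescale Ξ t z)) (rescale Ξ t z) :=
      ((hg.contDiffAt (Metric.isOpen_ball.mem_nhds (rescale_mem_ball hc hz ht))).differentiableAt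
        (by simp)).hasFDerivAt
    have h2 := h1.comp_hasDerivAt t (hasDerivAt_rescale Ξ z t)
    have e : fderiv ℝ g (rescale Ξ t z) (∑ i ∈ Ξ, z i • Pi.single i (1 : ℝ)) =
        ∑ i ∈ Ξ, z i * fderiv ℝ g (rescale Ξ t z) (Pi.single i 1) := by
      rw [map_sum]
      simp only [map_smul, smul_eq_mul]
    rw [e] at h2
    exact h2
  have hint : ∀ i ∈ Ξ, IntervalIntegrable (fun t => z i * fderiv ℝ g (rescale Ξ t z) (Pi.single i 1))
      MeasureTheory.volume 0 1 := fun i _ => (continuousOn_const.mul (hcont i)).intervalIntegrable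
  have h := intervalIntegral.integral_eq_sub_of_hasDerivAt hd
    (ContinuousOn.intervalIntegrable (continuousOn_finsetSum _ fun i _ =>
      continuousOn_const.mul (hcont i)))
  rw [intervalIntegral.integral_finsetSum hint] at h
  simp only [intervalIntegral.integral_const_mul, rescale_one] at h
  linarith

end Adapted

section AdaptedNhd

variable {ι : Type} [Fintype ι] [DecidableEq ι]

/-- Functions near `p` split into a part independent of the coordinates `Y_I`, `I ∈ Ξ`, and a part
in the ideal they generate; here `N x I` is the value at `x` of the vector field `∂/∂Y_I`. -/
theorem exists_adapted_nhd {Y : (ι → ℝ) → ι → ℝ} {N : (ι → ℝ) → ι → ι → ℝ} {O : Set (ι → ℝ)}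
    (hO : IsOpen O) {p : ι → ℝ} (hpO : p ∈ O) (hY : ContDiffOn ℝ ∞ Y O)
    (hN : ∀ x ∈ O, ∀ j, fderiv ℝ Y x (N x j) = Pi.single j 1)
    {Ξ : Finset ι} (hp : ∀ I ∈ Ξ, Y p I = 0) :
    ∃ U : Set (ι → ℝ), IsOpen U ∧ p ∈ U ∧ U ⊆ O ∧
      (∀ u : (ι → ℝ) → ℝ, ContDiffOn ℝ ∞ u U → ∃ (u₀ : (ι → ℝ) → ℝ) (v : ι → (ι → ℝ) → ℝ),
        ContDiffOn ℝ ∞ u₀ U ∧ (∀ I, ContDiffOn ℝ ∞ (v I) U) ∧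
        (∀ x ∈ U, u x = u₀ x + ∑ I ∈ Ξ, Y x I * v I x) ∧
        ∀ x ∈ U, ∀ I ∈ Ξ, fderiv ℝ u₀ x (N x I) = 0) ∧
      ∀ u : (ι → ℝ) → ℝ, ContDiffOn ℝ ∞ u U → (∀ x ∈ U, ∀ I ∈ Ξ, fderiv ℝ u x (N x I) = 0) →
        (∀ x ∈ U, (∀ I ∈ Ξ, Y x I = 0) → u x = 0) → ∀ x ∈ U, u x = 0 := by
  have hdY : ∀ x ∈ O, DifferentiableAt ℝ Y x := fun x hx =>
    (hY.contDiffAt (hO.mem_nhds hx)).differentiableAt (by simp)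
  have hequiv : ∀ x ∈ O, ∃ A : (ι → ℝ) ≃L[ℝ] (ι → ℝ), HasFDerivAt Y (A : (ι → ℝ) →L[ℝ] (ι → ℝ)) x := by
    intro x hx
    -- The vectors `N x j` are mapped to the standard basis; in finite dimension surjectivity
    -- suffices for the inverse function theorem.
    have hsurj : Function.Surjective (fderiv ℝ Y x).toLinearMap := by
      intro z
      refine ⟨∑ j, z j • N x j, ?_⟩
      rw [map_sum]
      simp only [map_smul, ContinuousLinearMap.coe_coe, hN x hx]
      funext i
      simp [Finset.sum_apply, Pi.single_apply]
    have hinj := LinearMap.injective_iff_surjective.2 hsurj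
    refine ⟨(LinearEquiv.ofBijective _ ⟨hinj, hsurj⟩).toContinuousLinearEquiv, ?_⟩
    exact (hdY x hx).hasFDerivAt
  obtain ⟨A, hA⟩ := hequiv p hpO
  let e := (hY.contDiffAt (hO.mem_nhds hpO)).toOpenPartialHomeomorph Y hA (by simp)
  have he : ⇑e = Y := rfl
  have hpe : p ∈ e.source :=
    (hY.contDiffAt (hO.mem_nhds hpO)).mem_toOpenPartialHomeomorph_source hA (by simp)
  have hopen : IsOpen (e.target ∩ e.symm ⁻¹' O) := e.symm.isOpen_inter_preimage hO
  have hYp : Y p ∈ e.target ∩ e.symm ⁻¹' O :=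
    ⟨e.map_source hpe, by
      change e.symm (e p) ∈ O
      rwa [e.left_inv hpe]⟩
  -- The neighbourhood is the preimage of a box around `Y p`, which is stable under rescaling
  -- because `Y p I = 0` for `I ∈ Ξ`.
  obtain ⟨r, hr, hball⟩ := Metric.isOpen_iff.1 hopen (Y p) hYp
  set B := Metric.ball (Y p) r with hB
  have hψO : ∀ z ∈ B, e.symm z ∈ O := fun z hz => (hball hz).2
  have hYψ : ∀ z ∈ B, Y (e.symm z) = z := fun z hz => e.right_inv (hball hz).1
  set U := e.source ∩ e ⁻¹' B with hU
  have hUopen : IsOpen U := e.isOpen_inter_preimage Metric.isOpen_ball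
  have hψY : ∀ x ∈ U, e.symm (Y x) = x := fun x hx => e.left_inv hx.1
  have hUB : ∀ x ∈ U, Y x ∈ B := fun x hx => hx.2
  have hUO : U ⊆ O := fun x hx => by
    rw [← hψY x hx]; exact hψO _ hx.2
  have hψU : ∀ z ∈ B, e.symm z ∈ U := fun z hz => ⟨e.map_target (hball hz).1, by
    change Y (e.symm z) ∈ B
    rwa [hYψ z hz]⟩
  have hψ : ContDiffOn ℝ ∞ e.symm B := by
    intro z hz
    obtain ⟨A', hA'⟩ := hequiv _ (hψO z hz)
    exact (e.contDiffAt_symm (hball hz).1 hA'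
      (hY.contDiffAt (hO.mem_nhds (hψO z hz)))).contDiffWithinAt
  have hYU : ContDiffOn ℝ ∞ Y U := hY.mono hUO
  have hpull : ∀ u : (ι → ℝ) → ℝ, ContDiffOn ℝ ∞ u U → ContDiffOn ℝ ∞ (fun z => u (e.symm z)) B :=
    fun u hu => hu.comp hψ hψU
  refine ⟨U, hUopen, ⟨hpe, Metric.mem_ball_self hr⟩, hUO, ?_, ?_⟩
  · intro u hu
    have hg := hpull u hu
    set g : (ι → ℝ) → ℝ := fun z => u (e.symm z)
    have hΩ : IsOpen {q : (ι → ℝ) × ℝ | rescale Ξ q.2 q.1 ∈ B} :=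
      Metric.isOpen_ball.preimage (contDiff_rescale Ξ).continuous
    have hv : ∀ I, ContDiffOn ℝ ∞ (fun z => ∫ t in (0 : ℝ)..1,
        fderiv ℝ g (rescale Ξ t z) (Pi.single I 1)) B := by
      intro I
      refine contDiffOn_intervalIntegral hΩ
        (f := fun q => fderiv ℝ g (rescale Ξ q.2 q.1) (Pi.single I 1)) ?_ Metric.isOpen_ball
        fun z hz t ht => rescale_mem_ball hp hz ht
      exact ((hg.fderiv_of_isOpen Metric.isOpen_ball (m := ∞) (by simp)).comp
        (contDiff_rescale Ξ).contDiffOn fun q hq => hq).clm_apply contDiffOn_const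
    have hg0 : ContDiffOn ℝ ∞ (fun z => g (rescale Ξ 0 z)) B :=
      hg.comp ((contDiff_rescale Ξ).comp (contDiff_prodMk_left (0 : ℝ))).contDiffOn
        fun z hz => rescale_mem_ball hp hz (by simp)
    -- The constant part is the value at the rescaled point `ξ = 0`; the cofactors are the Hadamard
    -- averages of the partial derivatives along the segment to that point.
    refine ⟨fun x => g (rescale Ξ 0 (Y x)), fun I x => ∫ t in (0 : ℝ)..1,
        fderiv ℝ g (rescale Ξ t (Y x)) (Pi.single I 1), hg0.comp hYU hUB,
      fun I => (hv I).comp hYU hUB, fun x hx => ?_, fun x hx I hI => ?_⟩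
    · rw [← hadamard_ball hp hg (hUB x hx)]
      change u x = u (e.symm (Y x))
      rw [hψY x hx]
    · have h1 : HasFDerivAt (fun z => g (rescale Ξ 0 z))
          (fderiv ℝ (fun z => g (rescale Ξ 0 z)) (Y x)) (Y x) :=
        ((hg0.contDiffAt (Metric.isOpen_ball.mem_nhds (hUB x hx))).differentiableAt
          (by simp)).hasFDerivAt
      have h2 := h1.comp x (hdY x (hUO hx)).hasFDerivAt
      rw [show (fun x => g (rescale Ξ 0 (Y x))) = (fun z => g (rescale Ξ 0 z)) ∘ Y from rfl, h2.fderiv,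
        ContinuousLinearMap.comp_apply, hN x (hUO hx)]
      -- The partial derivative is computed along a line in direction `I ∈ Ξ`, on which `rescale Ξ
      -- 0` is constant.
      have h3 := h1.comp_hasDerivAt_of_eq (0 : ℝ)
        (f := fun t : ℝ => Y x + t • (Pi.single I (1 : ℝ) : ι → ℝ))
        (((hasDerivAt_id (0 : ℝ)).smul_const (Pi.single I (1 : ℝ) : ι → ℝ)).const_add (Y x))
        (by simp)
      have h4 : ((fun z => g (rescale Ξ 0 z)) ∘ fun t : ℝ => Y x + t • (Pi.single I (1 : ℝ) : ι → ℝ)) =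
          fun _ => g (rescale Ξ 0 (Y x)) := by
        funext t
        have : rescale Ξ 0 (Y x + t • (Pi.single I (1 : ℝ) : ι → ℝ)) = rescale Ξ 0 (Y x) := by
          funext i
          by_cases hi : i ∈ Ξ
          · simp [rescale, hi]
          · have : i ≠ I := by rintro rfl; exact hi hI
            simp [rescale, hi, this]
        simp only [Function.comp_apply, this]
      rw [h4] at h3
      simpa using h3.unique (hasDerivAt_const _ _)
  · intro u hu hder hzero x hx
    have hg := hpull u hu
    set g : (ι → ℝ) → ℝ := fun z => u (e.symm z) with hgdef
    have hpartial : ∀ z ∈ B, ∀ I ∈ Ξ, fderiv ℝ g z (Pi.single I 1) = 0 := by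
      intro z hz I hI
      have hxU := hψU z hz
      have h1 : HasFDerivAt g (fderiv ℝ g (Y (e.symm z))) (Y (e.symm z)) := by
        rw [hYψ z hz]
        exact ((hg.contDiffAt (Metric.isOpen_ball.mem_nhds hz)).differentiableAt
          (by simp)).hasFDerivAt
      have h2 := h1.comp (e.symm z) (hdY _ (hψO z hz)).hasFDerivAt
      have h3 : g ∘ Y =ᶠ[nhds (e.symm z)] u :=
        Filter.eventuallyEq_of_mem (hUopen.mem_nhds hxU) fun y hy => by
          change u (e.symm (Y y)) = u y
          rw [hψY y hy]
      have h4 := hder _ hxU I hI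
      rw [← h3.fderiv_eq, h2.fderiv, ContinuousLinearMap.comp_apply, hN _ (hψO z hz), hYψ z hz] at h4
      exact h4
    -- All remainder integrals vanish, so the value at `x` equals the value at the rescaled point,
    -- where `ξ = 0`.
    have h := hadamard_ball hp hg (hUB x hx)
    have hz0 : rescale Ξ 0 (Y x) ∈ B := rescale_mem_ball hp (hUB x hx) (by simp)
    have h0 : g (rescale Ξ 0 (Y x)) = 0 := by
      refine hzero _ (hψU _ hz0) fun I hI => ?_
      rw [hYψ _ hz0]
      simp [rescale, hI]
    have hi : ∀ I ∈ Ξ, (∫ t in (0 : ℝ)..1, fderiv ℝ g (rescale Ξ t (Y x)) (Pi.single I 1)) = 0 := by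
      intro I hI
      refine intervalIntegral.integral_zero_ae (Filter.Eventually.of_forall fun t ht => ?_)
      rw [Set.uIoc_of_le zero_le_one] at ht
      exact hpartial _ (rescale_mem_ball hp (hUB x hx) ⟨ht.1.le, ht.2⟩) I hI
    rw [h0, zero_add, Finset.sum_eq_zero fun I hI => by rw [hi I hI, mul_zero]] at h
    rw [← h]
    change u x = u (e.symm (Y x))
    rw [hψY x hx]

end AdaptedNhd

namespace SuperFun

/-! ### The parity automorphism of matrices of superfunctions. -/

section GradedTwist

variable {V : Type*} [Fintype V] [LinearOrder V] {π : V → ZMod 2} {W : Opens (EvenIdx π → ℝ)}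
  {n : Type*} [Fintype n] [DecidableEq n]

/-- The parity automorphism of matrices whose rows and columns have parities `ρ`. -/
noncomputable def gradedTwist (ρ : n → ZMod 2) (M : Matrix n n (SuperFun π W)) :
    Matrix n n (SuperFun π W) :=
  Matrix.of fun i j => sgn (ρ i + ρ j) • twist 1 (M i j)

theorem gradedTwist_mul (ρ : n → ZMod 2) (M N : Matrix n n (SuperFun π W)) :
    gradedTwist ρ (M * N) = gradedTwist ρ M * gradedTwist ρ N := by
  ext1 i k
  simp only [gradedTwist, Matrix.mul_apply, Matrix.of_apply, map_sum, Finset.smul_sum, twist_mul,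
    smul_mul_smul_comm]
  refine Finset.sum_congr rfl fun j _ => ?_
  congr 1
  rw [sgn_add, sgn_add, sgn_add]
  linear_combination (-sgn (ρ i) * sgn (ρ k)) * sgn_mul_self (ρ j)

theorem gradedTwist_one (ρ : n → ZMod 2) :
    gradedTwist ρ (1 : Matrix n n (SuperFun π W)) = 1 := by
  ext1 i k
  by_cases h : i = k
  · subst h
    simp [gradedTwist, CharTwo.add_self_eq_zero]
  · simp [gradedTwist, Matrix.one_apply_ne h]

theorem gradedTwist_eq_iff {ρ : n → ZMod 2} {M : Matrix n n (SuperFun π W)} {e : ZMod 2} :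
    gradedTwist ρ M = sgn e • M ↔ ∀ i j, HasParity (M i j) (e + ρ i + ρ j) := by
  rw [← Matrix.ext_iff]
  refine forall_congr' fun i => forall_congr' fun j => ?_
  rw [hasParity_iff, add_assoc, sgn_add e]
  change sgn (ρ i + ρ j) • twist 1 (M i j) = sgn e • M i j ↔ _
  constructor
  · intro h
    rw [mul_comm, mul_smul, ← h, smul_smul, sgn_mul_self, one_smul]
  · intro h
    rw [h, smul_smul, mul_left_comm, sgn_mul_self, mul_one]

end GradedTwist

/-! ### Coordinate systems and coordinate vector fields. -/

section Coordinates

variable {V : Type*} [Fintype V] [LinearOrder V] {π : V → ZMod 2} {W : Opens (EvenIdx π → ℝ)}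
  {y : V → SuperFun π W} {N : V → V → SuperFun π W}

/-- `y` are coordinates whose Jacobian matrix has the inverse `N`. -/
structure IsCoordSystem (y : V → SuperFun π W) (N : V → V → SuperFun π W) : Prop where
  parity : ∀ j, HasParity (y j) (π j)
  inverse_left : ∀ j k, ∑ i, N j i * dL i (y k) = if j = k then 1 else 0
  inverse_right : ∀ i k, ∑ j, dL i (y j) * N j k = if i = k then 1 else 0

namespace IsCoordSystem

/-- The Jacobian matrix is fixed by the automorphism `gradedTwist`. Its inverse is unique, so it is
fixed too, and this encodes the parities of its entries. -/
theorem isVectorField (hc : IsCoordSystem y N) (j : V) : IsVectorField (π j) (N j) := by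
  let M : Matrix V V (SuperFun π W) := Matrix.of N
  let J : Matrix V V (SuperFun π W) := Matrix.of fun i k => dL i (y k)
  have hMJ : M * J = 1 := by
    ext1 j k
    simp only [Matrix.mul_apply, Matrix.one_apply]
    exact hc.inverse_left j k
  have hJM : J * M = 1 := by
    ext1 i k
    simp only [Matrix.mul_apply, Matrix.one_apply]
    exact hc.inverse_right i k
  have hJ : gradedTwist π J = J := by
    have := (gradedTwist_eq_iff (ρ := π) (M := J) (e := 0)).2 fun i k => by
      rw [zero_add]; exact (hc.parity k).dL i
    rwa [sgn_zero, one_smul] at this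
  have h : gradedTwist π M * J = 1 := by
    conv_lhs => rw [← hJ]
    rw [← gradedTwist_mul, hMJ, gradedTwist_one]
  have hM : gradedTwist π M = sgn 0 • M := by
    rw [sgn_zero, one_smul]; exact left_inv_eq_right_inv h hJM
  intro i
  have := gradedTwist_eq_iff.1 hM j i
  rwa [zero_add] at this

theorem apply_coord (hc : IsCoordSystem y N) (j k : V) :
    vectorField (N j) (y k) = if j = k then 1 else 0 := by
  rw [vectorField_apply, hc.inverse_left]

theorem chain_rule (hc : IsCoordSystem y N) (i : V) (f : SuperFun π W) :
    dL i f = ∑ j, dL i (y j) * vectorField (N j) f := by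
  simp only [vectorField_apply, Finset.mul_sum]
  rw [Finset.sum_comm]
  simp only [← mul_assoc, ← Finset.sum_mul, hc.inverse_right]
  simp

/-- The components are recovered from the action on the coordinates by multiplying with the inverse
Jacobian. -/
theorem vectorField_eq_zero (hc : IsCoordSystem y N) {c : V → SuperFun π W}
    (h : ∀ l, vectorField c (y l) = 0) : c = 0 := by
  funext w
  have h1 : ∑ l, vectorField c (y l) * N l w = c w := by
    simp only [vectorField_apply, Finset.sum_mul]
    rw [Finset.sum_comm]
    simp only [mul_assoc, ← Finset.mul_sum, hc.inverse_right]
    simp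
  rw [← h1]
  simp [h]

/-- The graded commutator is a vector field, and it annihilates all coordinates because `∂_j y_k` is
constant. -/
theorem comm (hc : IsCoordSystem y N) (j k : V) (f : SuperFun π W) :
    vectorField (N j) (vectorField (N k) f) =
      sgn (π j * π k) • vectorField (N k) (vectorField (N j) f) := by
  have h := fun f => (hc.isVectorField j).commutator (hc.isVectorField k) f
  rw [hc.vectorField_eq_zero (c := fun v => vectorField (N j) (N k v) -
    sgn (π j * π k) • vectorField (N k) (N j v))] at h
  · rw [← sub_eq_zero, h]
    simp [vectorField_apply]
  · intro l
    rw [← h, hc.apply_coord, hc.apply_coord]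
    split_ifs <;> simp [vectorField_one]

theorem comp_self_of_odd (hc : IsCoordSystem y N) {j : V} (hj : π j ≠ 0) (f : SuperFun π W) :
    vectorField (N j) (vectorField (N j) f) = 0 := by
  have h := hc.comm j j f
  rw [eq_one_of_ne_zero hj, mul_one, sgn_one, neg_smul, one_smul] at h
  have h2 : (2 : ℝ) • vectorField (N j) (vectorField (N j) f) = 0 := by
    rw [two_smul]; exact add_eq_zero_iff_eq_neg.2 h
  exact (smul_eq_zero.1 h2).resolve_left two_ne_zero

theorem map_coord_mul (hc : IsCoordSystem y N) (j k : V) (f : SuperFun π W) :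
    vectorField (N j) (y k * f) =
      (if j = k then f else 0) + sgn (π j * π k) • (y k * vectorField (N j) f) := by
  rw [(hc.isVectorField j).map_mul, hc.apply_coord, (hc.parity k).twist, smul_mul_assoc, ite_mul,
    one_mul, zero_mul]

theorem comm_eq_zero (hc : IsCoordSystem y N) {j k : V} {f : SuperFun π W}
    (h : vectorField (N k) f = 0) : vectorField (N k) (vectorField (N j) f) = 0 := by
  rw [hc.comm, h, map_zero, smul_zero]

end IsCoordSystem

/-! ### The ideal generated by the transversal fields -/

/-- `f = O(ξ)`. -/
def InIdeal (Ξ : Finset V) (y : V → SuperFun π W) (f : SuperFun π W) : Prop :=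
  ∃ g : V → SuperFun π W, f = ∑ I ∈ Ξ, y I * g I

variable {Ξ : Finset V} {f g : SuperFun π W}

theorem inIdeal_zero : InIdeal Ξ y 0 := ⟨0, by simp⟩

theorem InIdeal.add (hf : InIdeal Ξ y f) (hg : InIdeal Ξ y g) : InIdeal Ξ y (f + g) := by
  obtain ⟨a, rfl⟩ := hf
  obtain ⟨b, rfl⟩ := hg
  exact ⟨a + b, by simp [mul_add, Finset.sum_add_distrib]⟩

theorem InIdeal.smul (hf : InIdeal Ξ y f) (c : ℝ) : InIdeal Ξ y (c • f) := by
  obtain ⟨a, rfl⟩ := hf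
  exact ⟨c • a, by simp [Finset.smul_sum, mul_smul_comm]⟩

theorem InIdeal.sub (hf : InIdeal Ξ y f) (hg : InIdeal Ξ y g) : InIdeal Ξ y (f - g) := by
  have := hf.add (hg.smul (-1))
  rwa [neg_one_smul, ← sub_eq_add_neg] at this

theorem InIdeal.sum {ι : Type*} {s : Finset ι} {f : ι → SuperFun π W}
    (h : ∀ i ∈ s, InIdeal Ξ y (f i)) : InIdeal Ξ y (∑ i ∈ s, f i) := by
  induction s using Finset.cons_induction with
  | empty => exact inIdeal_zero
  | cons a s ha ih =>
    rw [Finset.sum_cons]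
    exact (h a (by simp)).add (ih fun i hi => h i (by simp [hi]))

theorem inIdeal_coord_mul {I : V} (hI : I ∈ Ξ) (f : SuperFun π W) : InIdeal Ξ y (y I * f) :=
  ⟨fun J => if J = I then f else 0, by simp [hI]⟩

theorem InIdeal.mul_right (hf : InIdeal Ξ y f) (g : SuperFun π W) : InIdeal Ξ y (f * g) := by
  obtain ⟨a, rfl⟩ := hf
  exact ⟨fun I => a I * g, by simp [Finset.sum_mul, mul_assoc]⟩

theorem InIdeal.mul_left (hy : ∀ j, HasParity (y j) (π j)) (hf : InIdeal Ξ y f) (g : SuperFun π W) :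
    InIdeal Ξ y (g * f) := by
  obtain ⟨a, rfl⟩ := hf
  refine ⟨fun I => SuperFun.twist (π I) g * a I, ?_⟩
  rw [Finset.mul_sum]
  refine Finset.sum_congr rfl fun I _ => ?_
  rw [← mul_assoc, ← mul_assoc, (hy I).mul_comm_twist (SuperFun.twist (π I) g), twist_twist_self]

theorem IsCoordSystem.inIdeal_apply (hc : IsCoordSystem y N) {j : V} (hj : j ∉ Ξ)
    (hf : InIdeal Ξ y f) : InIdeal Ξ y (vectorField (N j) f) := by
  obtain ⟨a, rfl⟩ := hf
  rw [map_sum]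
  refine InIdeal.sum fun I hI => ?_
  have : j ≠ I := by rintro rfl; exact hj hI
  rw [hc.map_coord_mul, if_neg this, zero_add]
  exact (inIdeal_coord_mul hI _).smul _

/-- One derivative removes at most one of the two factors `ξ`. -/
theorem IsCoordSystem.inIdeal_apply_sq (hc : IsCoordSystem y N) (j : V) (a : V → V → SuperFun π W) :
    InIdeal Ξ y (vectorField (N j) (∑ I ∈ Ξ, ∑ K ∈ Ξ, (y I * y K) * a I K)) := by
  simp only [map_sum]
  refine InIdeal.sum fun I hI => InIdeal.sum fun K hK => ?_
  rw [mul_assoc, hc.map_coord_mul]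
  refine InIdeal.add ?_ ((inIdeal_coord_mul hI _).smul _)
  split_ifs
  · exact inIdeal_coord_mul hK _
  · exact inIdeal_zero

theorem InIdeal.body_eq_zero (hf : InIdeal Ξ y f) {x} (hy : ∀ I ∈ Ξ, body (y I) x = 0) :
    body f x = 0 := by
  obtain ⟨a, rfl⟩ := hf
  rw [body_sum]
  exact Finset.sum_eq_zero fun I hI => by rw [body_mul, hy I hI, zero_mul]

/-! ### Functions that do not depend on the odd coordinates -/

theorem OrderGE.dL_even {k : ℕ} (hf : OrderGE k f) {i : V} (hi : π i = 0) :
    OrderGE k (SuperFun.dL i f) := fun S hS => by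
  funext x
  by_cases hx : x ∈ W
  · rw [dL_even_apply hi _ _ hx, hf S hS]; simp
  · exact ((SuperFun.dL i f).2 S).2 x hx

theorem OrderGE.dL_odd {k : ℕ} (hf : OrderGE (k + 1) f) {i : V} (hi : π i ≠ 0) :
    OrderGE k (SuperFun.dL i f) := fun S hS => by
  funext x
  rw [dL_odd_apply hi]
  split_ifs with h
  · rfl
  · rw [hf _ (by rw [Finset.card_insert_of_notMem h]; omega)]; simp

/-- A derivative in an odd variable lowers the odd degree by one, but in an even vector field its
coefficient is odd and restores it. -/
theorem IsCoordSystem.orderGE_apply (hc : IsCoordSystem y N) {j : V} (hj : π j = 0) {k : ℕ}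
    (hf : OrderGE (k + 1) f) : OrderGE (k + 1) (vectorField (N j) f) := by
  rw [vectorField_apply]
  refine OrderGE.sum fun i _ => ?_
  by_cases hi : π i = 0
  · simpa using (orderGE_zero (N j i)).mul (hf.dL_even hi)
  · have h1 : HasParity (N j i) 1 := by
      have := hc.isVectorField j i
      rwa [hj, eq_one_of_ne_zero hi, zero_add] at this
    rw [add_comm]
    exact h1.orderGE_one.mul (hf.dL_odd hi)

/-- The odd degree at which `f` starts is raised step by step. By the chain rule an odd derivative
of `f` involves only the even coordinate derivatives, with odd coefficients, so it starts one degree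
later than `f`; this forces the lowest coefficients of `f` to vanish. -/
theorem IsCoordSystem.eq_zero_of_body (hc : IsCoordSystem y N)
    (hf : ∀ j, π j ≠ 0 → vectorField (N j) f = 0) (hb : OrderGE 1 f) : f = 0 := by
  refine OrderGE.eq_zero fun k => ?_
  suffices ∀ k, OrderGE (k + 1) f from (this k).mono (Nat.le_succ k)
  intro k
  induction k with
  | zero => exact hb
  | succ k ih =>
    have hd : ∀ i, π i ≠ 0 → OrderGE (k + 1 + 1) (SuperFun.dL i f) := by
      intro i hi
      rw [hc.chain_rule]
      refine OrderGE.sum fun j _ => ?_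
      by_cases hj : π j = 0
      · have h1 : HasParity (SuperFun.dL i (y j)) 1 := by
          have := (hc.parity j).dL i
          rwa [hj, eq_one_of_ne_zero hi, add_zero] at this
        rw [add_comm]
        exact h1.orderGE_one.mul (hc.orderGE_apply hj ih)
      · rw [hf j hj, mul_zero]; exact fun _ _ => rfl
    intro S hS
    by_cases hS0 : S = ∅
    · subst hS0; exact hb ∅ (by simp)
    · obtain ⟨w, hw⟩ := Finset.nonempty_iff_ne_empty.2 hS0
      have h2 := hd w.1 w.2 (S.erase w) (lt_of_le_of_lt (Finset.card_le_card (Finset.erase_subset _ _))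
        hS)
      funext x
      have h3 := congrFun h2 x
      rw [dL_odd_apply w.2, if_neg (by simp), Finset.insert_erase hw] at h3
      exact (mul_eq_zero.1 h3).resolve_left (pow_ne_zero _ (by norm_num))

theorem OrderGE.add {k : ℕ} (hf : OrderGE k f) (hg : OrderGE k g) : OrderGE k (f + g) :=
  fun S hS => by
    have : (f + g).1 S = f.1 S + g.1 S := rfl
    rw [this, hf S hS, hg S hS, add_zero]

theorem OrderGE.neg {k : ℕ} (hf : OrderGE k f) : OrderGE k (-f) :=
  fun S hS => by
    have : (-f).1 S = -f.1 S := rfl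
    rw [this, hf S hS, neg_zero]

theorem OrderGE.sub {k : ℕ} (hf : OrderGE k f) (hg : OrderGE k g) : OrderGE k (f - g) := by
  rw [sub_eq_add_neg]; exact hf.add hg.neg

/-- For odd `y_j` one has `∂_j (y_j ∂_j f) = ∂_j f - y_j ∂_j² f` and `∂_j² = 0`. Subtracting `y_j
∂_j f` therefore removes the dependence on `y_j`. -/
theorem IsCoordSystem.apply_sub_coord_mul (hc : IsCoordSystem y N) {j : V} (hj : π j ≠ 0)
    (f : SuperFun π W) : vectorField (N j) (f - y j * vectorField (N j) f) = 0 := by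
  rw [map_sub, hc.map_coord_mul, if_pos rfl, hc.comp_self_of_odd hj]
  simp

theorem IsCoordSystem.apply_sub_coord_mul_of_ne (hc : IsCoordSystem y N) {j k : V} (hjk : k ≠ j)
    (hf : vectorField (N k) f = 0) : vectorField (N k) (f - y j * vectorField (N j) f) = 0 := by
  rw [map_sub, hc.map_coord_mul, if_neg hjk, hc.comm_eq_zero hf, hf]
  simp

/-- The odd coordinates are removed one at a time; the subtracted terms have an odd factor `y_j`, so
the body does not change. -/
theorem IsCoordSystem.exists_odd_closed (hc : IsCoordSystem y N) (f : SuperFun π W) :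
    ∃ f' : SuperFun π W, OrderGE 1 (f' - f) ∧ ∀ j, π j ≠ 0 → vectorField (N j) f' = 0 := by
  suffices ∀ s : Finset V, ∃ f' : SuperFun π W, OrderGE 1 (f' - f) ∧
      ∀ j ∈ s, π j ≠ 0 → vectorField (N j) f' = 0 by
    obtain ⟨f', h1, h2⟩ := this Finset.univ
    exact ⟨f', h1, fun j hj => h2 j (Finset.mem_univ j) hj⟩
  intro s
  induction s using Finset.induction_on with
  | empty => exact ⟨f, by rw [sub_self]; exact fun _ _ => rfl, by simp⟩
  | insert j s hjs ih =>
    obtain ⟨f', h1, h2⟩ := ih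
    by_cases hj : π j = 0
    · refine ⟨f', h1, fun k hk hk0 => ?_⟩
      rcases Finset.mem_insert.1 hk with rfl | hk
      · exact absurd hj hk0
      · exact h2 k hk hk0
    · refine ⟨f' - y j * vectorField (N j) f', ?_, fun k hk hk0 => ?_⟩
      · rw [sub_right_comm]
        refine h1.sub ?_
        have hy := hc.parity j
        rw [eq_one_of_ne_zero hj] at hy
        exact hy.orderGE_one.mul (orderGE_zero _)
      · rcases Finset.mem_insert.1 hk with rfl | hk
        · exact hc.apply_sub_coord_mul hj f'
        · exact hc.apply_sub_coord_mul_of_ne (fun h => hjs (h ▸ hk)) (h2 k hk hk0)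

/-! ### Expansion in the transversal fields -/

/-- On the domain, functions of the even variables can be expanded in the even coordinates `y_I`,
`I ∈ Ξ`. -/
structure IsAdapted (Ξ : Finset V) (y : V → SuperFun π W) (N : V → V → SuperFun π W) : Prop where
  expand : ∀ f : SuperFun π W, ∃ (f₀ : SuperFun π W) (g : V → SuperFun π W),
    (∀ x ∈ W, body f x = body f₀ x + ∑ I ∈ Ξ with π I = 0, body (y I) x * body (g I) x) ∧
    ∀ x ∈ W, ∀ I ∈ Ξ, π I = 0 → body (vectorField (N I) f₀) x = 0
  eq_zero : ∀ f : SuperFun π W,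
    (∀ x ∈ W, ∀ I ∈ Ξ, π I = 0 → body (vectorField (N I) f) x = 0) →
    (∀ x ∈ W, (∀ I ∈ Ξ, π I = 0 → body (y I) x = 0) → body f x = 0) → ∀ x ∈ W, body f x = 0

theorem body_eq_of_orderGE (h : OrderGE 1 (f - g)) {x} (hx : x ∈ W) : body f x = body g x := by
  have h1 := orderGE_one_iff.1 h x hx
  rw [body_sub] at h1
  exact sub_eq_zero.1 h1

/-- Induction on the set of odd coordinates on which `f` may depend. For `j ∉ Ξ` the derivative `∂_j
f` satisfies the same hypotheses and no longer depends on `y_j`, so it vanishes by induction, and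
`f` does not depend on `y_j` either. Without odd coordinates only the body matters: it is constant
along `ξ` and zero at `ξ = 0`. -/
theorem IsAdapted.eq_zero_of_inIdeal (ha : IsAdapted Ξ y N) (hc : IsCoordSystem y N)
    (hf : InIdeal Ξ y f) (hD : ∀ I ∈ Ξ, vectorField (N I) f = 0) : f = 0 := by
  suffices ∀ s : Finset V, ∀ f, InIdeal Ξ y f → (∀ I ∈ Ξ, vectorField (N I) f = 0) →
      (∀ j, π j ≠ 0 → j ∉ s → vectorField (N j) f = 0) → f = 0 from
    this Finset.univ f hf hD fun j _ hj => absurd (Finset.mem_univ j) hj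
  intro s
  induction s using Finset.induction_on with
  | empty =>
    intro f hf hD hodd
    refine hc.eq_zero_of_body (fun j hj => hodd j hj (by simp)) (orderGE_one_iff.2 ?_)
    refine ha.eq_zero f (fun x _ I hI _ => by rw [hD I hI]; rfl) fun x _ hy => ?_
    refine hf.body_eq_zero fun I hI => ?_
    by_cases h : π I = 0
    · exact hy I hI h
    · exact (hc.parity I).body_eq_zero h x
  | insert j s hjs ih =>
    intro f hf hD hodd
    have key : π j ≠ 0 → vectorField (N j) f = 0 := by
      intro hj
      by_cases hjΞ : j ∈ Ξ
      · exact hD j hjΞ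
      refine ih _ (hc.inIdeal_apply hjΞ hf) (fun I hI => hc.comm_eq_zero (hD I hI)) fun k hk hks => ?_
      by_cases hkj : k = j
      · subst hkj; exact hc.comp_self_of_odd hk f
      · exact hc.comm_eq_zero (hodd k hk (by simp [hkj, hks]))
    refine ih f hf hD fun k hk hks => ?_
    by_cases hkj : k = j
    · subst hkj; exact key hk
    · exact hodd k hk (by simp [hkj, hks])

/-- The bodies are expanded first, and each term is then replaced by a function with the same body
that is independent of the odd coordinates. Such functions are determined by their bodies. -/
theorem IsAdapted.exists_expand_of_odd_closed (ha : IsAdapted Ξ y N) (hc : IsCoordSystem y N)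
    (hf : ∀ j, π j ≠ 0 → vectorField (N j) f = 0) :
    ∃ f₀ : SuperFun π W, (∀ I ∈ Ξ, vectorField (N I) f₀ = 0) ∧ InIdeal Ξ y (f - f₀) := by
  obtain ⟨u, g, h1, h2⟩ := ha.expand f
  obtain ⟨u', hu, hu'⟩ := hc.exists_odd_closed u
  choose g' hg hg' using fun I => hc.exists_odd_closed (g I)
  refine ⟨u', fun I hI => ?_, fun I => if π I = 0 then g' I else 0, ?_⟩
  · by_cases h : π I = 0
    · refine hc.eq_zero_of_body (fun j hj => hc.comm_eq_zero (hu' j hj)) (orderGE_one_iff.2 ?_)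
      intro x hx
      rw [← h2 x hx I hI h]
      refine body_eq_of_orderGE ?_ hx
      rw [← map_sub]
      exact hc.orderGE_apply h hu
    · exact hu' I h
  · rw [sub_eq_iff_eq_add']
    rw [← sub_eq_zero]
    have e : ∑ I ∈ Ξ, y I * (if π I = 0 then g' I else 0) = ∑ I ∈ Ξ with π I = 0, y I * g' I := by
      rw [Finset.sum_filter]
      exact Finset.sum_congr rfl fun I _ => by split_ifs <;> simp
    rw [e]
    refine hc.eq_zero_of_body (fun j hj => ?_) (orderGE_one_iff.2 fun x hx => ?_)
    · rw [map_sub, map_add, hf j hj, hu' j hj, map_sum, zero_add, zero_sub, neg_eq_zero]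
      refine Finset.sum_eq_zero fun I hI => ?_
      have hI0 := (Finset.mem_filter.1 hI).2
      have : j ≠ I := by rintro rfl; exact hj hI0
      rw [hc.map_coord_mul, if_neg this, hg' I j hj]
      simp
    · rw [body_sub, body_add, body_sum, sub_eq_zero, h1 x hx, body_eq_of_orderGE hu hx]
      congr 1
      exact Finset.sum_congr rfl fun I _ => by rw [body_mul, body_eq_of_orderGE (hg I) hx]

/-- Write `f = (f - y_j ∂_j f) + y_j ∂_j f` for odd `y_j`; neither `f - y_j ∂_j f` nor `∂_j f`
depends on `y_j`. The second term lies in the ideal if `j ∈ Ξ`; otherwise both parts are expanded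
and recombined. -/
theorem IsAdapted.exists_expand (ha : IsAdapted Ξ y N) (hc : IsCoordSystem y N)
    (f : SuperFun π W) :
    ∃ f₀ : SuperFun π W, (∀ I ∈ Ξ, vectorField (N I) f₀ = 0) ∧ InIdeal Ξ y (f - f₀) := by
  suffices ∀ s : Finset V, ∀ f, (∀ j, π j ≠ 0 → j ∉ s → vectorField (N j) f = 0) →
      ∃ f₀ : SuperFun π W, (∀ I ∈ Ξ, vectorField (N I) f₀ = 0) ∧ InIdeal Ξ y (f - f₀) from
    this Finset.univ f fun j _ hj => absurd (Finset.mem_univ j) hj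
  intro s
  induction s using Finset.induction_on with
  | empty => exact fun f hf => ha.exists_expand_of_odd_closed hc fun j hj => hf j hj (by simp)
  | insert j s hjs ih =>
    intro f hf
    by_cases hj : π j = 0
    · refine ih f fun k hk hks => hf k hk ?_
      have : k ≠ j := by rintro rfl; exact hk hj
      simp [this, hks]
    obtain ⟨a, ha1, ha2⟩ := ih (f - y j * vectorField (N j) f) fun k hk hks => by
      by_cases hkj : k = j
      · subst hkj; exact hc.apply_sub_coord_mul hk f
      · exact hc.apply_sub_coord_mul_of_ne hkj (hf k hk (by simp [hkj, hks]))
    obtain ⟨b, hb1, hb2⟩ := ih (vectorField (N j) f) fun k hk hks => by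
      by_cases hkj : k = j
      · subst hkj; exact hc.comp_self_of_odd hk f
      · exact hc.comm_eq_zero (hf k hk (by simp [hkj, hks]))
    by_cases hjΞ : j ∈ Ξ
    · refine ⟨a, ha1, ?_⟩
      have := ha2.add (inIdeal_coord_mul (y := y) hjΞ (vectorField (N j) f))
      rwa [sub_right_comm, sub_add_cancel] at this
    · refine ⟨a + y j * b, fun I hI => ?_, ?_⟩
      · have : I ≠ j := by rintro rfl; exact hjΞ hI
        rw [map_add, ha1 I hI, hc.map_coord_mul, if_neg this, hb1 I hI]
        simp
      · have := ha2.add (hb2.mul_left hc.parity (y j))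
        rw [mul_sub] at this
        convert this using 1
        abel

/-- The parity automorphism maps an expansion of `f` to one of `± f`, so uniqueness transfers the
parity to the leading term. -/
theorem IsAdapted.hasParity_of_expand (ha : IsAdapted Ξ y N) (hc : IsCoordSystem y N)
    {f f₀ : SuperFun π W} {a : ZMod 2} (hf : HasParity f a)
    (h₀ : ∀ I ∈ Ξ, vectorField (N I) f₀ = 0) (hi : InIdeal Ξ y (f - f₀)) : HasParity f₀ a := by
  rw [hasParity_iff, ← sub_eq_zero]
  refine ha.eq_zero_of_inIdeal hc ?_ fun I hI => ?_
  · have h1 : InIdeal Ξ y (twist 1 (f - f₀)) := by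
      obtain ⟨g, hg⟩ := hi
      rw [hg, map_sum]
      refine InIdeal.sum fun I hI => ?_
      rw [twist_mul, (hc.parity I).twist, smul_mul_assoc]
      exact (inIdeal_coord_mul hI _).smul _
    have h2 := (hi.smul (sgn a)).sub h1
    rw [map_sub, hasParity_iff.1 hf, smul_sub] at h2
    convert h2 using 1
    abel
  · have := (hc.isVectorField I).twist 1 f₀
    rw [h₀ I hI, map_zero] at this
    rw [map_sub, map_smul, h₀ I hI, smul_zero, sub_zero]
    exact (smul_eq_zero.1 this.symm).resolve_left (sgn_ne_zero _)

/-- Expansions `∑ y_I h_I` modulo quadratic terms, with `h_I` independent of the `y_J`, are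
unique. -/
theorem IsAdapted.linear_unique (ha : IsAdapted Ξ y N) (hc : IsCoordSystem y N)
    {h : V → SuperFun π W} (hD : ∀ I ∈ Ξ, ∀ J ∈ Ξ, vectorField (N J) (h I) = 0)
    (hq : ∃ g : V → V → SuperFun π W, ∑ I ∈ Ξ, y I * h I = ∑ I ∈ Ξ, ∑ K ∈ Ξ, (y I * y K) * g I K)
    {J : V} (hJ : J ∈ Ξ) : h J = 0 := by
  obtain ⟨g, hg⟩ := hq
  refine ha.eq_zero_of_inIdeal hc ?_ (hD J hJ)
  have h1 : vectorField (N J) (∑ I ∈ Ξ, y I * h I) = h J := by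
    rw [map_sum, Finset.sum_eq_single_of_mem J hJ]
    · rw [hc.map_coord_mul, if_pos rfl, hD J hJ J hJ]; simp
    · intro I hI hne
      rw [hc.map_coord_mul, if_neg hne.symm, hD I hI J hJ]; simp
  rw [← h1, hg]
  exact hc.inIdeal_apply_sq J g

end Coordinates

/-! ### Existence of adapted neighbourhoods. -/

section Existence

variable {V : Type} [Fintype V] [LinearOrder V] {π : V → ZMod 2} {W : Opens (EvenIdx π → ℝ)}
  {y : V → SuperFun π W} {N : V → V → SuperFun π W}

theorem IsCoordSystem.res (hc : IsCoordSystem y N) {U : Opens (EvenIdx π → ℝ)} (h : U ≤ W) :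
    IsCoordSystem (fun j => SuperFun.res h (y j)) fun j i => SuperFun.res h (N j i) where
  parity j := (hc.parity j).res h
  inverse_left j k := by
    simp only [dL_res]
    simp only [← resHom_apply, ← map_mul, ← map_sum]
    rw [hc.inverse_left]
    split_ifs <;> simp
  inverse_right i k := by
    simp only [dL_res]
    simp only [← resHom_apply, ← map_mul, ← map_sum]
    rw [hc.inverse_right]
    split_ifs <;> simp

/-- The components of an even field along odd variables are odd and have no body, so on bodies it
acts as an ordinary vector field. -/
theorem IsCoordSystem.body_apply (hc : IsCoordSystem y N) {j : V} (hj : π j = 0) (f : SuperFun π W)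
    {x} (hx : x ∈ W) : body (vectorField (N j) f) x =
      fderiv ℝ (body f) x fun i => body (N j i.1) x := by
  have e : (fun i : EvenIdx π => body (N j i.1) x) =
      ∑ i : EvenIdx π, body (N j i.1) x • Pi.single i (1 : ℝ) := by
    funext i
    simp [Finset.sum_apply, Pi.single_apply]
  rw [e, map_sum, vectorField_apply, body_sum, ← Fintype.sum_subtype_add_sum_subtype
    (fun i => π i = 0), add_eq_left.2]
  · refine Finset.sum_congr rfl fun i _ => ?_
    rw [body_mul, map_smul, smul_eq_mul]
    congr 1
    exact dL_even_apply i.2 f ∅ hx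
  · refine Finset.sum_eq_zero fun i _ => ?_
    have h1 := hc.isVectorField j i.1
    rw [body_mul, h1.body_eq_zero (by rw [hj, zero_add]; exact i.2), zero_mul]

/-- Every point where the even `y_I`, `I ∈ Ξ`, vanish has arbitrarily small adapted
neighbourhoods. -/
theorem IsCoordSystem.exists_isAdapted (hc : IsCoordSystem y N) {Ξ : Finset V} {p : EvenIdx π → ℝ}
    (hpW : p ∈ W) (hp : ∀ I ∈ Ξ, π I = 0 → body (y I) p = 0) :
    ∃ (U : Opens (EvenIdx π → ℝ)) (h : U ≤ W), p ∈ U ∧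
      IsAdapted Ξ (fun j => SuperFun.res h (y j)) fun j i => SuperFun.res h (N j i) := by
  let Y : (EvenIdx π → ℝ) → EvenIdx π → ℝ := fun x k => body (y k.1) x
  let M : (EvenIdx π → ℝ) → EvenIdx π → EvenIdx π → ℝ := fun x j i => body (N j.1 i.1) x
  have hY : ContDiffOn ℝ ∞ Y W := contDiffOn_pi.2 fun k => contDiffOn_body _
  have hM : ∀ x ∈ (W : Set (EvenIdx π → ℝ)), ∀ j, fderiv ℝ Y x (M x j) = Pi.single j 1 := by
    intro x hx j
    have hd : ∀ k : EvenIdx π, DifferentiableAt ℝ (fun x => Y x k) x := fun k =>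
      differentiableAt (y k.1) ∅ hx
    funext k
    rw [fderiv_pi hd]
    change fderiv ℝ (body (y k.1)) x (M x j) = _
    rw [← hc.body_apply j.2 _ hx, hc.apply_coord, Pi.single_apply]
    by_cases h : k = j
    · subst h; simp [body_one hx]
    · have : j.1 ≠ k.1 := fun h' => h (Subtype.ext h'.symm)
      simp [h, this, body_zero]
  obtain ⟨U, hU, hpU, hUW, h1, h2⟩ := exists_adapted_nhd (Ξ := Ξ.subtype fun i => π i = 0) W.isOpen hpW
    hY hM (fun I hI => hp I.1 (Finset.mem_subtype.1 hI) I.2)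
  have hUW' : (⟨U, hU⟩ : Opens (EvenIdx π → ℝ)) ≤ W := hUW
  have hsum : ∀ F : V → ℝ, ∑ I ∈ Ξ.subtype (fun i => π i = 0), F I.1 =
      ∑ I ∈ Ξ with π I = 0, F I := fun F => by
    rw [← Finset.subtype_map, Finset.sum_map]
    rfl
  refine ⟨⟨U, hU⟩, hUW', hpU, ?_, ?_⟩
  · intro f
    obtain ⟨u₀, v, hu₀, hv, he, hd⟩ := h1 (body f) (contDiffOn_body f)
    refine ⟨ofSmooth u₀ hu₀, fun I => if h : π I = 0 then ofSmooth (v ⟨I, h⟩) (hv _) else 0,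
      fun x hx => ?_, fun x hx I hI hI0 => ?_⟩
    · rw [he x hx, body_ofSmooth hu₀ hx, ← hsum]
      congr 1
      refine Finset.sum_congr rfl fun I _ => ?_
      beta_reduce
      rw [dif_pos I.2, body_ofSmooth (hv _) hx, res_body _ _ hx]
    · rw [(hc.res hUW').body_apply hI0 _ hx, ← hd x hx ⟨I, hI0⟩ (Finset.mem_subtype.2 hI)]
      have e : body (ofSmooth u₀ hu₀) =ᶠ[nhds x] u₀ :=
        Filter.eventuallyEq_of_mem (hU.mem_nhds hx) fun z hz => body_ofSmooth (W := ⟨U, hU⟩) hu₀ hz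
      rw [e.fderiv_eq]
      congr 1
      funext i
      exact res_body _ _ hx
  · intro f hD h0
    refine h2 (body f) (contDiffOn_body f) (fun x hx I hI => ?_) fun x hx hyx => ?_
    · rw [← hD x hx I.1 (Finset.mem_subtype.1 hI) I.2, (hc.res hUW').body_apply I.2 _ hx]
      congr 1
      funext i
      exact (res_body _ _ hx).symm
    · refine h0 x hx fun I hI hI0 => ?_
      rw [res_body _ _ hx]
      exact hyx ⟨I, hI0⟩ (Finset.mem_subtype.2 hI)

end Existence

end SuperFun

/-! ### Linear algebra -/

section LinearAlgebra

variable {l m n : Type*} [Fintype l] [Fintype m] [Fintype n]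

/-- A complex of two real matrices whose ranks add up to the middle dimension is exact. -/
theorem exists_mulVec_eq_of_rank {A : Matrix l m ℝ} {B : Matrix m n ℝ} (hAB : A * B = 0)
    (hr : Fintype.card m ≤ A.rank + B.rank) {v : m → ℝ} (hv : A.mulVec v = 0) :
    ∃ u, B.mulVec u = v := by
  have hle : LinearMap.range B.mulVecLin ≤ LinearMap.ker A.mulVecLin := by
    rintro _ ⟨u, rfl⟩
    simp [hAB]
  have hdim := LinearMap.finrank_range_add_finrank_ker A.mulVecLin
  rw [Module.finrank_fintype_fun_eq_card] at hdim
  have hA : A.rank = Module.finrank ℝ (LinearMap.range A.mulVecLin) := rfl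
  have hB : B.rank = Module.finrank ℝ (LinearMap.range B.mulVecLin) := rfl
  have heq := Submodule.eq_of_le_of_finrank_le hle (by omega)
  have hmem : v ∈ LinearMap.ker A.mulVecLin := hv
  rw [← heq] at hmem
  exact hmem

theorem exists_vecMul_eq_of_rank {A : Matrix l m ℝ} {B : Matrix m n ℝ} (hAB : A * B = 0)
    (hr : Fintype.card m ≤ A.rank + B.rank) {v : m → ℝ} (hv : Matrix.vecMul v B = 0) :
    ∃ u, Matrix.vecMul u A = v := by
  obtain ⟨u, hu⟩ := exists_mulVec_eq_of_rank (A := B.transpose) (B := A.transpose) (v := v)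
    (by rw [← Matrix.transpose_mul, hAB, Matrix.transpose_zero])
    (by rw [Matrix.rank_transpose, Matrix.rank_transpose]; omega)
    (by rw [Matrix.mulVec_transpose, hv])
  exact ⟨u, by rw [← hu, Matrix.mulVec_transpose]⟩

/-- The left kernel of `A` is contained in that of `A * B`; the rank condition makes their
dimensions equal. -/
theorem vecMul_eq_zero_of_rank_mul {A : Matrix l m ℝ} {B : Matrix m n ℝ}
    (hr : A.rank ≤ (A * B).rank) {v : l → ℝ} (hv : Matrix.vecMul v (A * B) = 0) :
    Matrix.vecMul v A = 0 := by
  have hle : LinearMap.ker A.transpose.mulVecLin ≤ LinearMap.ker (A * B).transpose.mulVecLin := by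
    intro w hw
    rw [LinearMap.mem_ker, Matrix.mulVecLin_apply] at *
    rw [Matrix.transpose_mul, ← Matrix.mulVec_mulVec, hw, Matrix.mulVec_zero]
  have h1 := LinearMap.finrank_range_add_finrank_ker A.transpose.mulVecLin
  have h2 := LinearMap.finrank_range_add_finrank_ker (A * B).transpose.mulVecLin
  have h3 : A.transpose.rank = Module.finrank ℝ (LinearMap.range A.transpose.mulVecLin) := rfl
  have h4 : (A * B).transpose.rank =
    Module.finrank ℝ (LinearMap.range (A * B).transpose.mulVecLin) := rfl
  rw [Matrix.rank_transpose] at h3 h4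
  have heq := Submodule.eq_of_le_of_finrank_le hle (by omega)
  have hmem : v ∈ LinearMap.ker (A * B).transpose.mulVecLin := by
    rw [LinearMap.mem_ker, Matrix.mulVecLin_apply, Matrix.mulVec_transpose, hv]
  rw [← heq, LinearMap.mem_ker, Matrix.mulVecLin_apply, Matrix.mulVec_transpose] at hmem
  exact hmem

/-- A vector in the left kernel of the Gram matrix satisfies `|vA|² = 0`. -/
theorem det_mul_transpose_ne_zero [DecidableEq l] {A : Matrix l m ℝ}
    (h : ∀ v, Matrix.vecMul v A = 0 → v = 0) : (A * A.transpose).det ≠ 0 := by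
  intro hd
  obtain ⟨v, hv, hv0⟩ := Matrix.exists_vecMul_eq_zero_iff.2 hd
  refine hv (h v ?_)
  have h1 : Matrix.vecMul v A ⬝ᵥ Matrix.vecMul v A = 0 := by
    have : Matrix.vecMul v (A * A.transpose) ⬝ᵥ v = 0 := by rw [hv0, zero_dotProduct]
    rwa [← Matrix.vecMul_vecMul, Matrix.vecMul_transpose, dotProduct_comm,
      Matrix.dotProduct_mulVec] at this
  exact dotProduct_self_eq_zero.1 h1

/-- A square matrix of maximal rank has a nonsingular principal minor if it is symmetric up to
signs. -/
theorem exists_principal_minor {H : Matrix n n ℝ} {s : n → ℝ} (hs : ∀ i, s i * s i = 1)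
    (hH : ∀ i k, H i k = s k * H k i) :
    ∃ Ξ : Finset n, Ξ.card = H.rank ∧ ∀ v : n → ℝ, (∀ i, i ∉ Ξ → v i = 0) →
      (∀ k ∈ Ξ, Matrix.vecMul v H k = 0) → v = 0 := by
  classical
  -- `Ξ` labels a basis of the row space chosen among the rows of `H`.
  obtain ⟨κ, a, ha, hspan, hli⟩ := exists_linearIndependent' ℝ H.row
  have : Finite κ := Finite.of_injective a ha
  have := Fintype.ofFinite κ
  refine ⟨Finset.univ.map ⟨a, ha⟩, ?_, fun v hv0 hv => ?_⟩
  · rw [Finset.card_map, Finset.card_univ, Matrix.rank_eq_finrank_span_row, ← hspan,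
      finrank_span_eq_card hli]
  · have hv' : ∀ q, Matrix.vecMul v H (a q) = 0 := fun q => hv _ (by simp)
    -- By the symmetry up to signs, the columns in `Ξ` span all columns as the rows in `Ξ` span all
    -- rows. So `vH` vanishes everywhere once it vanishes on `Ξ`, and independence of the rows in
    -- `Ξ` gives `v = 0`.
    have hall : ∀ k, Matrix.vecMul v H k = 0 := by
      intro k
      have hk : H.row k ∈ Submodule.span ℝ (Set.range (H.row ∘ a)) := by
        rw [hspan]; exact Submodule.subset_span ⟨k, rfl⟩
      obtain ⟨c, hc⟩ := (Submodule.mem_span_range_iff_exists_fun ℝ).1 hk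
      have e : ∀ i, H i k = s k * ∑ q, c q * s (a q) * H i (a q) := by
        intro i
        have h1 := congrFun hc i
        simp only [Finset.sum_apply, Pi.smul_apply, smul_eq_mul, Function.comp_apply,
          Matrix.row_apply] at h1
        rw [hH i k, ← h1]
        congr 1
        refine Finset.sum_congr rfl fun q _ => ?_
        rw [hH i (a q)]
        linear_combination (-c q * H (a q) i) * hs (a q)
      have e2 : Matrix.vecMul v H k = s k * ∑ q, c q * s (a q) * Matrix.vecMul v H (a q) := by
        simp only [Matrix.vecMul, dotProduct, Finset.mul_sum]
        rw [Finset.sum_comm]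
        refine Finset.sum_congr rfl fun i _ => ?_
        rw [e i, Finset.mul_sum, Finset.mul_sum]
        exact Finset.sum_congr rfl fun q _ => by ring
      rw [e2]
      simp [hv']
    have h2 : ∑ q, v (a q) • (H.row ∘ a) q = 0 := by
      funext k
      have h3 := hall k
      simp only [Matrix.vecMul, dotProduct] at h3
      simp only [Finset.sum_apply, Pi.smul_apply, smul_eq_mul, Function.comp_apply, Matrix.row_apply,
        Pi.zero_apply]
      rw [← h3]
      refine (Finset.sum_map Finset.univ ⟨a, ha⟩ fun i => v i * H i k).symm.trans ?_
      refine Finset.sum_subset (Finset.subset_univ _) fun i _ hi => ?_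
      rw [hv0 i hi, zero_mul]
    have h4 := Fintype.linearIndependent_iff.1 hli _ h2
    funext i
    by_cases hi : i ∈ Finset.univ.map ⟨a, ha⟩
    · obtain ⟨q, _, rfl⟩ := Finset.mem_map.1 hi
      exact h4 q
    · exact hv0 i hi

end LinearAlgebra

/-! ### Invertibility of matrices of superfunctions near a point. -/

namespace SuperFun

section ConstMatrix

variable {V : Type*} [Fintype V] [LinearOrder V] {π : V → ZMod 2} {W : Opens (EvenIdx π → ℝ)}
  {m n : Type*} [Fintype m] [Fintype n]

/-- A matrix of real constants. -/
noncomputable def constMatrix (W : Opens (EvenIdx π → ℝ)) (C : Matrix m n ℝ) :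
    Matrix m n (SuperFun π W) := Matrix.of fun i j => C i j • (1 : SuperFun π W)

theorem bodyMatrix_constMatrix (C : Matrix m n ℝ) {x} (hx : x ∈ W) :
    bodyMatrix (constMatrix W C) x = C := by
  ext i j
  simp [bodyMatrix, constMatrix, body_smul, body_one hx]

theorem bodyMatrix_res {U : Opens (EvenIdx π → ℝ)} (h : U ≤ W) (F : Matrix m n (SuperFun π W)) {x}
    (hx : x ∈ U) : bodyMatrix (F.map (resHom h)) x = bodyMatrix F x := by
  ext i j
  exact res_body h _ hx

theorem exists_isUnit_res [DecidableEq m] (E : Matrix m m (SuperFun π W)) {p : EvenIdx π → ℝ} (hp : p ∈ W)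
    (hd : (bodyMatrix E p).det ≠ 0) :
    ∃ (U : Opens (EvenIdx π → ℝ)) (h : U ≤ W), p ∈ U ∧ IsUnit (E.map (resHom h)) := by
  refine ⟨⟨_, isOpen_det_bodyMatrix_ne_zero E⟩, fun x hx => hx.1, ⟨hp, hd⟩, ?_⟩
  refine isUnit_of_isUnit_bodyMatrix fun x hx => ?_
  rw [bodyMatrix_res _ _ hx]
  exact hx.2

/-- A matrix whose body has full row rank at `p` has a right inverse near `p`. -/
theorem exists_right_inverse [DecidableEq m] (F : Matrix m n (SuperFun π W)) {p : EvenIdx π → ℝ} (hp : p ∈ W)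
    (hF : ∀ v, Matrix.vecMul v (bodyMatrix F p) = 0 → v = 0) :
    ∃ (U : Opens (EvenIdx π → ℝ)) (h : U ≤ W), p ∈ U ∧
      ∃ C : Matrix n m (SuperFun π U), F.map (resHom h) * C = 1 := by
  -- Multiplying `F` by the constant matrix `F(p)ᵀ` gives a square matrix whose body at `p` is the
  -- Gram matrix of the rows of `F(p)`.
  obtain ⟨U, h, hpU, hu⟩ := exists_isUnit_res (F * constMatrix W (bodyMatrix F p).transpose) hp (by
    rw [bodyMatrix_mul, bodyMatrix_constMatrix _ hp]
    exact det_mul_transpose_ne_zero hF)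
  obtain ⟨C, hC⟩ := hu.exists_right_inv
  refine ⟨U, h, hpU, (constMatrix W (bodyMatrix F p).transpose).map (resHom h) * C, ?_⟩
  rw [← Matrix.mul_assoc, ← Matrix.map_mul, hC]

end ConstMatrix

end SuperFun

namespace GaugeData

variable {G : GaugeData}

/-! ### The starting point near a stationary point -/

section Basic

variable {U : Opens (EvenIdx (G.ε 0) → ℝ)}

theorem T_res {hU : U ≤ G.D} {U' : Opens (EvenIdx (G.ε 0) → ℝ)} (h : U' ≤ U) (i : Fin (G.m 0)) :
    res h (G.T hU i) = G.T (h.trans hU) i := res_res _ _ _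

theorem WeakZero.res {hU : U ≤ G.D} {U' : Opens (EvenIdx (G.ε 0) → ℝ)} (h : U' ≤ U) {f : G.Fun U}
    (hf : G.WeakZero hU f) : G.WeakZero (h.trans hU) (SuperFun.res h f) := by
  obtain ⟨b, rfl⟩ := hf
  refine ⟨fun i => SuperFun.res h (b i), ?_⟩
  rw [← resHom_apply, map_sum]
  refine Finset.sum_congr rfl fun i _ => ?_
  rw [map_mul, resHom_apply, T_res, resHom_apply]

theorem body_T_of_stationary (hU : U ≤ G.D) {x} (hx : x ∈ G.stationary) (hxU : x ∈ U)
    (i : Fin (G.m 0)) : body (G.T hU i) x = 0 := by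
  rw [T, res_body _ _ hxU, hx.2 i]

theorem WeakZero.body_eq_zero {hU : U ≤ G.D} {f : G.Fun U} (hf : G.WeakZero hU f) {x}
    (hx : x ∈ G.stationary) (hxU : x ∈ U) : body f x = 0 := by
  obtain ⟨b, rfl⟩ := hf
  rw [body_sum]
  exact Finset.sum_eq_zero fun i _ => by rw [body_mul, body_T_of_stationary hU hx hxU, zero_mul]

namespace IsGaugeTheory

variable (hG : G.IsGaugeTheory)

include hG

/-- The two alternating sums telescope; the last term of the second one vanishes because there are
no labels beyond stage `L + 1`. -/
theorem M_add_M (k : ℕ) : G.M k + G.M (k + 1) = G.m k := by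
  have h1 : G.M k = ∑ r ∈ Finset.range (G.L + 1), (-1 : ℤ) ^ (r + 1) * (G.m (k + (r + 1)) : ℤ) +
      G.m k := by
    rw [M, Finset.sum_range_succ']
    simp
  have h2 : G.M (k + 1) = ∑ r ∈ Finset.range (G.L + 1), (-1 : ℤ) ^ r * (G.m (k + 1 + r) : ℤ) := by
    rw [M, Finset.sum_range_succ, hG.m_eq_zero (k + 1 + (G.L + 1)) (by omega)]
    simp
  rw [h1, h2, add_right_comm, ← Finset.sum_add_distrib, Finset.sum_eq_zero, zero_add]
  intro r _
  rw [show k + (r + 1) = k + 1 + r by ring, pow_succ]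
  ring

theorem T_eq (hU : U ≤ G.D) (i : Fin (G.m 0)) :
    G.T hU i = sgn (G.ε 0 i) • dL i (res hU G.S₀) := by
  rw [T, dR_of_hasParity hG.parity_S₀, res_smul, zero_add, mul_one, dL_res]

theorem hasParity_T (hU : U ≤ G.D) (i : Fin (G.m 0)) : HasParity (G.T hU i) (G.ε 0 i) := by
  rw [hG.T_eq]
  have := (hG.parity_S₀.res hU).dL i
  rw [add_zero] at this
  exact this.smul _

theorem dR_T (hU : U ≤ G.D) (i j : Fin (G.m 0)) :
    dR i (G.T hU j) = sgn (G.ε 0 j) • dL j (G.T hU i) := by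
  rw [dR_of_hasParity (hG.hasParity_T hU j), hG.T_eq, hG.T_eq, map_smul, map_smul, dL_dL i j, smul_smul,
    smul_smul, smul_smul]
  congr 1
  rw [mul_add, mul_one, sgn_add]
  linear_combination (sgn (G.ε 0 i) * sgn (G.ε 0 j)) * sgn_mul_self (G.ε 0 i * G.ε 0 j)

theorem dL_T_symm (hU : U ≤ G.D) (i j : Fin (G.m 0)) :
    dL i (G.T hU j) = (sgn (G.ε 0 i * G.ε 0 j) * sgn (G.ε 0 i) * sgn (G.ε 0 j)) •
      dL j (G.T hU i) := by
  rw [hG.T_eq, hG.T_eq, map_smul, map_smul, dL_dL i j, smul_smul, smul_smul]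
  congr 1
  linear_combination (-sgn (G.ε 0 j) * sgn (G.ε 0 i * G.ε 0 j)) * sgn_mul_self (G.ε 0 i)

theorem noether_zero_res (hU : U ≤ G.D) (a : Fin (G.m 1)) :
    ∑ i, G.T hU i * res hU (G.Z 0 i a) = 0 := by
  have h := congrArg (resHom hU) (hG.noether_zero a)
  rw [map_sum, map_zero] at h
  rw [← h]
  refine Finset.sum_congr rfl fun i _ => ?_
  rw [map_mul, resHom_apply, resHom_apply, T_res]

theorem noether_succ_res (hU : U ≤ G.D) (k : ℕ) (c a) :
    G.WeakZero hU (∑ b, res hU (G.Z k c b) * res hU (G.Z (k + 1) b a)) := by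
  have h := (hG.noether_succ k c a).res hU
  rw [← resHom_apply, map_sum] at h
  simpa only [map_mul, resHom_apply] using h

/-- Differentiate the Noether identity `T_i R^i = 0`: the terms in which the derivative hits `R` are
multiples of the `T_i`. -/
theorem weakZero_hessian_mul (hU : U ≤ G.D) (j : Fin (G.m 0)) (a : Fin (G.m 1)) :
    G.WeakZero hU (∑ i, dL j (G.T hU i) * res hU (G.Z 0 i a)) := by
  have h := congrArg (dL j) (hG.noether_zero_res hU a)
  rw [map_sum, map_zero] at h
  refine ⟨fun i => -sgn (G.ε 0 j * G.ε 0 i) • dL j (res hU (G.Z 0 i a)), ?_⟩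
  rw [← sub_eq_zero, ← h, ← Finset.sum_sub_distrib]
  refine Finset.sum_congr rfl fun i _ => ?_
  rw [dL_mul, (hG.hasParity_T hU i).twist, mul_smul_comm, neg_smul, sub_neg_eq_add, smul_mul_assoc]

end IsGaugeTheory

/-- The Hessian of the action at a point. -/
noncomputable def hessian (G : GaugeData) (x : EvenIdx (G.ε 0) → ℝ) :
    Matrix (Fin (G.m 0)) (Fin (G.m 0)) ℝ := Matrix.of fun i j => body (dL i (dR j G.S₀)) x

theorem body_dL_T (hU : U ≤ G.D) {x} (hx : x ∈ U) (i j : Fin (G.m 0)) :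
    body (dL i (G.T hU j)) x = G.hessian x i j := by
  rw [T, dL_res, res_body _ _ hx]
  rfl

/-- The values of the generators at a point. -/
noncomputable def generator (G : GaugeData) (x : EvenIdx (G.ε 0) → ℝ) (k : ℕ) :
    Matrix (Fin (G.m k)) (Fin (G.m (k + 1))) ℝ := Matrix.of fun b a => body (G.Z k b a) x

namespace IsGaugeTheory

variable (hG : G.IsGaugeTheory)

include hG

theorem hessian_mul_generator {x} (hx : x ∈ G.stationary) :
    G.hessian x * G.generator x 0 = 0 := by
  ext j a
  have h := (hG.weakZero_hessian_mul le_rfl j a).body_eq_zero hx hx.1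
  rw [body_sum] at h
  rw [Matrix.mul_apply, Matrix.zero_apply, ← h]
  refine Finset.sum_congr rfl fun i _ => ?_
  rw [body_mul, body_dL_T le_rfl hx.1, res_body _ _ hx.1]
  rfl

theorem generator_mul_generator {x} (hx : x ∈ G.stationary) (k : ℕ) :
    G.generator x k * G.generator x (k + 1) = 0 := by
  ext c a
  have h := (hG.noether_succ k c a).body_eq_zero hx hx.1
  rw [body_sum] at h
  rw [Matrix.mul_apply, Matrix.zero_apply, ← h]
  exact Finset.sum_congr rfl fun b _ => (body_mul _ _ _).symm

theorem rank_generator_add {x} (hx : x ∈ G.stationary) (k : ℕ) :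
    (G.generator x k).rank + (G.generator x (k + 1)).rank = G.m (k + 1) := by
  have h1 := hG.rank_Z x hx k
  have h2 := hG.rank_Z x hx (k + 1)
  have h3 := hG.M_add_M (k + 1)
  have h4 : ((G.generator x k).rank : ℤ) + (G.generator x (k + 1)).rank = G.m (k + 1) := by
    rw [← h3, ← h1, ← h2]; rfl
  exact_mod_cast h4

theorem rank_hessian_add {x} (hx : x ∈ G.stationary) :
    (G.hessian x).rank + (G.generator x 0).rank = G.m 0 := by
  have h1 := hG.rank_hessian x hx
  have h2 := hG.rank_Z x hx 0
  have h3 := hG.M_add_M 0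
  have h4 : ((G.hessian x).rank : ℤ) + (G.generator x 0).rank = G.m 0 := by
    rw [← h3, ← h1, ← h2]; rfl
  exact_mod_cast h4

/-- The body of an entry vanishes unless its two indices have equal parity, and then the general
sign of `dL_T_symm` reduces to a sign depending on the column only, as `exists_principal_minor`
requires. -/
theorem hessian_symm {x} (hx : x ∈ G.D) (i k : Fin (G.m 0)) :
    G.hessian x i k = sgn (G.ε 0 k) * G.hessian x k i := by
  rw [← body_dL_T le_rfl hx, ← body_dL_T le_rfl hx, hG.dL_T_symm, body_smul]
  have hp := (hG.hasParity_T le_rfl i).dL k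
  by_cases h : G.ε 0 k + G.ε 0 i = 0
  · have h' : G.ε 0 k = G.ε 0 i := by
      have h2 : ∀ a b : ZMod 2, a + b = 0 → a = b := by decide
      exact h2 _ _ h
    rw [h']
    rcases zmod_two_eq_zero_or_one (G.ε 0 i) with h | h <;> simp [h]
  · rw [hp.body_eq_zero h]; simp

/-- Transversal and longitudinal fields exist near every stationary point. -/
theorem exists_transversalLongitudinal {p} (hp : p ∈ G.stationary) :
    ∃ (U : Opens (EvenIdx (G.ε 0) → ℝ)) (hU : U ≤ G.D) (Ξ : Finset (Fin (G.m 0)))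
      (y : Fin (G.m 0) → G.Fun U) (N : Fin (G.m 0) → Fin (G.m 0) → G.Fun U),
      p ∈ U ∧ G.IsTransversalLongitudinal hU Ξ y N := by
  obtain ⟨Ξ, hcard, hminor⟩ := exists_principal_minor (fun i => sgn_mul_self (G.ε 0 i))
    (hG.hessian_symm hp.1)
  -- The transversal fields are the equations of motion of a nonsingular principal minor of the
  -- Hessian; the other original fields are kept as longitudinal fields.
  let y₀ : Fin (G.m 0) → G.Fun G.D := fun j => if j ∈ Ξ then G.T le_rfl j else var j
  let J : Matrix (Fin (G.m 0)) (Fin (G.m 0)) (G.Fun G.D) := Matrix.of fun i k => dL i (y₀ k)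
  have hJ1 : ∀ i, ∀ k ∈ Ξ, bodyMatrix J p i k = G.hessian p i k := by
    intro i k hk
    change body (dL i (if k ∈ Ξ then G.T le_rfl k else var k)) p = _
    rw [if_pos hk, body_dL_T le_rfl hp.1]
  have hJ2 : ∀ i, ∀ k ∉ Ξ, bodyMatrix J p i k = if i = k then 1 else 0 := by
    intro i k hk
    change body (dL i (if k ∈ Ξ then G.T le_rfl k else var k)) p = _
    rw [if_neg hk, dL_var]
    split_ifs
    · exact body_one hp.1
    · rfl
  have hdet : (bodyMatrix J p).det ≠ 0 := by
    intro hd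
    -- The unit columns outside `Ξ` force `v` to be supported on `Ξ`; the columns in `Ξ` are those
    -- of the Hessian, so the minor gives `v = 0`.
    obtain ⟨v, hv, hv0⟩ := Matrix.exists_vecMul_eq_zero_iff.2 hd
    refine hv (hminor v (fun k hk => ?_) fun k hk => ?_)
    · have h := congrFun hv0 k
      simp only [Matrix.vecMul, dotProduct, hJ2 _ k hk] at h
      simpa using h
    · have h := congrFun hv0 k
      simp only [Matrix.vecMul, dotProduct, hJ1 _ k hk] at h
      exact h
  obtain ⟨U, hU, hpU, hu⟩ := exists_isUnit_res J hp.1 hdet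
  obtain ⟨N, hN1, hN2⟩ := isUnit_iff_exists.1 hu
  have hTL : ∀ I ∈ Ξ, res hU (y₀ I) = G.T hU I := by
    intro I hI
    change res hU (if I ∈ Ξ then G.T le_rfl I else var I) = _
    rw [if_pos hI, T_res]
  refine ⟨U, hU, Ξ, fun j => res hU (y₀ j), N, hpU, ?_, fun j => ?_, fun j k => ?_, fun i k => ?_,
    fun I hI a => ?_, fun I hI => ?_⟩
  · rw [hcard]; exact hG.rank_hessian p hp
  · refine HasParity.res _ ?_
    by_cases h : j ∈ Ξ
    · simp only [y₀, h, if_true]; exact hG.hasParity_T _ j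
    · simp only [y₀, h, if_false]; exact hasParity_var j
  · have h := congrFun (congrFun hN2 j) k
    rw [Matrix.mul_apply, Matrix.one_apply] at h
    rw [← h]
    exact Finset.sum_congr rfl fun i _ => by rw [dL_res]; rfl
  · have h := congrFun (congrFun hN1 i) k
    rw [Matrix.mul_apply, Matrix.one_apply] at h
    rw [← h]
    exact Finset.sum_congr rfl fun j _ => by rw [dL_res]; rfl
  · simp only [hTL I hI, hG.dR_T]
    obtain ⟨b, hb⟩ := hG.weakZero_hessian_mul hU I a
    refine ⟨fun i => sgn (G.ε 0 I) • b i, ?_⟩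
    simp only [smul_mul_assoc, mul_smul_comm, ← Finset.smul_sum, hb]
  · refine ⟨fun i => if i = I then 1 else 0, ?_⟩
    simp only [hTL I hI]
    simp

end IsGaugeTheory

end Basic

/-! ### The equations of motion as functions of the transversal fields -/

section Transversal

variable {U : Opens (EvenIdx (G.ε 0) → ℝ)} {hU : U ≤ G.D} {Ξ : Finset (Fin (G.m 0))}
  {y : Fin (G.m 0) → G.Fun U} {N : Fin (G.m 0) → Fin (G.m 0) → G.Fun U}

theorem IsTransversalLongitudinal.isCoordSystem (h : G.IsTransversalLongitudinal hU Ξ y N) :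
    IsCoordSystem y N := ⟨h.parity, h.inverse_left, h.inverse_right⟩

theorem coordD_eq (N : Fin (G.m 0) → Fin (G.m 0) → G.Fun U) (j : Fin (G.m 0)) (f : G.Fun U) :
    G.coordD N j f = vectorField (N j) f := (vectorField_apply _ _).symm

theorem IsTransversalLongitudinal.body_eq_zero (h : G.IsTransversalLongitudinal hU Ξ y N) {x}
    (hx : x ∈ G.stationary) (hxU : x ∈ U) {I} (hI : I ∈ Ξ) : body (y I) x = 0 :=
  (h.vanishes I hI).body_eq_zero hx hxU

/-- The columns of the body of the Jacobian matrix belonging to `Ξ`. -/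
noncomputable def jacobianBody (Ξ : Finset (Fin (G.m 0))) (y : Fin (G.m 0) → G.Fun U)
    (x : EvenIdx (G.ε 0) → ℝ) : Matrix (Fin (G.m 0)) Ξ ℝ := Matrix.of fun j I => body (dL j (y I)) x

/-- The corresponding rows of the inverse Jacobian provide a left inverse. -/
theorem IsTransversalLongitudinal.rank_jacobianBody (h : G.IsTransversalLongitudinal hU Ξ y N) {x}
    (hxU : x ∈ U) : (jacobianBody Ξ y x).rank = Ξ.card := by
  let P : Matrix Ξ (Fin (G.m 0)) ℝ := Matrix.of fun I j => body (N I j) x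
  have hP : P * jacobianBody Ξ y x = 1 := by
    ext I K
    have h1 := congrArg (fun f => body f x) (h.inverse_left I K)
    simp only [body_sum, body_mul] at h1
    rw [Matrix.mul_apply, Matrix.one_apply]
    refine h1.trans ?_
    by_cases hIK : I = K
    · subst hIK; simp [body_one hxU]
    · have : (I : Fin (G.m 0)) ≠ K := fun hh => hIK (Subtype.ext hh)
      simp [hIK, this, body_zero]
  have h2 := Matrix.rank_mul_le_right P (jacobianBody Ξ y x)
  rw [hP, Matrix.rank_one, Fintype.card_coe] at h2
  have h3 := Matrix.rank_le_card_width (jacobianBody Ξ y x)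
  rw [Fintype.card_coe] at h3
  exact le_antisymm h3 h2

/-- The equations of motion are `O(ξ)` near every stationary point. -/
theorem IsGaugeTheory.exists_T_inIdeal (hG : G.IsGaugeTheory) {p} (hp : p ∈ G.stationary)
    (hpU : p ∈ U) (h : G.IsTransversalLongitudinal hU Ξ y N) :
    ∃ (U' : Opens (EvenIdx (G.ε 0) → ℝ)) (h' : U' ≤ U), p ∈ U' ∧
      ∀ i, InIdeal Ξ (fun j => res h' (y j)) (G.T (h'.trans hU) i) := by
  choose! b hb using h.vanishes
  -- The columns are the gauge generators `R` and the coefficients `b` in `ξ^I = T_i b^i`, so the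
  -- row vector `T F` consists of zeros and the `ξ^I`.
  let F : Matrix (Fin (G.m 0)) (Fin (G.m 1) ⊕ Ξ) (G.Fun U) :=
    Matrix.of fun i => Sum.elim (fun a => res hU (G.Z 0 i a)) fun I => b I i
  let B : Matrix (Fin (G.m 0)) Ξ ℝ := Matrix.of fun i I => body (b I i) p
  -- Differentiating `ξ^I = T_i b^i` at `p`, where `T` vanishes, leaves only the derivatives of `T`.
  have hHB : G.hessian p * B = jacobianBody Ξ y p := by
    ext j I
    rw [Matrix.mul_apply]
    change _ = body (dL j (y I)) p
    rw [hb I I.2, map_sum, body_sum]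
    refine Finset.sum_congr rfl fun i _ => ?_
    rw [dL_mul, body_add, body_mul, body_mul, body_dL_T hU hpU, (hG.hasParity_T hU i).twist, body_smul,
      body_T_of_stationary hU hp hpU]
    simp [B]
  have hrank : (G.hessian p).rank = (G.hessian p * B).rank := by
    rw [hHB, h.rank_jacobianBody hpU]
    have h1 : ((G.hessian p).rank : ℤ) = Ξ.card := (hG.rank_hessian p hp).trans h.card_eq.symm
    exact_mod_cast h1
  -- Full row rank at `p`: `vR = 0` puts `v` into the row space of the Hessian `H` by exactness, `v
  -- = μH`. Then `μHB = 0`, and `HB` has the same rank as `H`, so `μH = 0`.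
  obtain ⟨U', h', hpU', C, hC⟩ := exists_right_inverse F hpU (fun v hv => by
    have hv1 : Matrix.vecMul v (G.generator p 0) = 0 := by
      funext a
      have h2 := congrFun hv (Sum.inl a)
      refine Eq.trans ?_ h2
      simp only [Matrix.vecMul, dotProduct]
      refine Finset.sum_congr rfl fun i _ => ?_
      congr 1
      exact (res_body hU (G.Z 0 i a) hpU).symm
    have hv2 : Matrix.vecMul v B = 0 := by
      funext I
      exact congrFun hv (Sum.inr I)
    obtain ⟨μ, rfl⟩ := exists_vecMul_eq_of_rank (hG.hessian_mul_generator hp)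
      (by rw [hG.rank_hessian_add hp, Fintype.card_fin]) hv1
    rw [Matrix.vecMul_vecMul] at hv2
    exact vecMul_eq_zero_of_rank_mul hrank.le hv2)
  refine ⟨U', h', hpU', fun i => ?_⟩
  have hTF : ∀ q, ∑ j, G.T (h'.trans hU) j * res h' (F j q) =
      Sum.elim (fun _ => 0) (fun I : Ξ => res h' (y I)) q := by
    rintro (a | I)
    · have := hG.noether_zero_res (h'.trans hU) a
      rw [Sum.elim_inl, ← this]
      refine Finset.sum_congr rfl fun j _ => ?_
      congr 1
      exact res_res hU h' _
    · rw [Sum.elim_inr, hb I I.2, ← resHom_apply, map_sum]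
      refine Finset.sum_congr rfl fun j _ => ?_
      rw [map_mul, resHom_apply, T_res]
      rfl
  -- With a right inverse `C` of `F` one has `T = (T F) C`, a combination of the `ξ^I`.
  have hT : G.T (h'.trans hU) i = ∑ q, Sum.elim (fun _ => 0) (fun I : Ξ => res h' (y I)) q * C q i := by
    simp only [← hTF, Finset.sum_mul]
    rw [Finset.sum_comm]
    simp only [mul_assoc, ← Finset.mul_sum]
    have hC' : ∀ j, ∑ q, res h' (F j q) * C q i = if j = i then 1 else 0 := by
      intro j
      have := congrFun (congrFun hC j) i
      rwa [Matrix.mul_apply, Matrix.one_apply] at this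
    simp [hC']
  rw [hT, Fintype.sum_sum_type]
  simp only [Sum.elim_inl, zero_mul, Finset.sum_const_zero, zero_add, Sum.elim_inr]
  exact InIdeal.sum fun I _ => inIdeal_coord_mul (y := fun j => res h' (y j)) I.2 _

theorem IsTransversalLongitudinal.res (h : G.IsTransversalLongitudinal hU Ξ y N)
    {U' : Opens (EvenIdx (G.ε 0) → ℝ)} (h' : U' ≤ U) :
    G.IsTransversalLongitudinal (h'.trans hU) Ξ (fun j => SuperFun.res h' (y j))
      fun j i => SuperFun.res h' (N j i) where
  card_eq := h.card_eq
  parity := (h.isCoordSystem.res h').parity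
  inverse_left := (h.isCoordSystem.res h').inverse_left
  inverse_right := (h.isCoordSystem.res h').inverse_right
  gauge_invariant I hI a := by
    have := (h.gauge_invariant I hI a).res h'
    rw [← resHom_apply, map_sum] at this
    simpa only [map_mul, resHom_apply, dR_res, res_res] using this
  vanishes I hI := (h.vanishes I hI).res h'

end Transversal

end GaugeData

/-! ### Leading terms -/

namespace SuperFun

section Square

variable {V : Type*} [Fintype V] [LinearOrder V] {π : V → ZMod 2} {W : Opens (EvenIdx π → ℝ)}
  {y : V → SuperFun π W} {N : V → V → SuperFun π W} {Ξ : Finset V} {f g : SuperFun π W}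

/-- `f = O(ξ²)`. -/
def InIdealSq (Ξ : Finset V) (y : V → SuperFun π W) (f : SuperFun π W) : Prop :=
  ∃ g : V → V → SuperFun π W, f = ∑ I ∈ Ξ, ∑ K ∈ Ξ, (y I * y K) * g I K

theorem inIdealSq_zero : InIdealSq Ξ y 0 := ⟨0, by simp⟩

theorem InIdealSq.add (hf : InIdealSq Ξ y f) (hg : InIdealSq Ξ y g) : InIdealSq Ξ y (f + g) := by
  obtain ⟨a, rfl⟩ := hf
  obtain ⟨b, rfl⟩ := hg
  exact ⟨a + b, by simp [mul_add, Finset.sum_add_distrib]⟩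

theorem InIdealSq.smul (hf : InIdealSq Ξ y f) (c : ℝ) : InIdealSq Ξ y (c • f) := by
  obtain ⟨a, rfl⟩ := hf
  exact ⟨c • a, by simp [Finset.smul_sum, mul_smul_comm]⟩

theorem InIdealSq.neg (hf : InIdealSq Ξ y f) : InIdealSq Ξ y (-f) := by
  have := hf.smul (-1)
  rwa [neg_one_smul] at this

theorem InIdealSq.sum {ι : Type*} {s : Finset ι} {f : ι → SuperFun π W}
    (h : ∀ i ∈ s, InIdealSq Ξ y (f i)) : InIdealSq Ξ y (∑ i ∈ s, f i) := by
  induction s using Finset.cons_induction with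
  | empty => exact inIdealSq_zero
  | cons a s ha ih =>
    rw [Finset.sum_cons]
    exact (h a (by simp)).add (ih fun i hi => h i (by simp [hi]))

theorem InIdealSq.mul_right (hf : InIdealSq Ξ y f) (g : SuperFun π W) : InIdealSq Ξ y (f * g) := by
  obtain ⟨a, rfl⟩ := hf
  exact ⟨fun I K => a I K * g, by simp [Finset.sum_mul, mul_assoc]⟩

theorem InIdeal.coord_mul {I : V} (hI : I ∈ Ξ) (hf : InIdeal Ξ y f) : InIdealSq Ξ y (y I * f) := by
  obtain ⟨a, rfl⟩ := hf
  refine ⟨fun J K => if J = I then a K else 0, ?_⟩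
  symm
  refine (Finset.sum_eq_single_of_mem I hI fun J _ hJ => ?_).trans ?_
  · simp [hJ]
  · simp [Finset.mul_sum, mul_assoc]

theorem InIdealSq.twist (hy : ∀ j, HasParity (y j) (π j)) (hf : InIdealSq Ξ y f) (a : ZMod 2) :
    InIdealSq Ξ y (SuperFun.twist a f) := by
  obtain ⟨g, rfl⟩ := hf
  refine ⟨fun I K => (sgn (a * π I) * sgn (a * π K)) • SuperFun.twist a (g I K), ?_⟩
  simp only [map_sum]
  refine Finset.sum_congr rfl fun I _ => Finset.sum_congr rfl fun K _ => ?_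
  rw [twist_mul, twist_mul, (hy I).twist, (hy K).twist, smul_mul_smul_comm, smul_mul_assoc,
    mul_smul_comm]

theorem IsCoordSystem.apply_mul_eq_zero (hc : IsCoordSystem y N) {j : V}
    (hf : vectorField (N j) f = 0) (hg : vectorField (N j) g = 0) :
    vectorField (N j) (f * g) = 0 := by
  rw [(hc.isVectorField j).map_mul, hf, hg, zero_mul, mul_zero, add_zero]

end Square

end SuperFun

namespace GaugeData

variable {G : GaugeData}

section Leading

variable {U : Opens (EvenIdx (G.ε 0) → ℝ)} {hU : U ≤ G.D} {Ξ : Finset (Fin (G.m 0))}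
  {y : Fin (G.m 0) → G.Fun U} {N : Fin (G.m 0) → Fin (G.m 0) → G.Fun U}

/-- `h` and `Z₀` are the coefficients of the leading terms of the equations of motion and of the
generators. -/
structure IsLeadingCoeff (hU : U ≤ G.D) (Ξ : Finset (Fin (G.m 0))) (y : Fin (G.m 0) → G.Fun U)
    (N : Fin (G.m 0) → Fin (G.m 0) → G.Fun U) (h : Fin (G.m 0) → Fin (G.m 0) → G.Fun U)
    (Z₀ : ∀ k, Fin (G.m k) → Fin (G.m (k + 1)) → G.Fun U) : Prop where
  h_const : ∀ I ∈ Ξ, ∀ i, ∀ J ∈ Ξ, vectorField (N J) (h I i) = 0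
  T_sub : ∀ i, InIdealSq Ξ y (G.T hU i - ∑ I ∈ Ξ, y I * h I i)
  Z_const : ∀ k b a, ∀ J ∈ Ξ, vectorField (N J) (Z₀ k b a) = 0
  Z_sub : ∀ k b a, InIdeal Ξ y (res hU (G.Z k b a) - Z₀ k b a)

theorem IsLeading.exists_coeff {T₁ : Fin (G.m 0) → G.Fun U}
    {Z₀ : ∀ k, Fin (G.m k) → Fin (G.m (k + 1)) → G.Fun U} (hl : G.IsLeading hU Ξ y N T₁ Z₀) :
    ∃ h, IsLeadingCoeff hU Ξ y N h Z₀ ∧ ∀ i, T₁ i = ∑ I ∈ Ξ, y I * h I i := by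
  choose h g h1 h2 h3 using hl.T_expansion
  refine ⟨fun I i => h i I, ⟨fun I hI i J hJ => ?_, fun i => ⟨g i, ?_⟩, fun k b a J hJ => ?_,
    fun k b a => ?_⟩, h2⟩
  · rw [← coordD_eq]; exact h1 i I hI J hJ
  · rw [h3, ← h2 i, add_sub_cancel_left]
  · rw [← coordD_eq]; exact (hl.Z_expansion k b a).1 J hJ
  · obtain ⟨g, hg⟩ := (hl.Z_expansion k b a).2
    exact ⟨g, by rw [hg, add_sub_cancel_left]⟩

variable {h h' : Fin (G.m 0) → Fin (G.m 0) → G.Fun U}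
  {Z₀ Z₀' : ∀ k, Fin (G.m k) → Fin (G.m (k + 1)) → G.Fun U}

theorem IsLeadingCoeff.isLeading (hl : IsLeadingCoeff hU Ξ y N h Z₀) :
    G.IsLeading hU Ξ y N (fun i => ∑ I ∈ Ξ, y I * h I i) Z₀ where
  T_expansion i := by
    obtain ⟨g, hg⟩ := hl.T_sub i
    refine ⟨fun I => h I i, g, fun I hI J hJ => ?_, rfl, ?_⟩
    · rw [coordD_eq]; exact hl.h_const I hI i J hJ
    · rw [← hg, add_sub_cancel]
  Z_expansion k b a := by
    obtain ⟨g, hg⟩ := hl.Z_sub k b a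
    refine ⟨fun J hJ => ?_, g, ?_⟩
    · rw [coordD_eq]; exact hl.Z_const k b a J hJ
    · rw [← hg, add_sub_cancel]

/-- With `T_i = ξ^I g_I`, replacing each `g_I` by its leading term changes `T_i` by `O(ξ²)` only. -/
theorem IsTransversalLongitudinal.exists_isLeadingCoeff (hc : G.IsTransversalLongitudinal hU Ξ y N)
    (ha : IsAdapted Ξ y N) (hT : ∀ i, InIdeal Ξ y (G.T hU i)) :
    ∃ h Z₀, IsLeadingCoeff hU Ξ y N h Z₀ := by
  choose g hg using hT
  choose h h1 h2 using fun I i => ha.exists_expand hc.isCoordSystem (g i I)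
  choose Z₀ Z1 Z2 using fun k b a => ha.exists_expand hc.isCoordSystem
    (SuperFun.res hU (G.Z k b a))
  refine ⟨h, Z₀, fun I _ i => h1 I i, fun i => ?_, Z1, Z2⟩
  rw [hg i, ← Finset.sum_sub_distrib]
  refine InIdealSq.sum fun I hI => ?_
  rw [← mul_sub]
  exact (h2 I i).coord_mul hI

theorem IsLeadingCoeff.h_unique (hc : IsCoordSystem y N) (ha : IsAdapted Ξ y N)
    (hl : IsLeadingCoeff hU Ξ y N h Z₀) (hl' : IsLeadingCoeff hU Ξ y N h' Z₀') {I} (hI : I ∈ Ξ) (i) :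
    h I i = h' I i := by
  rw [← sub_eq_zero]
  refine ha.linear_unique hc (h := fun I => h I i - h' I i) (fun I hI J hJ => ?_) ?_ hI
  · rw [map_sub, hl.h_const I hI i J hJ, hl'.h_const I hI i J hJ, sub_zero]
  · have := (hl.T_sub i).neg.add (hl'.T_sub i)
    rw [neg_sub, sub_add_sub_cancel, ← Finset.sum_sub_distrib] at this
    simp only [mul_sub]
    exact this

theorem IsLeadingCoeff.Z_unique (hc : IsCoordSystem y N) (ha : IsAdapted Ξ y N)
    (hl : IsLeadingCoeff hU Ξ y N h Z₀) (hl' : IsLeadingCoeff hU Ξ y N h' Z₀') : Z₀ = Z₀' := by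
  funext k b a
  rw [← sub_eq_zero]
  refine ha.eq_zero_of_inIdeal hc ?_ fun J hJ => ?_
  · have := (hl'.Z_sub k b a).sub (hl.Z_sub k b a)
    rwa [sub_sub_sub_cancel_left] at this
  · rw [map_sub, hl.Z_const k b a J hJ, hl'.Z_const k b a J hJ, sub_zero]

theorem IsLeadingCoeff.hasParity_Z (hG : G.IsGaugeTheory) (hc : IsCoordSystem y N)
    (ha : IsAdapted Ξ y N) (hl : IsLeadingCoeff hU Ξ y N h Z₀) (k b a) :
    HasParity (Z₀ k b a) (G.ε k b + G.ε (k + 1) a) :=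
  ha.hasParity_of_expand hc ((hG.parity_Z k b a).res hU) (hl.Z_const k b a) (hl.Z_sub k b a)

/-- The parity automorphism, corrected by signs, produces another family of leading coefficients;
uniqueness makes it equal to the given one. -/
theorem IsLeadingCoeff.hasParity_h (hG : G.IsGaugeTheory) (hc : IsCoordSystem y N)
    (ha : IsAdapted Ξ y N) (hl : IsLeadingCoeff hU Ξ y N h Z₀) {I} (hI : I ∈ Ξ) (i) :
    HasParity (h I i) (G.ε 0 I + G.ε 0 i) := by
  have hl' : IsLeadingCoeff hU Ξ y N (fun I i => sgn (G.ε 0 I + G.ε 0 i) • twist 1 (h I i)) Z₀ := by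
    refine ⟨fun I hI i J hJ => ?_, fun i => ?_, hl.Z_const, hl.Z_sub⟩
    · have := (hc.isVectorField J).twist 1 (h I i)
      rw [hl.h_const I hI i J hJ, map_zero] at this
      rw [map_smul, (smul_eq_zero.1 this.symm).resolve_left (sgn_ne_zero _), smul_zero]
    · have := ((hl.T_sub i).twist hc.parity 1).smul (sgn (G.ε 0 i))
      rw [map_sub, hasParity_iff.1 (hG.hasParity_T hU i), smul_sub, smul_smul, sgn_mul_self, one_smul,
        map_sum, Finset.smul_sum] at this
      refine (congrArg (InIdealSq Ξ y) ?_).mp this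
      congr 1
      refine Finset.sum_congr rfl fun I _ => ?_
      rw [twist_mul, hasParity_iff.1 (hc.parity I), smul_mul_assoc, mul_smul_comm, smul_smul, sgn_add,
        mul_comm]
  rw [hasParity_iff]
  have e := hl.h_unique hc ha hl' hI i
  conv_rhs => rw [e]
  rw [smul_smul, sgn_mul_self, one_smul]

/-- This is the part of `T_i R^i = 0` linear in `ξ`: every correction to the leading terms is
`O(ξ²)`, so `linear_unique` applies. -/
theorem IsLeadingCoeff.h_mul_Z (hG : G.IsGaugeTheory) (hc : IsCoordSystem y N)
    (ha : IsAdapted Ξ y N) (hl : IsLeadingCoeff hU Ξ y N h Z₀) {I} (hI : I ∈ Ξ) (a) :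
    ∑ i, h I i * Z₀ 0 i a = 0 := by
  refine ha.linear_unique hc (h := fun I => ∑ i, h I i * Z₀ 0 i a) (fun I hI J hJ => ?_) ?_ hI
  · rw [map_sum]
    exact Finset.sum_eq_zero fun i _ =>
      hc.apply_mul_eq_zero (hl.h_const I hI i J hJ) (hl.Z_const 0 i a J hJ)
  · have h1 : ∑ I ∈ Ξ, y I * ∑ i, h I i * Z₀ 0 i a = -∑ i,
        ((G.T hU i - ∑ I ∈ Ξ, y I * h I i) * res hU (G.Z 0 i a) +
          ∑ I ∈ Ξ, y I * (h I i * (res hU (G.Z 0 i a) - Z₀ 0 i a))) := by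
      have h2 := hG.noether_zero_res hU a
      have h3 : ∑ I ∈ Ξ, y I * ∑ i, h I i * Z₀ 0 i a =
          ∑ i, ∑ I ∈ Ξ, y I * (h I i * Z₀ 0 i a) := by
        simp only [Finset.mul_sum]
        exact Finset.sum_comm
      rw [h3, ← sub_eq_zero, sub_neg_eq_add, ← Finset.sum_add_distrib, ← h2]
      refine Finset.sum_congr rfl fun i _ => ?_
      simp only [sub_mul, mul_sub, Finset.sum_sub_distrib, Finset.sum_mul, mul_assoc]
      abel
    rw [h1]
    refine InIdealSq.neg (InIdealSq.sum fun i _ => ((hl.T_sub i).mul_right _).add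
      (InIdealSq.sum fun I hI => ?_))
    exact ((hl.Z_sub 0 i a).mul_left hc.parity _).coord_mul hI

/-- The product differs from a weakly vanishing one by `O(ξ)`, and weakly vanishing functions are
`O(ξ)` because the `T_i` are. Being independent of `ξ`, it is zero. -/
theorem IsLeadingCoeff.Z_mul_Z (hG : G.IsGaugeTheory) (hc : IsCoordSystem y N)
    (ha : IsAdapted Ξ y N) (hT : ∀ i, InIdeal Ξ y (G.T hU i)) (hl : IsLeadingCoeff hU Ξ y N h Z₀)
    (k c a) : ∑ b, Z₀ k c b * Z₀ (k + 1) b a = 0 := by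
  refine ha.eq_zero_of_inIdeal hc ?_ fun J hJ => ?_
  · obtain ⟨b, hb⟩ := hG.noether_succ_res hU k c a
    have h1 : ∑ b, Z₀ k c b * Z₀ (k + 1) b a = ∑ i, G.T hU i * b i - ∑ b,
        (Z₀ k c b * (res hU (G.Z (k + 1) b a) - Z₀ (k + 1) b a) +
          (res hU (G.Z k c b) - Z₀ k c b) * res hU (G.Z (k + 1) b a)) := by
      rw [← hb, ← Finset.sum_sub_distrib]
      refine Finset.sum_congr rfl fun b _ => ?_
      simp only [sub_mul, mul_sub]
      abel
    rw [h1]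
    refine (InIdeal.sum fun i _ => (hT i).mul_right _).sub (InIdeal.sum fun b _ => ?_)
    exact ((hl.Z_sub _ _ _).mul_left hc.parity _).add ((hl.Z_sub _ _ _).mul_right _)
  · rw [map_sum]
    exact Finset.sum_eq_zero fun b _ =>
      hc.apply_mul_eq_zero (hl.Z_const k c b J hJ) (hl.Z_const (k + 1) b a J hJ)

theorem InIdealSq_res {f : G.Fun U} {U' : Opens (EvenIdx (G.ε 0) → ℝ)} (h' : U' ≤ U)
    (hf : InIdealSq Ξ y f) : InIdealSq Ξ (fun j => res h' (y j)) (res h' f) := by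
  obtain ⟨g, rfl⟩ := hf
  refine ⟨fun I K => res h' (g I K), ?_⟩
  simp only [← resHom_apply, map_sum, map_mul]

theorem InIdeal_res {f : G.Fun U} {U' : Opens (EvenIdx (G.ε 0) → ℝ)} (h' : U' ≤ U)
    (hf : InIdeal Ξ y f) : InIdeal Ξ (fun j => res h' (y j)) (res h' f) := by
  obtain ⟨g, rfl⟩ := hf
  refine ⟨fun I => res h' (g I), ?_⟩
  simp only [← resHom_apply, map_sum, map_mul]

theorem vectorField_res {f : G.Fun U} {c : Fin (G.m 0) → G.Fun U}
    {U' : Opens (EvenIdx (G.ε 0) → ℝ)} (h' : U' ≤ U) :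
    vectorField (fun i => res h' (c i)) (res h' f) = res h' (vectorField c f) := by
  simp only [vectorField_apply, dL_res]
  simp only [← resHom_apply, map_sum, map_mul]

theorem IsLeadingCoeff.res (hl : IsLeadingCoeff hU Ξ y N h Z₀)
    {U' : Opens (EvenIdx (G.ε 0) → ℝ)} (h' : U' ≤ U) :
    IsLeadingCoeff (h'.trans hU) Ξ (fun j => SuperFun.res h' (y j))
      (fun j i => SuperFun.res h' (N j i)) (fun I i => SuperFun.res h' (h I i))
      fun k b a => SuperFun.res h' (Z₀ k b a) where
  h_const I hI i J hJ := by
    rw [vectorField_res, hl.h_const I hI i J hJ]; exact (resHom h').map_zero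
  T_sub i := by
    have := InIdealSq_res h' (hl.T_sub i)
    rw [← resHom_apply, map_sub, map_sum] at this
    simpa only [map_mul, resHom_apply, T_res] using this
  Z_const k b a J hJ := by
    rw [vectorField_res, hl.Z_const k b a J hJ]; exact (resHom h').map_zero
  Z_sub k b a := by
    have := InIdeal_res h' (hl.Z_sub k b a)
    rw [← resHom_apply, map_sub] at this
    simpa only [resHom_apply, res_res] using this

end Leading

/-! ### The linear part of the Koszul-Tate differential -/

section BigMatrix

/-- The labels of the transversal fields and the antifields. -/
abbrev LinIdx (G : GaugeData) (Ξ : Finset (Fin (G.m 0))) : Type :=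
  Ξ ⊕ (Σ k : Fin (G.L + 2), Fin (G.m k))

/-- The Grassmann parities of the transversal fields and the antifields. -/
def linParity (G : GaugeData) (Ξ : Finset (Fin (G.m 0))) : G.LinIdx Ξ → ZMod 2 :=
  Sum.elim (fun I => G.ε 0 I) fun q => G.ε q.1 q.2 + ((q.1 : ℕ) : ZMod 2) + 1

variable {R : Type*} {Ξ : Finset (Fin (G.m 0))}

/-- The generators `Z k` as a block of a matrix with blocks labelled by all pairs of stages. -/
def stageBlock [Zero R] (Z : ∀ k, Fin (G.m k) → Fin (G.m (k + 1)) → R) (k l : ℕ)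
    (b : Fin (G.m k)) (a : Fin (G.m l)) : R :=
  if h : l = k + 1 then Z k b (Fin.cast (congrArg G.m h) a) else 0

/-- The rows of the transversal fields. -/
def transversalBlock [Zero R] (h : Fin (G.m 0) → Fin (G.m 0) → R) (I : Fin (G.m 0)) (l : ℕ)
    (a : Fin (G.m l)) : R :=
  if hl : l = 0 then h I (Fin.cast (congrArg G.m hl) a) else 0

/-- The matrix of the Koszul-Tate differential on the span of transversal fields and antifields. -/
def linMatrix [Zero R] (Ξ : Finset (Fin (G.m 0))) (h : Fin (G.m 0) → Fin (G.m 0) → R)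
    (Z : ∀ k, Fin (G.m k) → Fin (G.m (k + 1)) → R) : Matrix (G.LinIdx Ξ) (G.LinIdx Ξ) R :=
  Matrix.of fun p q => Sum.elim (fun I : Ξ => Sum.elim (fun _ => 0)
    (fun q => transversalBlock h I q.1 q.2) q) (fun p => Sum.elim (fun _ => 0)
    (fun q => stageBlock Z p.1 q.1 p.2 q.2) q) p

section Entries

variable [Zero R] (h : Fin (G.m 0) → Fin (G.m 0) → R)
  (Z : ∀ k, Fin (G.m k) → Fin (G.m (k + 1)) → R)

theorem stageBlock_succ (k b a) : stageBlock Z k (k + 1) b a = Z k b a := by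
  simp [stageBlock]

theorem stageBlock_of_ne {k l : ℕ} (hl : l ≠ k + 1) (b a) : stageBlock Z k l b a = 0 := by
  simp [stageBlock, hl]

theorem transversalBlock_zero (I a) : transversalBlock h I 0 a = h I a := by
  simp [transversalBlock]

theorem transversalBlock_of_ne {l : ℕ} (hl : l ≠ 0) (I a) : transversalBlock h I l a = 0 := by
  simp [transversalBlock, hl]

theorem linMatrix_map {R' : Type*} [Zero R'] (f : R → R') (hf : f 0 = 0) :
    (linMatrix Ξ h Z).map f = linMatrix Ξ (fun I i => f (h I i)) fun k b a => f (Z k b a) := by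
  ext p q
  rcases p with I | ⟨k, b⟩ <;> rcases q with J | ⟨l, a⟩
  · exact hf
  · simp only [linMatrix, transversalBlock, Matrix.map_apply, Matrix.of_apply, Sum.elim_inl,
      Sum.elim_inr]
    split_ifs <;> simp [hf]
  · exact hf
  · simp only [linMatrix, stageBlock, Matrix.map_apply, Matrix.of_apply, Sum.elim_inr]
    split_ifs <;> simp [hf]

end Entries

section Sums

variable [NonUnitalNonAssocSemiring R] (h : Fin (G.m 0) → Fin (G.m 0) → R)
  (Z : ∀ k, Fin (G.m k) → Fin (G.m (k + 1)) → R) (F : ∀ l, Fin (G.m l) → R)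

theorem sum_stageBlock_mul (hm : G.m (G.L + 2) = 0) {k : ℕ} (hk : k < G.L + 2) (b : Fin (G.m k)) :
    ∑ q : Σ l : Fin (G.L + 2), Fin (G.m l), stageBlock Z k q.1 b q.2 * F q.1 q.2 =
      ∑ a, Z k b a * F (k + 1) a := by
  rw [Fintype.sum_sigma]
  by_cases hk' : k + 1 < G.L + 2
  · rw [Fintype.sum_eq_single (⟨k + 1, hk'⟩ : Fin (G.L + 2))]
    · exact Finset.sum_congr rfl fun a _ => by rw [stageBlock_succ]
    · intro l hl
      refine Finset.sum_eq_zero fun a _ => ?_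
      rw [stageBlock_of_ne, zero_mul]
      exact fun hh => hl (Fin.ext hh)
  -- At the last stage the right-hand sum is empty since `G.m (G.L + 2) = 0`, and no block on the
  -- left matches.
  · obtain rfl : k = G.L + 1 := by omega
    rw [Finset.sum_eq_zero, Finset.sum_eq_zero]
    · intro a _
      have : (a : ℕ) < G.m (G.L + 2) := a.2
      omega
    · intro l _
      refine Finset.sum_eq_zero fun a _ => ?_
      rw [stageBlock_of_ne, zero_mul]
      have := l.2
      omega

theorem sum_transversalBlock_mul (I : Fin (G.m 0)) :
    ∑ q : Σ l : Fin (G.L + 2), Fin (G.m l), transversalBlock h I q.1 q.2 * F q.1 q.2 =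
      ∑ a, h I a * F 0 a := by
  rw [Fintype.sum_sigma, Fintype.sum_eq_single (0 : Fin (G.L + 2))]
  · exact Finset.sum_congr rfl fun a _ => congrArg (· * F 0 a) (transversalBlock_zero h I a)
  · intro l hl
    refine Finset.sum_eq_zero fun a _ => ?_
    rw [transversalBlock_of_ne, zero_mul]
    exact fun hh => hl (Fin.ext hh)

theorem sum_mul_stageBlock {k : ℕ} (hk : k < G.L + 2) (a : Fin (G.m (k + 1))) :
    ∑ q : Σ l : Fin (G.L + 2), Fin (G.m l), F q.1 q.2 * stageBlock Z q.1 (k + 1) q.2 a =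
      ∑ b, F k b * Z k b a := by
  rw [Fintype.sum_sigma, Fintype.sum_eq_single (⟨k, hk⟩ : Fin (G.L + 2))]
  · exact Finset.sum_congr rfl fun a _ => by rw [stageBlock_succ]
  · intro l hl
    refine Finset.sum_eq_zero fun a _ => ?_
    rw [stageBlock_of_ne, mul_zero]
    exact fun hh => hl (Fin.ext (by simpa using hh.symm))

theorem sum_mul_stageBlock_zero (a : Fin (G.m 0)) :
    ∑ q : Σ l : Fin (G.L + 2), Fin (G.m l), F q.1 q.2 * stageBlock Z q.1 0 q.2 a = 0 :=
  Finset.sum_eq_zero fun q _ => by rw [stageBlock_of_ne _ (by omega), mul_zero]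

theorem linMatrix_mul_self (hm : G.m (G.L + 2) = 0) (h1 : ∀ I ∈ Ξ, ∀ a, ∑ i, h I i * Z 0 i a = 0)
    (h2 : ∀ k c a, ∑ b, Z k c b * Z (k + 1) b a = 0) :
    linMatrix Ξ h Z * linMatrix Ξ h Z = 0 := by
  ext p q
  rw [Matrix.mul_apply, Fintype.sum_sum_type]
  rcases q with J | ⟨l, a⟩
  · rcases p with I | ⟨k, b⟩ <;> simp [linMatrix]
  rcases p with I | ⟨k, b⟩
  · simp only [linMatrix, Matrix.of_apply, Sum.elim_inl, Sum.elim_inr, zero_mul,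
      Finset.sum_const_zero, zero_add]
    rw [sum_transversalBlock_mul h (fun k b => stageBlock Z k l b a)]
    by_cases hl : (l : ℕ) = 0 + 1
    · obtain ⟨l, hl'⟩ := l
      simp only at hl
      subst hl
      simp only [stageBlock_succ]
      exact h1 I I.2 a
    · simp [stageBlock_of_ne Z hl]
  · simp only [linMatrix, Matrix.of_apply, Sum.elim_inl, Sum.elim_inr, zero_mul,
      Finset.sum_const_zero, zero_add]
    rw [sum_stageBlock_mul Z (fun k b => stageBlock Z k l b a) hm k.2]
    by_cases hl : (l : ℕ) = k + 1 + 1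
    · obtain ⟨l, hl'⟩ := l
      simp only at hl
      subst hl
      simp only [stageBlock_succ]
      exact h2 k b a
    · simp [stageBlock_of_ne Z hl]

end Sums

end BigMatrix

end GaugeData

/-! ### Contracting homotopies -/

/-- The quadratic form of the Laplacian at `v` is `|vD|² + |Dv|²`, so its kernel consists of the
harmonic vectors. -/
theorem det_laplacian_ne_zero {n : Type*} [Fintype n] [DecidableEq n] {D : Matrix n n ℝ}
    (h : ∀ v, D.mulVec v = 0 → Matrix.vecMul v D = 0 → v = 0) :
    (D * D.transpose + D.transpose * D).det ≠ 0 := by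
  intro hd
  obtain ⟨v, hv, hv0⟩ := Matrix.exists_mulVec_eq_zero_iff.2 hd
  have h1 : v ⬝ᵥ (D * D.transpose + D.transpose * D).mulVec v = 0 := by rw [hv0, dotProduct_zero]
  rw [Matrix.add_mulVec, dotProduct_add, ← Matrix.mulVec_mulVec, ← Matrix.mulVec_mulVec,
    Matrix.dotProduct_mulVec, Matrix.dotProduct_mulVec v D.transpose, Matrix.vecMul_transpose,
    Matrix.mulVec_transpose] at h1
  have h2 : 0 ≤ Matrix.vecMul v D ⬝ᵥ Matrix.vecMul v D :=
    Finset.sum_nonneg fun i _ => mul_self_nonneg _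
  have h3 : 0 ≤ D.mulVec v ⬝ᵥ D.mulVec v := Finset.sum_nonneg fun i _ => mul_self_nonneg _
  refine hv (h v ?_ ?_)
  · exact dotProduct_self_eq_zero.1 (by linarith)
  · exact dotProduct_self_eq_zero.1 (by linarith)

theorem eq_zero_of_mulVec_of_vecMul {m n : Type*} [Fintype m] [Fintype n] {B : Matrix m n ℝ}
    {u : n → ℝ} (h : Matrix.vecMul (B.mulVec u) B = 0) : B.mulVec u = 0 := by
  refine dotProduct_self_eq_zero.1 ?_
  rw [Matrix.dotProduct_mulVec, h, zero_dotProduct]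

/-- A contracting homotopy from an invertible Laplacian. -/
theorem exists_homotopy_of_isUnit {R : Type*} [Ring R] {D σ : R} (hD : D * D = 0)
    (hE : IsUnit (D * σ + σ * D)) : ∃ s, D * s + s * D = 1 := by
  obtain ⟨u, hu⟩ := hE
  -- Since `D² = 0`, multiplying `Dσ + σD` by `D` on either side gives `DσD`.
  have hcomm : Commute (u : R) D := by
    rw [hu]
    change (D * σ + σ * D) * D = D * (D * σ + σ * D)
    rw [add_mul, mul_add, mul_assoc σ, hD, ← mul_assoc D D, hD]
    simp [mul_assoc]
  have hcomm' : (↑u⁻¹ : R) * D = D * ↑u⁻¹ := hcomm.units_inv_left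
  refine ⟨σ * ↑u⁻¹, ?_⟩
  rw [mul_assoc, hcomm', ← mul_assoc, ← mul_assoc, ← add_mul, ← hu, Units.mul_inv]

namespace SuperFun

variable {V : Type*} [Fintype V] [LinearOrder V] {π : V → ZMod 2} {W : Opens (EvenIdx π → ℝ)}
  {n : Type*} [Fintype n] [DecidableEq n]

theorem gradedTwist_add (ρ : n → ZMod 2) (M N : Matrix n n (SuperFun π W)) :
    gradedTwist ρ (M + N) = gradedTwist ρ M + gradedTwist ρ N := by
  ext1 i j
  simp [gradedTwist]

theorem gradedTwist_smul (ρ : n → ZMod 2) (c : ℝ) (M : Matrix n n (SuperFun π W)) :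
    gradedTwist ρ (c • M) = c • gradedTwist ρ M := by
  ext1 i j
  simp only [gradedTwist, Matrix.of_apply, Matrix.smul_apply, map_smul]
  rw [smul_comm]

theorem gradedTwist_gradedTwist (ρ : n → ZMod 2) (M : Matrix n n (SuperFun π W)) :
    gradedTwist ρ (gradedTwist ρ M) = M := by
  ext1 i j
  simp [gradedTwist, smul_smul]

/-- The odd part of a contracting homotopy of an odd differential is a contracting homotopy. -/
theorem exists_odd_homotopy {ρ : n → ZMod 2} {D s : Matrix n n (SuperFun π W)}
    (hD : ∀ i j, HasParity (D i j) (1 + ρ i + ρ j)) (hs : D * s + s * D = 1) :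
    ∃ s' : Matrix n n (SuperFun π W), D * s' + s' * D = 1 ∧
      ∀ i j, HasParity (s' i j) (1 + ρ i + ρ j) := by
  have hD' := gradedTwist_eq_iff.2 hD
  rw [sgn_one, neg_one_smul] at hD'
  have h1 := congrArg (gradedTwist ρ) hs
  rw [gradedTwist_add, gradedTwist_mul, gradedTwist_mul, gradedTwist_one, hD'] at h1
  -- The automorphism reverses the sign of `D`, so `-gradedTwist ρ s` is a homotopy as well; the
  -- average of the two is odd.
  refine ⟨(1 / 2 : ℝ) • (s + (-1 : ℝ) • gradedTwist ρ s), ?_, ?_⟩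
  · have h2 : D * (s + (-1 : ℝ) • gradedTwist ρ s) + (s + (-1 : ℝ) • gradedTwist ρ s) * D =
        (2 : ℝ) • 1 := by
      rw [two_smul]
      nth_rewrite 1 [← hs]
      rw [← h1]
      simp only [neg_one_smul, mul_add, add_mul, mul_neg, neg_mul]
      abel
    rw [mul_smul_comm, smul_mul_assoc, ← smul_add, h2, smul_smul]
    norm_num
  · refine gradedTwist_eq_iff.1 ?_
    rw [gradedTwist_smul, gradedTwist_add, gradedTwist_smul, gradedTwist_gradedTwist, sgn_one,
      smul_comm (-1 : ℝ) (1 / 2 : ℝ)]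
    congr 1
    rw [smul_add, smul_smul, add_comm]
    norm_num

end SuperFun

/-! ### Exactness of the linear part at a stationary point. -/

namespace GaugeData

variable {G : GaugeData} {Ξ : Finset (Fin (G.m 0))}

/-- The homology of the linear part vanishes if its blocks form an exact sequence. -/
theorem linMatrix_exact (hm : G.m (G.L + 2) = 0) {h : Fin (G.m 0) → Fin (G.m 0) → ℝ}
    {Z : ∀ k, Matrix (Fin (G.m k)) (Fin (G.m (k + 1))) ℝ}
    (hrow : ∀ v : Ξ → ℝ, Matrix.vecMul v (Matrix.of fun (I : Ξ) i => h I i) = 0 → v = 0)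
    (h0 : ∀ v, (Matrix.of fun (I : Ξ) i => h I i).mulVec v = 0 → ∃ u, (Z 0).mulVec u = v)
    (hZ : ∀ k v, (Z k).mulVec v = 0 → ∃ u, (Z (k + 1)).mulVec u = v)
    {v : G.LinIdx Ξ → ℝ} (h1 : (linMatrix Ξ h Z).mulVec v = 0)
    (h2 : Matrix.vecMul v (linMatrix Ξ h Z) = 0) : v = 0 := by
  -- The antifield components of `v` by stage, continued by zero past the last stage so that all
  -- stages are treated alike.
  let F : ∀ l, Fin (G.m l) → ℝ := fun l a => if hl : l < G.L + 2 then v (Sum.inr ⟨⟨l, hl⟩, a⟩) else 0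
  have hF : ∀ q : Σ l : Fin (G.L + 2), Fin (G.m l), v (Sum.inr q) = F q.1 q.2 := fun q => by
    simp [F]
  have row0 : ∀ I : Ξ, ∑ i, h I i * F 0 i = 0 := by
    intro I
    have h3 := congrFun h1 (Sum.inl I)
    simp only [Matrix.mulVec, dotProduct, Fintype.sum_sum_type, hF] at h3
    simp only [linMatrix, Matrix.of_apply, Sum.elim_inl, Sum.elim_inr, zero_mul,
      Finset.sum_const_zero, zero_add] at h3
    rwa [sum_transversalBlock_mul h F] at h3
  have row : ∀ k, k < G.L + 2 → (Z k).mulVec (F (k + 1)) = 0 := by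
    intro k hk
    funext b
    have h3 := congrFun h1 (Sum.inr ⟨⟨k, hk⟩, b⟩)
    simp only [Matrix.mulVec, dotProduct, Fintype.sum_sum_type, hF] at h3
    simp only [linMatrix, Matrix.of_apply, Sum.elim_inl, Sum.elim_inr, zero_mul,
      Finset.sum_const_zero, zero_add] at h3
    rwa [sum_stageBlock_mul (Z := Z) F hm hk b] at h3
  have col0 : ∀ i, ∑ I : Ξ, v (Sum.inl I) * h I i = 0 := by
    intro i
    have h3 := congrFun h2 (Sum.inr ⟨0, i⟩)
    simp only [Matrix.vecMul, dotProduct, Fintype.sum_sum_type, hF] at h3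
    simp only [linMatrix, Matrix.of_apply, Sum.elim_inl, Sum.elim_inr] at h3
    rw [show ∑ q : Σ l : Fin (G.L + 2), Fin (G.m l), F q.1 q.2 *
      stageBlock Z q.1 ((0 : Fin (G.L + 2)) : ℕ) q.2 i = 0 from sum_mul_stageBlock_zero Z F i,
      add_zero] at h3
    rw [← show _ = (0 : ℝ) from h3]
    exact Finset.sum_congr rfl fun I _ => congrArg (v (Sum.inl I) * ·)
      (transversalBlock_zero h I i).symm
  have col : ∀ k, k + 1 < G.L + 2 → Matrix.vecMul (F k) (Z k) = 0 := by
    intro k hk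
    funext a
    have h3 := congrFun h2 (Sum.inr ⟨⟨k + 1, hk⟩, a⟩)
    simp only [Matrix.vecMul, dotProduct, Fintype.sum_sum_type, hF] at h3
    simp only [linMatrix, Matrix.of_apply, Sum.elim_inl, Sum.elim_inr,
      transversalBlock_of_ne h (Nat.succ_ne_zero k), mul_zero, Finset.sum_const_zero, zero_add] at h3
    rwa [sum_mul_stageBlock Z F (by omega) a] at h3
  have col' : ∀ k, k < G.L + 2 → Matrix.vecMul (F k) (Z k) = 0 := by
    intro k hk
    by_cases hk' : k + 1 < G.L + 2
    · exact col k hk'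
    · obtain rfl : k = G.L + 1 := by omega
      funext a
      have : (a : ℕ) < G.m (G.L + 2) := a.2
      omega
  -- Exactness turns `Dv = 0` into `F k ∈ im (Z k)`, while `vD = 0` says that `F k` is orthogonal to
  -- this image.
  have hFz : ∀ k, k < G.L + 2 → F k = 0 := by
    intro k hk
    cases k with
    | zero =>
      obtain ⟨u, hu⟩ := h0 (F 0) (funext fun I => row0 I)
      have h3 := col' 0 hk
      rw [← hu] at h3 ⊢
      exact eq_zero_of_mulVec_of_vecMul h3
    | succ k =>
      obtain ⟨u, hu⟩ := hZ k (F (k + 1)) (row k (by omega))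
      have h3 := col' (k + 1) hk
      rw [← hu] at h3 ⊢
      exact eq_zero_of_mulVec_of_vecMul h3
  have hΞ := hrow (fun I => v (Sum.inl I)) (funext fun i => col0 i)
  funext q
  rcases q with I | q
  · exact congrFun hΞ I
  · rw [hF, hFz _ q.1.2]; rfl

/-! ### Neighbourhoods on which the linear part is contractible. -/

section Local

variable {U : Opens (EvenIdx (G.ε 0) → ℝ)} {hU : U ≤ G.D}
  {y : Fin (G.m 0) → G.Fun U} {N : Fin (G.m 0) → Fin (G.m 0) → G.Fun U}
  {h : Fin (G.m 0) → Fin (G.m 0) → G.Fun U}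
  {Z₀ : ∀ k, Fin (G.m k) → Fin (G.m (k + 1)) → G.Fun U}

theorem IsLeadingCoeff.hasParity_linMatrix (hG : G.IsGaugeTheory) (hc : IsCoordSystem y N)
    (ha : IsAdapted Ξ y N) (hl : IsLeadingCoeff hU Ξ y N h Z₀) (p q : G.LinIdx Ξ) :
    HasParity (linMatrix Ξ h Z₀ p q) (1 + G.linParity Ξ p + G.linParity Ξ q) := by
  rcases p with I | ⟨k, b⟩ <;> rcases q with J | ⟨l, a⟩
  · exact hasParity_zero _
  · change HasParity (transversalBlock h I l a) _
    by_cases hl0 : (l : ℕ) = 0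
    · obtain ⟨l, hl'⟩ := l
      simp only at hl0
      subst hl0
      rw [transversalBlock_zero]
      have := hl.hasParity_h hG hc ha I.2 a
      convert this using 1
      simp only [linParity, Sum.elim_inl, Sum.elim_inr, Nat.cast_zero, add_zero]
      linear_combination zmod_two_one_add_one
    · rw [transversalBlock_of_ne h hl0]; exact hasParity_zero _
  · exact hasParity_zero _
  · change HasParity (stageBlock Z₀ k l b a) _
    by_cases hl0 : (l : ℕ) = k + 1
    · obtain ⟨l, hl'⟩ := l
      simp only at hl0
      subst hl0
      rw [stageBlock_succ]
      have := hl.hasParity_Z hG hc ha k b a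
      convert this using 1
      simp only [linParity, Sum.elim_inr, Nat.cast_add, Nat.cast_one]
      linear_combination (2 + ((k : ℕ) : ZMod 2)) * zmod_two_one_add_one
    · rw [stageBlock_of_ne Z₀ hl0]; exact hasParity_zero _

theorem IsLeadingCoeff.linMatrix_sq (hG : G.IsGaugeTheory) (hc : IsCoordSystem y N)
    (ha : IsAdapted Ξ y N) (hT : ∀ i, InIdeal Ξ y (G.T hU i)) (hl : IsLeadingCoeff hU Ξ y N h Z₀) :
    linMatrix Ξ h Z₀ * linMatrix Ξ h Z₀ = 0 :=
  linMatrix_mul_self h Z₀ (hG.m_eq_zero _ le_rfl) (fun _ hI a => hl.h_mul_Z hG hc ha hI a)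
    (fun k c a => hl.Z_mul_Z hG hc ha hT k c a)

theorem IsLeadingCoeff.det_laplacian (hG : G.IsGaugeTheory) {p} (hp : p ∈ G.stationary) (hpU : p ∈ U)
    (hc : G.IsTransversalLongitudinal hU Ξ y N) (ha : IsAdapted Ξ y N)
    (hl : IsLeadingCoeff hU Ξ y N h Z₀) :
    (bodyMatrix (linMatrix Ξ h Z₀) p * (bodyMatrix (linMatrix Ξ h Z₀) p).transpose +
      (bodyMatrix (linMatrix Ξ h Z₀) p).transpose * bodyMatrix (linMatrix Ξ h Z₀) p).det ≠ 0 := by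
  have hy : ∀ I ∈ Ξ, body (y I) p = 0 := fun I hI => hc.body_eq_zero hp hpU hI
  have hZ : ∀ k b a, body (Z₀ k b a) p = G.generator p k b a := by
    intro k b a
    have h1 := (hl.Z_sub k b a).body_eq_zero hy
    rw [body_sub, res_body _ _ hpU] at h1
    exact (sub_eq_zero.1 h1).symm
  let hb : Matrix Ξ (Fin (G.m 0)) ℝ := Matrix.of fun I i => body (h I i) p
  -- At `p`, where `ξ = 0`, only the linear term of `T_i = ξ^I h_{Ii} + O(ξ²)` contributes to the
  -- Hessian. Hence `h` has at least the rank of the Hessian, which is the number of transversal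
  -- fields.
  have hH : jacobianBody Ξ y p * hb = G.hessian p := by
    ext j i
    obtain ⟨g, hg⟩ := hl.T_sub i
    have hquad : ∀ I ∈ Ξ, ∀ K ∈ Ξ, body (dL j (y I * y K * g I K)) p = 0 := by
      intro I hI K hK
      rw [mul_assoc, dL_mul, body_add, body_mul, body_mul, body_mul, dL_mul, body_add, body_mul,
        body_mul, (hc.parity I).twist, (hc.parity K).twist, body_smul, body_smul, hy I hI, hy K hK]
      ring
    have hlin : ∀ I ∈ Ξ, body (dL j (y I * h I i)) p = body (dL j (y I)) p * body (h I i) p := by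
      intro I hI
      rw [dL_mul, body_add, body_mul, body_mul, (hc.parity I).twist, body_smul, hy I hI]
      ring
    rw [← body_dL_T hU hpU, sub_eq_iff_eq_add.1 hg, map_add, body_add]
    simp only [map_sum, body_sum]
    rw [Finset.sum_eq_zero fun I hI => Finset.sum_eq_zero fun K hK => hquad I hI K hK, zero_add,
      Finset.sum_congr rfl hlin, Matrix.mul_apply,
      ← Finset.sum_coe_sort Ξ fun I => body (dL j (y I)) p * body (h I i) p]
    rfl
  have hcard : Ξ.card = (G.hessian p).rank := by
    have := hc.card_eq.trans (hG.rank_hessian p hp).symm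
    exact_mod_cast this
  have hrank : Ξ.card ≤ hb.rank := by
    rw [hcard, ← hH]; exact Matrix.rank_mul_le_right _ _
  have hbZ : hb * G.generator p 0 = 0 := by
    ext I a
    have h1 := congrArg (fun f => body f p) (hl.h_mul_Z hG hc.isCoordSystem ha I.2 a)
    simp only [body_sum, body_mul, hZ, body_zero] at h1
    exact h1
  have hD : bodyMatrix (linMatrix Ξ h Z₀) p =
      linMatrix Ξ (fun I i => body (h I i) p) (G.generator p) := by
    have h1 := linMatrix_map (Ξ := Ξ) h Z₀ (fun f => body f p) (body_zero p)
    simp only [hZ] at h1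
    exact h1
  rw [hD]
  refine det_laplacian_ne_zero fun v h1 h2 => linMatrix_exact (hG.m_eq_zero _ le_rfl) (fun v hv => ?_)
    (fun v hv => ?_) (fun k v hv => ?_) h1 h2
  -- Independence of the rows of `h` is exactness at the end of the sequence, with a zero map of
  -- empty row type placed in front.
  · obtain ⟨u, hu⟩ := exists_vecMul_eq_of_rank (A := (0 : Matrix Empty Ξ ℝ)) (B := hb) (by simp)
      (by rw [Fintype.card_coe]; omega) hv
    rw [← hu]; simp
  · have := hG.rank_hessian_add hp
    exact exists_mulVec_eq_of_rank hbZ (by rw [Fintype.card_fin]; omega) hv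
  · exact exists_mulVec_eq_of_rank (hG.generator_mul_generator hp k)
      (by rw [Fintype.card_fin, hG.rank_generator_add hp]) hv

/-- Near a stationary point, the expansions exist and the linear part of the Koszul-Tate operator
has a contracting homotopy. -/
theorem IsGaugeTheory.exists_good_nhd (hG : G.IsGaugeTheory) {p} (hp : p ∈ G.stationary)
    (hpU : p ∈ U) (hc : G.IsTransversalLongitudinal hU Ξ y N) :
    ∃ (U' : Opens (EvenIdx (G.ε 0) → ℝ)) (h' : U' ≤ U), p ∈ U' ∧
      IsAdapted Ξ (fun j => res h' (y j)) (fun j i => res h' (N j i)) ∧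
      (∀ i, InIdeal Ξ (fun j => res h' (y j)) (G.T (h'.trans hU) i)) ∧
      ∃ h Z₀, IsLeadingCoeff (h'.trans hU) Ξ (fun j => res h' (y j)) (fun j i => res h' (N j i)) h Z₀ ∧
        ∃ s : Matrix (G.LinIdx Ξ) (G.LinIdx Ξ) (G.Fun U'),
          linMatrix Ξ h Z₀ * s + s * linMatrix Ξ h Z₀ = 1 ∧
          ∀ i j, HasParity (s i j) (1 + G.linParity Ξ i + G.linParity Ξ j) := by
  obtain ⟨U₁, k₁, hp₁, hT₁⟩ := hG.exists_T_inIdeal hp hpU hc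
  have hc₁ := hc.res k₁
  obtain ⟨U₂, k₂, hp₂, ha₂⟩ := hc₁.isCoordSystem.exists_isAdapted (Ξ := Ξ) hp₁
    fun I hI _ => hc₁.body_eq_zero hp hp₁ hI
  have hc₂ := hc₁.res k₂
  have hT₂ : ∀ i, InIdeal Ξ (fun j => res k₂ (res k₁ (y j))) (G.T ((k₂.trans k₁).trans hU) i) := by
    intro i
    rw [← T_res (hU := k₁.trans hU) k₂]
    exact InIdeal_res k₂ (hT₁ i)
  obtain ⟨h, Z₀, hl⟩ := hc₂.exists_isLeadingCoeff ha₂ hT₂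
  set D := linMatrix Ξ h Z₀ with hDdef
  -- With the constant matrix `σ = D(p)ᵀ` the body of `Dσ + σD` at `p` is the Laplacian, so it is
  -- invertible on a neighbourhood.
  obtain ⟨U₃, k₃, hp₃, hu⟩ := exists_isUnit_res
    (D * constMatrix U₂ (bodyMatrix D p).transpose + constMatrix U₂ (bodyMatrix D p).transpose * D)
    hp₂ (by
      have : bodyMatrix (D * constMatrix U₂ (bodyMatrix D p).transpose +
          constMatrix U₂ (bodyMatrix D p).transpose * D) p =
          bodyMatrix D p * (bodyMatrix D p).transpose +
            (bodyMatrix D p).transpose * bodyMatrix D p := by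
        have hσ := bodyMatrix_constMatrix (bodyMatrix D p).transpose hp₂
        change bodyMatrix (D * constMatrix U₂ (bodyMatrix D p).transpose) p +
          bodyMatrix (constMatrix U₂ (bodyMatrix D p).transpose * D) p = _
        rw [bodyMatrix_mul, bodyMatrix_mul, hσ]
      rw [this]
      exact hl.det_laplacian hG hp hp₂ hc₂ ha₂)
  have hc₃ := hc₂.res k₃
  -- Adaptedness need not survive the restriction to `U₃`, so an adapted neighbourhood is chosen
  -- once more inside it.
  obtain ⟨U₄, k₄, hp₄, ha₄⟩ := hc₃.isCoordSystem.exists_isAdapted (Ξ := Ξ) hp₃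
    fun I hI _ => hc₃.body_eq_zero hp hp₃ hI
  have hc₄ := hc₃.res k₄
  have hl₄ := hl.res (k₄.trans k₃)
  have hT₄ : ∀ i, InIdeal Ξ (fun j => res (k₄.trans k₃) (res k₂ (res k₁ (y j))))
      (G.T ((k₄.trans k₃).trans ((k₂.trans k₁).trans hU)) i) := by
    intro i
    rw [← T_res (hU := (k₂.trans k₁).trans hU) (k₄.trans k₃)]
    exact InIdeal_res (k₄.trans k₃) (hT₂ i)
  have hu₄ := hu.map (RingHom.mapMatrix (resHom k₄))
  simp only [res_res] at ha₄ hc₄ hl₄ hT₄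
  refine ⟨U₄, ((k₄.trans k₃).trans k₂).trans k₁, hp₄, ha₄, hT₄, _, _, hl₄, ?_⟩
  have hD₄ : linMatrix Ξ (fun I i => res (k₄.trans k₃) (h I i))
      (fun k b a => res (k₄.trans k₃) (Z₀ k b a)) = D.map (resHom (k₄.trans k₃)) :=
    (linMatrix_map h Z₀ _ (resHom (k₄.trans k₃)).map_zero).symm
  have hsq := hl₄.linMatrix_sq hG hc₄.isCoordSystem ha₄ hT₄
  obtain ⟨s, hs⟩ := exists_homotopy_of_isUnit hsq
    (σ := (constMatrix U₂ (bodyMatrix D p).transpose).map (resHom (k₄.trans k₃))) (by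
      rw [hD₄, ← Matrix.map_mul, ← Matrix.map_mul, ← Matrix.map_add _ (map_add _)]
      convert hu₄ using 1
      ext1 i j
      exact (res_res k₃ k₄ _).symm)
  exact exists_odd_homotopy (hl₄.hasParity_linMatrix hG hc₄.isCoordSystem ha₄) hs

end Local

end GaugeData

namespace SuperFun

/-! ### Adding variables -/

section Lift

variable {V V' : Type*} [Fintype V] [LinearOrder V] [Fintype V'] [LinearOrder V']
  {π : V → ZMod 2} {π' : V' → ZMod 2} (j : V ↪o V') (hj : ∀ v, π' (j v) = π v)
  {W : Opens (EvenIdx π → ℝ)}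

theorem lift_apply_map (f : SuperFun π W) (A : Finset (OddIdx π)) (x) :
    (lift j hj f).1 (A.map (oddIncl j hj)) x = f.1 A (proj j hj x) := by
  refine (Finset.sum_eq_single A (fun B _ hB => if_neg fun h => hB ?_) (by simp)).trans (if_pos rfl)
  exact Finset.map_injective _ h

theorem lift_apply_of_ne (f : SuperFun π W) {S : Finset (OddIdx π')}
    (hS : ∀ A : Finset (OddIdx π), A.map (oddIncl j hj) ≠ S) : (lift j hj f).1 S = 0 := by
  funext x
  exact Finset.sum_eq_zero fun A _ => if_neg (hS A)

/-- Superfunctions are equal if they agree with lifts on the monomials in the old odd variables, and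
vanish on all others. -/
theorem eq_lift_iff (f : SuperFun π W) (F : SuperFun π' (cylinder j hj W))
    (h1 : ∀ (A : Finset (OddIdx π)) x, x ∈ cylinder j hj W →
      F.1 (A.map (oddIncl j hj)) x = f.1 A (proj j hj x))
    (h2 : ∀ S, (∀ A : Finset (OddIdx π), A.map (oddIncl j hj) ≠ S) →
      ∀ x ∈ cylinder j hj W, F.1 S x = 0) : F = lift j hj f := by
  refine ext_apply fun S x hx => ?_
  by_cases hS : ∃ A : Finset (OddIdx π), A.map (oddIncl j hj) = S
  · obtain ⟨A, rfl⟩ := hS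
    rw [lift_apply_map, h1 A x hx]
  · push Not at hS
    rw [lift_apply_of_ne j hj f hS, h2 S hS x hx]
    rfl

theorem inversions_map (A B : Finset (OddIdx π)) :
    inversions (A.map (oddIncl j hj)) (B.map (oddIncl j hj)) = inversions A B := by
  unfold inversions
  rw [← Finset.prodMap_map_product, Finset.filter_map, Finset.card_map]
  congr 1
  refine Finset.filter_congr fun p _ => ?_
  exact j.lt_iff_lt

theorem lift_one : lift j hj (1 : SuperFun π W) = 1 := by
  refine (eq_lift_iff j hj _ _ (fun A x hx => ?_) fun S hS x hx => ?_).symm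
  · rw [one_apply _ hx, one_apply _ (show proj j hj x ∈ W from hx)]
    simp only [Finset.map_eq_empty]
  · rw [one_apply _ hx, if_neg]
    rintro rfl
    exact hS ∅ (Finset.map_empty _)

theorem lift_add (f g : SuperFun π W) : lift j hj (f + g) = lift j hj f + lift j hj g := by
  refine (eq_lift_iff j hj _ _ (fun A x hx => ?_) fun S hS x hx => ?_).symm
  · rw [add_apply, lift_apply_map, lift_apply_map, add_apply]
  · rw [add_apply, lift_apply_of_ne j hj _ hS, lift_apply_of_ne j hj _ hS]
    simp

theorem lift_mul (f g : SuperFun π W) : lift j hj (f * g) = lift j hj f * lift j hj g := by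
  refine (eq_lift_iff j hj _ _ (fun A x hx => ?_) fun S hS x hx => ?_).symm
  · have e : (A.map (oddIncl j hj)).powerset =
        A.powerset.map ⟨Finset.map (oddIncl j hj), Finset.map_injective _⟩ := by
      ext B
      simp only [Finset.mem_powerset, Finset.subset_map_iff, Finset.mem_map,
        Function.Embedding.coeFn_mk, eq_comm]
    rw [mul_apply, mul_apply, e, Finset.sum_map]
    refine Finset.sum_congr rfl fun B _ => ?_
    rw [Function.Embedding.coeFn_mk, ← Finset.map_sdiff, inversions_map, lift_apply_map,
      lift_apply_map]
  · rw [mul_apply]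
    refine Finset.sum_eq_zero fun B hB => ?_
    -- If `S` contains a new odd variable, so does `B` or `S \ B`, and the corresponding factor
    -- vanishes.
    by_cases h1 : ∃ A : Finset (OddIdx π), A.map (oddIncl j hj) = B
    · obtain ⟨A, rfl⟩ := h1
      rw [lift_apply_of_ne j hj g, Pi.zero_apply]
      · simp
      · intro A' h2
        refine hS (A ∪ A') ?_
        rw [Finset.map_union, h2, Finset.union_sdiff_of_subset (Finset.mem_powerset.1 hB)]
    · push Not at h1
      rw [lift_apply_of_ne j hj f h1]
      simp

/-- `lift` as a ring homomorphism. -/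
noncomputable def liftHom : SuperFun π W →+* SuperFun π' (cylinder j hj W) :=
  RingHom.mk' ⟨⟨lift j hj, lift_one j hj⟩, lift_mul j hj⟩ (lift_add j hj)

theorem HasParity.lift {f : SuperFun π W} {a : ZMod 2} (hf : HasParity f a) :
    HasParity (SuperFun.lift j hj f) a := by
  intro S hS
  by_cases h1 : ∃ A : Finset (OddIdx π), A.map (oddIncl j hj) = S
  · obtain ⟨A, rfl⟩ := h1
    rw [Finset.card_map] at hS
    funext x
    rw [lift_apply_map, hf A hS]
    rfl
  · push Not at h1
    exact lift_apply_of_ne j hj f h1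

theorem dL_lift_even_apply {v : V'} (hv : π' v = 0) (f : SuperFun π W) (A : Finset (OddIdx π)) {x}
    (hx : x ∈ cylinder j hj W) :
    (dL v (lift j hj f)).1 (A.map (oddIncl j hj)) x =
      fderiv ℝ (f.1 A) (proj j hj x) (proj j hj (Pi.single ⟨v, hv⟩ 1)) := by
  rw [dL_even_apply hv _ _ hx]
  let L : (EvenIdx π' → ℝ) →L[ℝ] (EvenIdx π → ℝ) := ContinuousLinearMap.pi fun v =>
    ContinuousLinearMap.proj (R := ℝ) (φ := fun _ => ℝ) (⟨j v.1, (hj v.1).trans v.2⟩ : EvenIdx π')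
  have h1 : (lift j hj f).1 (A.map (oddIncl j hj)) = f.1 A ∘ L := by
    funext x
    exact lift_apply_map j hj f A x
  rw [h1]
  have h2 : DifferentiableAt ℝ (f.1 A) (L x) := differentiableAt f A hx
  rw [(h2.hasFDerivAt.comp x L.hasFDerivAt).fderiv]
  rfl

theorem dL_lift_even_of_ne {v : V'} (hv : π' v = 0) (f : SuperFun π W) {S : Finset (OddIdx π')}
    (hS : ∀ A : Finset (OddIdx π), A.map (oddIncl j hj) ≠ S) {x} (hx : x ∈ cylinder j hj W) :
    (dL v (lift j hj f)).1 S x = 0 := by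
  rw [dL_even_apply hv _ _ hx, lift_apply_of_ne j hj f hS]
  simp

theorem dL_lift (v : V) (f : SuperFun π W) : dL (j v) (lift j hj f) = lift j hj (dL v f) := by
  refine eq_lift_iff j hj _ _ (fun A x hx => ?_) fun S hS x hx => ?_
  · by_cases hv : π v = 0
    · rw [dL_lift_even_apply j hj ((hj v).trans hv) f A hx,
        dL_even_apply hv _ _ (show proj j hj x ∈ W from hx)]
      congr 1
      funext w
      simp only [proj, Pi.single_apply, Subtype.ext_iff, j.injective.eq_iff]
    · have hv' : π' (j v) ≠ 0 := fun h => hv ((hj v).symm.trans h)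
      rw [dL_odd_apply hv', dL_odd_apply hv]
      have e : (⟨j v, hv'⟩ : OddIdx π') = oddIncl j hj ⟨v, hv⟩ := rfl
      rw [e, ← Finset.map_insert, lift_apply_map, ← Finset.map_singleton, inversions_map]
      simp only [Finset.mem_map']
  · by_cases hv : π v = 0
    · exact dL_lift_even_of_ne j hj ((hj v).trans hv) f hS hx
    · have hv' : π' (j v) ≠ 0 := fun h => hv ((hj v).symm.trans h)
      rw [dL_odd_apply hv']
      split_ifs with hm
      · rfl
      · rw [lift_apply_of_ne, Pi.zero_apply, mul_zero]
        intro A hA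
        refine hS (A.erase ⟨v, hv⟩) ?_
        have e : (⟨j v, hv'⟩ : OddIdx π') = oddIncl j hj ⟨v, hv⟩ := rfl
        rw [Finset.map_erase, hA, ← e, Finset.erase_insert hm]

theorem dL_lift_of_notMem {v : V'} (hv : v ∉ Set.range j) (f : SuperFun π W) :
    dL v (lift j hj f) = 0 := by
  refine ext_apply fun S x hx => ?_
  change _ = (0 : ℝ)
  by_cases hp : π' v = 0
  · by_cases hS : ∃ A : Finset (OddIdx π), A.map (oddIncl j hj) = S
    · obtain ⟨A, rfl⟩ := hS
      rw [dL_lift_even_apply j hj hp f A hx]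
      have : proj j hj (Pi.single ⟨v, hp⟩ 1) = 0 := by
        funext w
        simp only [proj, Pi.single_apply, Subtype.ext_iff]
        exact if_neg fun h => hv ⟨w.1, h⟩
      rw [this, map_zero]
    · push Not at hS
      exact dL_lift_even_of_ne j hj hp f hS hx
  · rw [dL_odd_apply hp]
    split_ifs with hm
    · rfl
    · rw [lift_apply_of_ne, Pi.zero_apply, mul_zero]
      intro A hA
      have h1 := hA ▸ Finset.mem_insert_self (⟨v, hp⟩ : OddIdx π') S
      obtain ⟨w, _, hw⟩ := Finset.mem_map.1 h1
      exact hv ⟨w.1, congrArg Subtype.val hw⟩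

theorem vectorField_lift (c : V' → SuperFun π' (cylinder j hj W)) (f : SuperFun π W) :
    vectorField c (lift j hj f) = ∑ v, c (j v) * lift j hj (dL v f) := by
  rw [vectorField_apply]
  refine (Fintype.sum_of_injective j j.injective _ _ (fun v hv => ?_) fun v => ?_).symm
  · rw [dL_lift_of_notMem j hj hv, mul_zero]
  · rw [dL_lift]

end Lift

end SuperFun

namespace GaugeData

/-! ### Vector fields on the space of fields and antifields -/

variable {G : GaugeData} {U : Opens (EvenIdx (G.ε 0) → ℝ)}

/-- `up` as a ring homomorphism. -/
noncomputable def upHom : G.Fun U →+* G.PhaseFun U := liftHom G.incl G.parity_incl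

theorem upHom_apply (f : G.Fun U) : upHom f = G.up f := rfl

/-- The labels of the antifields. -/
abbrev AntiIdx (G : GaugeData) : Type := Σ k : Fin (G.L + 2), Fin (G.m k)

/-- The vector field with components `a` along the original fields, and `b` along the antifields. -/
def phaseField (a : Fin (G.m 0) → G.PhaseFun U) (b : G.AntiIdx → G.PhaseFun U) (v : G.PhaseIdx) :
    G.PhaseFun U :=
  Sum.elim (fun α : G.FieldIdx => Fin.cases (motive := fun k => Fin (G.m k) → G.PhaseFun U) a
    (fun _ _ => 0) (ofLex α).1 (ofLex α).2) (fun α : G.FieldIdx => b (ofLex α)) (ofLex v)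

section PhaseField

variable (a : Fin (G.m 0) → G.PhaseFun U) (b : G.AntiIdx → G.PhaseFun U)

theorem phaseField_incl (i : Fin (G.m 0)) : phaseField a b (G.incl i) = a i := rfl

theorem phaseField_ghost (k : Fin (G.L + 1)) (c : Fin (G.m k.succ)) :
    phaseField a b (G.field k.succ c) = 0 := rfl

theorem phaseField_antifield (q : G.AntiIdx) : phaseField a b (G.antifield q.1 q.2) = b q := rfl

theorem phaseIdx_cases {P : G.PhaseIdx → Prop} (h1 : ∀ i, P (G.incl i))
    (h2 : ∀ (k : Fin (G.L + 1)) (c : Fin (G.m k.succ)), P (G.field k.succ c))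
    (h3 : ∀ q : G.AntiIdx, P (G.antifield q.1 q.2)) (v) : P v := by
  obtain ⟨k, c⟩ | q := v
  · revert c
    refine Fin.cases (fun c => h1 c) (fun k c => h2 k c) k
  · exact h3 q

theorem sum_phaseIdx {M : Type*} [AddCommMonoid M] (F : G.PhaseIdx → M) :
    ∑ v, F v = (∑ i, F (G.incl i) + ∑ k : Fin (G.L + 1), ∑ c : Fin (G.m k.succ),
      F (G.field k.succ c)) + ∑ q : G.AntiIdx, F (G.antifield q.1 q.2) := by
  have h1 : ∑ v, F v = ∑ v : G.FieldIdx ⊕ G.FieldIdx, F (toLex v) :=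
    (Fintype.sum_equiv toLex _ _ fun _ => rfl).symm
  have h2 : ∀ F' : G.FieldIdx → M, ∑ v, F' v = ∑ q : G.AntiIdx, F' (toLex q) := fun F' =>
    (Fintype.sum_equiv toLex _ _ fun _ => rfl).symm
  rw [h1, Fintype.sum_sum_type, h2, h2, Fintype.sum_sigma, Fin.sum_univ_succ]
  rfl

theorem vectorField_phaseField (f : G.PhaseFun U) :
    vectorField (phaseField a b) f = ∑ i, a i * dL (G.incl i) f +
      ∑ q : G.AntiIdx, b q * dL (G.antifield q.1 q.2) f := by
  rw [vectorField_apply, sum_phaseIdx]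
  simp only [phaseField_incl, phaseField_ghost, phaseField_antifield, zero_mul,
    Finset.sum_const_zero, add_zero]

end PhaseField

/-! ### Linear vector fields and their matrices. -/

section LinField

variable (Ξ : Finset (Fin (G.m 0))) (y : Fin (G.m 0) → G.Fun U)
  (N : Fin (G.m 0) → Fin (G.m 0) → G.Fun U)

/-- The transversal fields and the antifields, as functions on the phase space. -/
noncomputable def linCoord : G.LinIdx Ξ → G.PhaseFun U :=
  Sum.elim (fun I => G.up (y I)) fun q => var (G.antifield q.1 q.2)

/-- The linear function of the transversal fields and antifields with coefficients `A`. -/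
noncomputable def linFun (A : G.LinIdx Ξ → G.Fun U) : G.PhaseFun U :=
  ∑ p, linCoord Ξ y p * G.up (A p)

/-- The linear vector field with matrix `A` in the transversal fields and the antifields. -/
noncomputable def linField (A : Matrix (G.LinIdx Ξ) (G.LinIdx Ξ) (G.Fun U)) :
    G.PhaseIdx → G.PhaseFun U :=
  phaseField (fun i => ∑ I : Ξ, linFun Ξ y (fun p => A p (Sum.inl I)) * G.up (N I i))
    fun q => linFun Ξ y fun p => A p (Sum.inr q)

variable {Ξ y N}

theorem linFun_add (A B : G.LinIdx Ξ → G.Fun U) :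
    linFun Ξ y (fun p => A p + B p) = linFun Ξ y A + linFun Ξ y B := by
  simp only [linFun, ← upHom_apply, map_add, mul_add, Finset.sum_add_distrib]

theorem linFun_zero : linFun Ξ y (fun _ => (0 : G.Fun U)) = 0 := by
  simp only [linFun, ← upHom_apply, map_zero, mul_zero, Finset.sum_const_zero]

theorem linFun_one (q : G.LinIdx Ξ) :
    linFun Ξ y (fun p => (1 : Matrix (G.LinIdx Ξ) (G.LinIdx Ξ) (G.Fun U)) p q) = linCoord Ξ y q := by
  rw [linFun, Fintype.sum_eq_single q]
  · rw [Matrix.one_apply_eq, ← upHom_apply, map_one, mul_one]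
  · intro p hp
    rw [Matrix.one_apply_ne hp, ← upHom_apply, map_zero, mul_zero]

theorem linFun_mul (A B : Matrix (G.LinIdx Ξ) (G.LinIdx Ξ) (G.Fun U)) (q) :
    linFun Ξ y (fun p => (A * B) p q) = ∑ p, linFun Ξ y (fun p' => A p' p) * G.up (B p q) := by
  simp only [linFun, Matrix.mul_apply, ← upHom_apply, map_sum, map_mul, Finset.mul_sum,
    Finset.sum_mul, mul_assoc]
  rw [Finset.sum_comm]

theorem hasParity_linCoord (hy : ∀ j, HasParity (y j) (G.ε 0 j)) (p : G.LinIdx Ξ) :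
    HasParity (linCoord Ξ y p) (G.linParity Ξ p) := by
  rcases p with I | q
  · exact (hy I).lift G.incl G.parity_incl
  · exact hasParity_var _

theorem hasParity_linFun (hy : ∀ j, HasParity (y j) (G.ε 0 j)) {A : G.LinIdx Ξ → G.Fun U}
    {e : ZMod 2} (hA : ∀ p, HasParity (A p) (e + G.linParity Ξ p)) : HasParity (linFun Ξ y A) e := by
  refine HasParity.sum fun p _ => ?_
  have := (hasParity_linCoord hy p).mul ((hA p).lift G.incl G.parity_incl)
  rw [show e = G.linParity Ξ p + (e + G.linParity Ξ p) by
    linear_combination -G.linParity Ξ p * zmod_two_one_add_one]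
  exact this

variable {A B : Matrix (G.LinIdx Ξ) (G.LinIdx Ξ) (G.Fun U)}

theorem isVectorField_linField (hc : IsCoordSystem y N)
    (hA : ∀ p q, HasParity (A p q) (1 + G.linParity Ξ p + G.linParity Ξ q)) :
    IsVectorField 1 (linField Ξ y N A) := by
  have hA' : ∀ q, HasParity (linFun Ξ y fun p => A p q) (1 + G.linParity Ξ q) := fun q =>
    hasParity_linFun hc.parity fun p => by convert hA p q using 1; ring
  refine phaseIdx_cases (fun i => ?_) (fun k c => ?_) fun q => ?_
  · rw [linField, phaseField_incl, parity_incl]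
    refine HasParity.sum fun I _ => ?_
    have := (hA' (Sum.inl I)).mul ((hc.isVectorField I i).lift G.incl G.parity_incl)
    rw [show 1 + G.ε 0 i = 1 + G.ε 0 I + (G.ε 0 I + G.ε 0 i) by
      linear_combination -G.ε 0 I * zmod_two_one_add_one]
    exact this
  · rw [linField, phaseField_ghost]
    exact hasParity_zero _
  · exact hA' (Sum.inr q)

theorem linField_up (f : G.Fun U) : vectorField (linField Ξ y N A) (G.up f) =
    ∑ I : Ξ, linFun Ξ y (fun p => A p (Sum.inl I)) * G.up (vectorField (N I) f) := by
  rw [up, vectorField_lift]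
  simp only [linField, phaseField_incl, Finset.sum_mul]
  rw [Finset.sum_comm]
  refine Finset.sum_congr rfl fun I _ => ?_
  rw [vectorField_apply, ← upHom_apply, map_sum, Finset.mul_sum]
  refine Finset.sum_congr rfl fun i _ => ?_
  rw [map_mul, mul_assoc]
  rfl

theorem linField_linCoord (hc : IsCoordSystem y N) (q : G.LinIdx Ξ) :
    vectorField (linField Ξ y N A) (linCoord Ξ y q) = linFun Ξ y fun p => A p q := by
  rcases q with I | q
  · change vectorField _ (G.up (y I)) = _
    rw [linField_up, Fintype.sum_eq_single I]
    · rw [hc.apply_coord, if_pos rfl, ← upHom_apply, map_one, mul_one]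
    · intro J hJ
      rw [hc.apply_coord, if_neg fun h => hJ (Subtype.ext h), ← upHom_apply, map_zero, mul_zero]
  · change vectorField _ (var _) = _
    rw [vectorField_var]
    rfl

/-- A linear vector field annihilates functions of the longitudinal fields. -/
theorem linField_up_of_const {f : G.Fun U} (hf : ∀ I ∈ Ξ, vectorField (N I) f = 0) :
    vectorField (linField Ξ y N A) (G.up f) = 0 := by
  rw [linField_up]
  refine Finset.sum_eq_zero fun I _ => ?_
  rw [hf I I.2, ← upHom_apply, map_zero, mul_zero]

/-- A vertical linear vector field annihilates functions of the original fields. -/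
theorem linField_up_of_vertical (hA : ∀ p (I : Ξ), A p (Sum.inl I) = 0) (f : G.Fun U) :
    vectorField (linField Ξ y N A) (G.up f) = 0 := by
  rw [linField_up]
  refine Finset.sum_eq_zero fun I _ => ?_
  simp only [hA, linFun_zero, zero_mul]

/-- When the field annihilates the coefficients, it acts on the linear coordinates only, and
composition becomes matrix multiplication. -/
theorem linField_linFun (hc : IsCoordSystem y N)
    (hA : ∀ p q, HasParity (A p q) (1 + G.linParity Ξ p + G.linParity Ξ q)) {q : G.LinIdx Ξ}
    (hB : ∀ p, vectorField (linField Ξ y N A) (G.up (B p q)) = 0) :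
    vectorField (linField Ξ y N A) (linFun Ξ y fun p => B p q) =
      linFun Ξ y fun p => (A * B) p q := by
  rw [linFun_mul, linFun, map_sum]
  refine Finset.sum_congr rfl fun p _ => ?_
  rw [(isVectorField_linField hc hA).map_mul, hB, mul_zero, add_zero, linField_linCoord hc]

variable (hc : IsCoordSystem y N)
  (hA : ∀ p q, HasParity (A p q) (1 + G.linParity Ξ p + G.linParity Ξ q))
  (hA0 : ∀ p (I : Ξ), A p (Sum.inl I) = 0)

include hc hA hA0

/-- The square of an odd vertical linear vector field. -/
theorem linField_linField (hAA : A * A = 0) (f : G.PhaseFun U) :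
    vectorField (linField Ξ y N A) (vectorField (linField Ξ y N A) f) = 0 := by
  have hv := isVectorField_linField hc hA
  -- The square of an odd field is half its graded commutator with itself, hence a vector field; it
  -- vanishes because its components do.
  have h1 : ∀ v, vectorField (linField Ξ y N A) (linField Ξ y N A v) = 0 := by
    refine phaseIdx_cases (fun i => ?_) (fun k c => ?_) fun q => ?_
    · rw [linField, phaseField_incl]
      simp only [hA0, linFun_zero, zero_mul, Finset.sum_const_zero, map_zero]
    · exact map_zero _
    · change vectorField (linField Ξ y N A) (linFun Ξ y fun p => A p (Sum.inr q)) = 0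
      rw [linField_linFun hc hA fun p => linField_up_of_vertical hA0 _, hAA]
      exact linFun_zero
  have h2 := hv.commutator hv f
  simp only [h1, smul_zero, sub_zero, mul_one, sgn_one, neg_smul, one_smul, sub_neg_eq_add] at h2
  have h3 : vectorField (fun _ : G.PhaseIdx => (0 : G.PhaseFun U)) f = 0 := by
    simp [vectorField_apply]
  rw [h3] at h2
  rw [← two_smul ℝ] at h2
  exact (smul_eq_zero.1 h2).resolve_left two_ne_zero

/-- The anticommutator of an odd vertical linear vector field with a contracting homotopy. -/
theorem linField_anticomm (hAc : ∀ p q, ∀ I ∈ Ξ, vectorField (N I) (A p q) = 0)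
    (hB : ∀ p q, HasParity (B p q) (1 + G.linParity Ξ p + G.linParity Ξ q))
    (hAB : A * B + B * A = 1) (f : G.PhaseFun U) :
    vectorField (linField Ξ y N A) (vectorField (linField Ξ y N B) f) +
      vectorField (linField Ξ y N B) (vectorField (linField Ξ y N A) f) =
        vectorField (linField Ξ y N 1) f := by
  have hvA := isVectorField_linField hc hA
  have hvB := isVectorField_linField hc hB
  have hAB' : ∀ q, vectorField (linField Ξ y N A) (linFun Ξ y fun p => B p q) =
      linFun Ξ y fun p => (A * B) p q := fun q =>
    linField_linFun hc hA fun p => linField_up_of_vertical hA0 _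
  have h1 : ∀ v, vectorField (linField Ξ y N A) (linField Ξ y N B v) +
      vectorField (linField Ξ y N B) (linField Ξ y N A v) = linField Ξ y N 1 v := by
    refine phaseIdx_cases (fun i => ?_) (fun k c => ?_) fun q => ?_
    -- The field of `A` has no component along the original fields, and it annihilates the factors
    -- `N I i`.
    · have h5 : linField Ξ y N A (G.incl i) = 0 := by
        rw [linField, phaseField_incl]
        simp only [hA0, linFun_zero, zero_mul, Finset.sum_const_zero]
      rw [h5, map_zero, add_zero]
      change vectorField (linField Ξ y N A)
        (∑ I : Ξ, linFun Ξ y (fun p => B p (Sum.inl I)) * G.up (N I i)) =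
        ∑ I : Ξ, linFun Ξ y (fun p => (1 : Matrix (G.LinIdx Ξ) (G.LinIdx Ξ) (G.Fun U)) p
          (Sum.inl I)) * G.up (N I i)
      rw [map_sum]
      refine Finset.sum_congr rfl fun I _ => ?_
      have h0 : (A * B) = 1 - B * A := eq_sub_of_add_eq hAB
      -- The columns of `A` labelled by transversal fields vanish, hence so do those of `B * A`, and
      -- there `A * B` alone is the identity.
      have h3 : ∀ p, (A * B) p (Sum.inl I) = (1 : Matrix (G.LinIdx Ξ) (G.LinIdx Ξ) (G.Fun U)) p (Sum.inl I) := by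
        intro p
        rw [h0, Matrix.sub_apply, Matrix.mul_apply]
        simp [hA0]
      have h4 := hvA.map_mul (linFun Ξ y fun p => B p (Sum.inl I)) (G.up (N I i))
      rw [linField_up_of_vertical hA0, mul_zero, add_zero, hAB'] at h4
      simp only [h3] at h4
      exact h4
    · change vectorField _ (0 : G.PhaseFun U) + vectorField _ (0 : G.PhaseFun U) = 0
      rw [map_zero, map_zero, add_zero]
    · change vectorField (linField Ξ y N A) (linFun Ξ y fun p => B p (Sum.inr q)) +
        vectorField (linField Ξ y N B) (linFun Ξ y fun p => A p (Sum.inr q)) =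
        linFun Ξ y fun p => (1 : Matrix (G.LinIdx Ξ) (G.LinIdx Ξ) (G.Fun U)) p (Sum.inr q)
      -- The field of `B` does move the transversal fields, but the entries of `A` do not depend on
      -- them. Nothing similar is needed of `B`, since the field of `A` is vertical.
      rw [hAB', linField_linFun hc hB fun p => linField_up_of_const (hAc p _), ← linFun_add, ← hAB]
      rfl
  have h2 := hvA.commutator hvB f
  simp only [mul_one, sgn_one, neg_smul, one_smul, sub_neg_eq_add, h1] at h2
  exact h2

end LinField

end GaugeData

namespace GaugeData

/-! ### The reduced Koszul-Tate operator -/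

variable {G : GaugeData} {U : Opens (EvenIdx (G.ε 0) → ℝ)} {Ξ : Finset (Fin (G.m 0))}
  {y : Fin (G.m 0) → G.Fun U} {N : Fin (G.m 0) → Fin (G.m 0) → G.Fun U}
  {h : Fin (G.m 0) → Fin (G.m 0) → G.Fun U} {Z₀ : ∀ k, Fin (G.m k) → Fin (G.m (k + 1)) → G.Fun U}

theorem up_zero : G.up (0 : G.Fun U) = 0 := (upHom (G := G) (U := U)).map_zero

theorem linMatrix_inl (p) (I : Ξ) : linMatrix Ξ h Z₀ p (Sum.inl I) = 0 := by
  rcases p with J | q <;> rfl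

theorem IsLeadingCoeff.linMatrix_const {hU : U ≤ G.D} (hl : IsLeadingCoeff hU Ξ y N h Z₀) (p q)
    (I : Fin (G.m 0)) (hI : I ∈ Ξ) : vectorField (N I) (linMatrix Ξ h Z₀ p q) = 0 := by
  rcases p with J | ⟨k, b⟩ <;> rcases q with J' | ⟨l, a⟩
  · exact map_zero _
  · change vectorField (N I) (transversalBlock h J l a) = 0
    unfold transversalBlock
    split_ifs
    · exact hl.h_const J J.2 _ I hI
    · exact map_zero _
  · exact map_zero _
  · change vectorField (N I) (stageBlock Z₀ k l b a) = 0
    unfold stageBlock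
    split_ifs
    · exact hl.Z_const k b _ I hI
    · exact map_zero _

theorem linFun_linMatrix_zero (i : Fin (G.m 0)) :
    linFun Ξ y (fun p => linMatrix Ξ h Z₀ p (Sum.inr ⟨0, i⟩)) =
      G.up (∑ I ∈ Ξ, y I * h I i) := by
  rw [linFun, Fintype.sum_sum_type]
  have h1 : ∀ q : G.AntiIdx, linMatrix Ξ h Z₀ (Sum.inr q) (Sum.inr ⟨0, i⟩) = 0 := fun q =>
    stageBlock_of_ne (k := q.1) (l := 0) Z₀ (by omega) q.2 i
  have h2 : ∀ I : Ξ, linMatrix Ξ h Z₀ (Sum.inl I) (Sum.inr ⟨0, i⟩) = h I i := fun I =>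
    transversalBlock_zero h I i
  simp only [h1, h2, up_zero, mul_zero, Finset.sum_const_zero, add_zero]
  rw [← Finset.sum_coe_sort Ξ fun I => y I * h I i]
  simp only [← upHom_apply, map_sum, map_mul]
  rfl

theorem linFun_linMatrix_succ (s : Fin (G.L + 1)) (a : Fin (G.m (s + 1))) :
    linFun Ξ y (fun p => linMatrix Ξ h Z₀ p (Sum.inr ⟨s.succ, a⟩)) =
      ∑ b : Fin (G.m s), var (G.antifield s.castSucc b) * G.up (Z₀ s b a) := by
  rw [linFun, Fintype.sum_sum_type]
  have h1 : ∀ I : Ξ, linMatrix Ξ h Z₀ (Sum.inl I) (Sum.inr ⟨s.succ, a⟩) = 0 := fun I =>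
    transversalBlock_of_ne h (by simp) I a
  simp only [h1, up_zero, mul_zero, Finset.sum_const_zero, zero_add]
  rw [Fintype.sum_sigma, Fintype.sum_eq_single s.castSucc]
  · refine Finset.sum_congr rfl fun b _ => ?_
    have h2 : linMatrix Ξ h Z₀ (Sum.inr ⟨s.castSucc, b⟩) (Sum.inr ⟨s.succ, a⟩) = Z₀ s b a :=
      stageBlock_succ Z₀ s b a
    rw [h2]
    rfl
  · intro l hl
    refine Finset.sum_eq_zero fun b _ => ?_
    have h2 : linMatrix Ξ h Z₀ (Sum.inr ⟨l, b⟩) (Sum.inr ⟨s.succ, a⟩) = 0 :=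
      stageBlock_of_ne Z₀ (fun hh => hl (Fin.ext (by simpa using hh.symm))) b a
    rw [h2, up_zero, mul_zero]

theorem koszulTate_eq :
    G.koszulTate (fun i => ∑ I ∈ Ξ, y I * h I i) Z₀ =
      vectorField (linField Ξ y N (linMatrix Ξ h Z₀)) := by
  refine LinearMap.ext fun f => ?_
  rw [linField, vectorField_phaseField]
  simp only [linMatrix_inl, linFun_zero, zero_mul, Finset.sum_const_zero, zero_add]
  rw [Fintype.sum_sigma, Fin.sum_univ_succ]
  simp only [koszulTate, LinearMap.add_apply, LinearMap.sum_apply, LinearMap.comp_apply,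
    mulLeft_apply]
  congr 1
  · refine Finset.sum_congr rfl fun i _ => ?_
    rw [← linFun_linMatrix_zero (Z₀ := Z₀)]
  · refine Finset.sum_congr rfl fun s _ => ?_
    rw [Finset.sum_comm]
    refine Finset.sum_congr rfl fun a _ => ?_
    rw [← Finset.sum_mul, ← linFun_linMatrix_succ (Ξ := Ξ) (y := y) (h := h)]

/-- With `K` as the field of the identity matrix, `D s + s D = 1` translates into `δη + ηδ = K`. -/
theorem euler_eq : G.euler Ξ y N = vectorField (linField Ξ y N 1) := by
  refine LinearMap.ext fun f => ?_
  rw [linField, vectorField_phaseField]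
  simp only [linFun_one, euler, LinearMap.add_apply, LinearMap.sum_apply, LinearMap.comp_apply,
    mulLeft_apply]
  congr 1
  · rw [← Finset.sum_coe_sort Ξ, Finset.sum_comm]
    refine Finset.sum_congr rfl fun i _ => ?_
    rw [Finset.sum_mul]
    exact Finset.sum_congr rfl fun I _ => (mul_assoc _ _ _).symm
  · rw [Fintype.sum_sigma]
    rfl

/-- An operator that has non-zero weight with respect to the anticommutator of two odd operators and
that commutes with the first one is a commutator. -/
theorem exists_eq_oddCommutator {δ η K X : G.Operator U} {r : ℝ} (hr : r ≠ 0)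
    (hδ : ∀ f, parityOp (δ f) = -δ (parityOp f)) (hη : ∀ f, parityOp (η f) = -η (parityOp f))
    (hK : ∀ f, δ (η f) + η (δ f) = K f) (hX : K ∘ₗ X - X ∘ₗ K = r • X)
    (h0 : G.oddCommutator δ X = 0) : ∃ Y, X = G.oddCommutator δ Y := by
  have hP : ∀ f : G.PhaseFun U, parityOp (parityOp f) = f := fun f => by
    rw [← twist_one, twist_twist_self]
  have h1 : ∀ f, δ (X f) = parityOp (X (parityOp (δ f))) := fun f =>
    sub_eq_zero.1 (LinearMap.congr_fun h0 f)
  -- The operator `X` need not be homogeneous. Conjugation by `parityOp` carries the signs of the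
  -- graded commutator, and this is the conjugate form of `[δ, X] = 0`.
  have h2 : ∀ f, X (δ f) = δ (parityOp (X (parityOp f))) := fun f => by
    have := congrArg parityOp (h1 (parityOp f))
    rw [hδ, hP, hδ, hP, map_neg, neg_inj] at this
    exact this.symm
  -- The witness is `r⁻¹ [η, X]`; the Jacobi identity is then checked by hand.
  refine ⟨r⁻¹ • (η ∘ₗ X - (parityOp ∘ₗ X ∘ₗ parityOp) ∘ₗ η), LinearMap.ext fun f => ?_⟩
  have h3 : K (X f) - X (K f) = r • X f := LinearMap.congr_fun hX f
  have h4 : parityOp (η (X (parityOp (δ f)))) = -η (δ (X f)) := by rw [hη, ← h1]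
  have h5 : parityOp (parityOp (X (parityOp (η (parityOp (δ f)))))) = -X (η (δ f)) := by
    rw [hP, hη, hP, map_neg]
  simp only [oddCommutator, LinearMap.sub_apply, LinearMap.comp_apply, LinearMap.smul_apply,
    map_smul, map_sub]
  rw [h4, h5, ← h2, ← smul_sub, eq_inv_smul_iff₀ hr, ← h3, ← hK, ← hK, map_add]
  abel

end GaugeData

/-! ### The local acyclicity theorem. -/

theorem mainTheorem3 (G : GaugeData) (hG : G.IsGaugeTheory)
    (p : EvenIdx (G.ε 0) → ℝ) (hp : p ∈ G.stationary) :
    (∃ (U : Opens (EvenIdx (G.ε 0) → ℝ)) (hU : U ≤ G.D) (Ξ : Finset (Fin (G.m 0)))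
      (y : Fin (G.m 0) → G.Fun U) (N : Fin (G.m 0) → Fin (G.m 0) → G.Fun U),
      p ∈ U ∧ G.IsTransversalLongitudinal hU Ξ y N) ∧
    ∀ (U' : Opens (EvenIdx (G.ε 0) → ℝ)) (hU' : U' ≤ G.D) (Ξ : Finset (Fin (G.m 0)))
      (y' : Fin (G.m 0) → G.Fun U') (N' : Fin (G.m 0) → Fin (G.m 0) → G.Fun U'),
      p ∈ U' → G.IsTransversalLongitudinal hU' Ξ y' N' →
      ∃ (U : Opens (EvenIdx (G.ε 0) → ℝ)) (hU : U ≤ U') (y : Fin (G.m 0) → G.Fun U)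
        (N : Fin (G.m 0) → Fin (G.m 0) → G.Fun U),
        p ∈ U ∧ y = (fun j => res hU (y' j)) ∧ N = (fun j i => res hU (N' j i)) ∧
        (∃ T₁ Z₀, G.IsLeading (hU.trans hU') Ξ y N T₁ Z₀) ∧
        ∀ T₁ Z₀, G.IsLeading (hU.trans hU') Ξ y N T₁ Z₀ →
          G.koszulTate T₁ Z₀ ∘ₗ G.koszulTate T₁ Z₀ = 0 ∧
          ∀ (X : G.Operator U) (r : ℤ), r ≠ 0 → G.HasRafn Ξ y N X r →
            G.oddCommutator (G.koszulTate T₁ Z₀) X = 0 →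
            ∃ Y : G.Operator U, X = G.oddCommutator (G.koszulTate T₁ Z₀) Y := by
  refine ⟨hG.exists_transversalLongitudinal hp, fun U' hU' Ξ y' N' hpU' hc' => ?_⟩
  obtain ⟨U, hU, hpU, ha, hT, h, Z₀, hl, s, hs, hs'⟩ := hG.exists_good_nhd hp hpU' hc'
  have hc := (hc'.res hU).isCoordSystem
  refine ⟨U, hU, _, _, hpU, rfl, rfl, ⟨_, _, hl.isLeading⟩, fun T₁ Z₁ hlead => ?_⟩
  obtain ⟨h₁, hl₁, hT₁⟩ := hlead.exists_coeff
  -- Uniqueness of leading terms identifies the arbitrary choice of `T₁` and `Z₁` with the one for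
  -- which the homotopy `s` was built.
  obtain rfl := hl.Z_unique hc ha hl₁
  obtain rfl : T₁ = fun i => ∑ I ∈ Ξ, res hU (y' I) * h I i := by
    funext i
    rw [hT₁]
    exact Finset.sum_congr rfl fun I hI => by rw [hl.h_unique hc ha hl₁ hI]
  rw [GaugeData.koszulTate_eq (N := fun j i => res hU (N' j i))]
  have hA := hl.hasParity_linMatrix hG hc ha
  have hP : ∀ {a}, IsVectorField 1 a → ∀ f : G.PhaseFun U,
      parityOp (vectorField a f) = -vectorField a (parityOp f) := fun hv f => by
    rw [← twist_one, hv.twist, mul_one, sgn_one, neg_one_smul]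
  refine ⟨LinearMap.ext fun f => GaugeData.linField_linField hc hA GaugeData.linMatrix_inl
    (hl.linMatrix_sq hG hc ha hT) f, fun X r hr hX h0 => ?_⟩
  rw [GaugeData.HasRafn, GaugeData.euler_eq] at hX
  exact GaugeData.exists_eq_oddCommutator (Int.cast_ne_zero.2 hr)
    (hP (GaugeData.isVectorField_linField hc hA)) (hP (GaugeData.isVectorField_linField hc hs'))
    (GaugeData.linField_anticomm hc hA GaugeData.linMatrix_inl (hl.linMatrix_const) hs' hs) hX h0
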